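/- **Setting.** An algebra is a complex associative algebra, not necessarily unital; $A\sqcup B$ denotes the free product (coproduct) of algebras. Let $\mathcal F=\{\circ,\bullet\}$. A *2-faced algebra* is an algebra $A$ that is freely generated by given subalgebras $A^{\circ},A^{\bullet}$ (its faces); homomorphisms of 2-faced algebras map $A^{f}$ into $B^{f}$ for each $f\in\mathcal F$; $A\sqcup B$ is 2-faced with $(A\sqcup B)^{f}=A^{f}\sqcup B^{f}$. A *2-faced universal product* assigns to linear functionals $\varphi_1,\varphi_2$ on 2-faced algebras $A_1,A_2$ a linear functional $\varphi_1\odot\varphi_2$ on $A_1\sqcup A_2$ such that $(\varphi_1\circ h_1)\odot(\varphi_2\circ h_2)=(\varphi_1\odot\varphi_2)\circ(h_1\sqcup h_2)$ for all homomorphisms $h_i:B_i\to A_i$ of 2-faced algebras, $(\varphi_1\odot\varphi_2)\odot\varphi_3=\varphi_1\odot(\varphi_2\odot\varphi_3)$, and $(\varphi_1\odot\varphi_2)|_{A_i}=\varphi_i$ (with the canonical identifications of free products). It is *symmetric* if $\varphi_1\odot\varphi_2=\varphi_2\odot\varphi_1$. A linear functional on a $*$-algebra is a *restricted state* if its unital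 extension to the unitization is positive; $\odot$ is *positive* if the product of restricted states on 2-faced $*$-algebras (the faces being $*$-subalgebras) is a restricted state on the free product $*$-algebra. $\odot$ is *unit preserving* if the following holds for all 2-faced algebras $A_1,A_2$ such that each face $A_i^{f}$ has a unit $1_i^{f}$, and all linear functionals $\varphi_i$ on $A_i$ with $\varphi_i(1_i^{f})=1$ for all $f\in\mathcal F$ which vanish on the two-sided ideal of $A_i$ generated by $\{1_i^{f}-1_i^{g}:f,g\in\mathcal F\}$: the functional $\varphi_1\odot\varphi_2$ vanishes on the two-sided ideal of $A_1\sqcup A_2$ generated by $\{1_i^{f}-1_j^{g}: i,j\in\{1,2\},\,f,g\in\mathcal F\}$ and $(\varphi_1\odot\varphi_2)(1_i^{f})=1$ for all $i,f$. A *2-faced partition* is a pair $(\pi,\mathbf f)$ of a word $\mathbf f\in\mathcal F^n$, $n\ge1$, and a set partition $\pi$ of the set of legs $\{1,\dots,n\}$. For $\mathbf s=(\mathbf b,\mathbf f)\in(\{1,\dots,k\}\times\mathcal F)^n$, a set partition $\pi$ is *adapted* to $\mathbf s$, $\pi\prec\mathbf s$, if $\mathbf b$ is constant on each block of $\pi$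 and $i,i+1$ lie in the same block whenever $\mathbf s(i)=\mathbf s(i+1)$. *Coefficients* of $\odot$ are complex numbers $\alpha^{\pi}_{\mathbf s}$ ($\pi\prec\mathbf s$) such that for all $k,n\geq 1$, all $\mathbf s$, all linear functionals $\varphi_1,\dots,\varphi_k$ on 2-faced algebras $A_1,\dots,A_k$ and all $a_\ell\in A_{\mathbf b(\ell)}^{\mathbf f(\ell)}$, $$(\varphi_1\odot\cdots\odot\varphi_k)(a_1\cdots a_n)=\sum_{\pi\prec\mathbf s}\alpha^{\pi}_{\mathbf s}\prod_{\kappa=1}^{k}\ \prod_{\beta\in\pi,\ \mathbf b|_\beta=\kappa}\varphi_\kappa\Bigl(\overrightarrow{\prod_{\ell\in\beta}}a_\ell\Bigr).$$ *Highest coefficients* of $\odot$ are numbers $\alpha_{(\pi,\mathbf f)}$, indexed by the 2-faced partitions, such that there are coefficients of $\odot$ with $\alpha_{(\pi,\mathbf f)}=\alpha^{\pi}_{(\mathbf b,\mathbf f)}$ for every 2-faced partition $(\pi,\mathbf f)$ and every enumeration $\beta_1,\dots,\beta_k$ of the blocks of $\pi$, where $\mathbf b(\ell)=\kappa$ for $\ell\in\beta_\kappa$.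 A leg $\ell$ of $\pi$ is *inner* if there are legs $i<\ell<j$ in a common block of $\pi$ not containing $\ell$; a block is inner if it contains an inner leg. $(\pi,\mathbf f)$ is *pure noncrossing* if $\pi$ is noncrossing and $\mathbf f$ is constant on every inner block. Let $\mathrm{pNC}_{\circ\bullet}$ be the set of all pure noncrossing 2-faced partitions. **Corollary 9.7 (2-faced unit preserving).** Let $\odot$ be a positive symmetric 2-faced universal product. Then $\odot$ has unique highest coefficients $\alpha_{(\pi,\mathbf f)}$, and, with $\Pi_\odot:=\{(\pi,\mathbf f):\alpha_{(\pi,\mathbf f)}\neq0\}$, the product $\odot$ is unit preserving if and only if $\mathrm{pNC}_{\circ\bullet}\subseteq\Pi_\odot$. -/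

import Mathlib

universe u v

/-! ## The free product of two (not necessarily unital) complex algebras

An algebra is a complex associative algebra, not necessarily unital. -/

namespace FreeProd

section Construction

variable (A : Type u) (B : Type v)
variable [NonUnitalRing A] [Module ℂ A] [NonUnitalRing B] [Module ℂ B]

/-- The relations making the two generating maps from `A` and from `B` linear and multiplicative. -/
inductive Rel : FreeAlgebra ℂ (A ⊕ B) → FreeAlgebra ℂ (A ⊕ B) → Prop
  | addL (a b : A) : Rel (FreeAlgebra.ι ℂ (Sum.inl (a + b)))
      (FreeAlgebra.ι ℂ (Sum.inl a) + FreeAlgebra.ι ℂ (Sum.inl b))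
  | smulL (c : ℂ) (a : A) : Rel (FreeAlgebra.ι ℂ (Sum.inl (c • a)))
      (c • FreeAlgebra.ι ℂ (Sum.inl a))
  | mulL (a b : A) : Rel (FreeAlgebra.ι ℂ (Sum.inl (a * b)))
      (FreeAlgebra.ι ℂ (Sum.inl a) * FreeAlgebra.ι ℂ (Sum.inl b))
  | addR (a b : B) : Rel (FreeAlgebra.ι ℂ (Sum.inr (a + b)))
      (FreeAlgebra.ι ℂ (Sum.inr a) + FreeAlgebra.ι ℂ (Sum.inr b))
  | smulR (c : ℂ) (a : B) : Rel (FreeAlgebra.ι ℂ (Sum.inr (c • a)))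
      (c • FreeAlgebra.ι ℂ (Sum.inr a))
  | mulR (a b : B) : Rel (FreeAlgebra.ι ℂ (Sum.inr (a * b)))
      (FreeAlgebra.ι ℂ (Sum.inr a) * FreeAlgebra.ι ℂ (Sum.inr b))

/-- The unital algebra generated by `A` and `B`, where possible units of `A` and `B` are not
identified with the new unit; it is the unitization of the free product. -/
abbrev Ambient : Type (max u v) := RingQuot (Rel A B)

/-- The generating map from `A` to the ambient unital algebra. -/
noncomputable def ambL : A →ₙₐ[ℂ] Ambient A B where
  toFun a := RingQuot.mkAlgHom ℂ (Rel A B) (FreeAlgebra.ι ℂ (Sum.inl a))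
  map_smul' c a := by
    rw [RingQuot.mkAlgHom_rel ℂ (Rel.smulL c a), map_smul]; rfl
  map_zero' := by
    have h := RingQuot.mkAlgHom_rel ℂ (Rel.smulL (B := B) 0 (0 : A))
    simpa using h
  map_add' a b := by rw [RingQuot.mkAlgHom_rel ℂ (Rel.addL a b), map_add]
  map_mul' a b := by rw [RingQuot.mkAlgHom_rel ℂ (Rel.mulL a b), map_mul]

/-- The generating map from `B` to the ambient unital algebra. -/
noncomputable def ambR : B →ₙₐ[ℂ] Ambient A B where
  toFun a := RingQuot.mkAlgHom ℂ (Rel A B) (FreeAlgebra.ι ℂ (Sum.inr a))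
  map_smul' c a := by
    rw [RingQuot.mkAlgHom_rel ℂ (Rel.smulR c a), map_smul]; rfl
  map_zero' := by
    have h := RingQuot.mkAlgHom_rel ℂ (Rel.smulR (A := A) 0 (0 : B))
    simpa using h
  map_add' a b := by rw [RingQuot.mkAlgHom_rel ℂ (Rel.addR a b), map_add]
  map_mul' a b := by rw [RingQuot.mkAlgHom_rel ℂ (Rel.mulR a b), map_mul]

/-- The free product `A ⊔ B`, as the non-unital subalgebra generated by `A` and `B`. -/
noncomputable def sub : NonUnitalSubalgebra ℂ (Ambient A B) :=
  NonUnitalAlgebra.adjoin ℂ (Set.range (ambL A B) ∪ Set.range (ambR A B))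

end Construction

end FreeProd

/-- The free product of two not necessarily unital complex algebras. -/
def FreeProd (A : Type u) (B : Type v) [NonUnitalRing A] [Module ℂ A]
    [NonUnitalRing B] [Module ℂ B] : Type (max u v) := FreeProd.sub A B

namespace FreeProd

section Basic

variable {A : Type u} {B : Type v}
variable [NonUnitalRing A] [Module ℂ A] [NonUnitalRing B] [Module ℂ B]

noncomputable instance : NonUnitalRing (FreeProd A B) :=
  inferInstanceAs (NonUnitalRing (FreeProd.sub A B))

noncomputable instance : Module ℂ (FreeProd A B) :=
  inferInstanceAs (Module ℂ (FreeProd.sub A B))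

instance : IsScalarTower ℂ (FreeProd A B) (FreeProd A B) :=
  inferInstanceAs (IsScalarTower ℂ (FreeProd.sub A B) (FreeProd.sub A B))

instance : SMulCommClass ℂ (FreeProd A B) (FreeProd A B) :=
  inferInstanceAs (SMulCommClass ℂ (FreeProd.sub A B) (FreeProd.sub A B))

/-- The inclusion of the free product in the ambient unital algebra. -/
noncomputable def val : FreeProd A B →ₙₐ[ℂ] Ambient A B :=
  NonUnitalSubalgebraClass.subtype (FreeProd.sub A B)

theorem val_injective : Function.Injective (val (A := A) (B := B)) := Subtype.val_injective

/-- The canonical homomorphism `A → A ⊔ B`. -/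
noncomputable def inl : A →ₙₐ[ℂ] FreeProd A B :=
  NonUnitalAlgHom.codRestrict (ambL A B) (FreeProd.sub A B) fun a =>
    NonUnitalAlgebra.subset_adjoin ℂ (Or.inl ⟨a, rfl⟩)

/-- The canonical homomorphism `B → A ⊔ B`. -/
noncomputable def inr : B →ₙₐ[ℂ] FreeProd A B :=
  NonUnitalAlgHom.codRestrict (ambR A B) (FreeProd.sub A B) fun a =>
    NonUnitalAlgebra.subset_adjoin ℂ (Or.inr ⟨a, rfl⟩)

theorem val_inl (a : A) : val (inl a : FreeProd A B) = ambL A B a := rfl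

theorem val_inr (b : B) : val (inr b : FreeProd A B) = ambR A B b := rfl

/-- Induction on elements of the free product. -/
theorem induction {p : FreeProd A B → Prop}
    (hl : ∀ a, p (inl a)) (hr : ∀ b, p (inr b)) (zero : p 0)
    (add : ∀ x y, p x → p y → p (x + y)) (mul : ∀ x y, p x → p y → p (x * y))
    (smul : ∀ (c : ℂ) x, p x → p (c • x)) (x : FreeProd A B) : p x := by
  obtain ⟨x, hx⟩ := x
  refine NonUnitalAlgebra.adjoin_induction (R := ℂ)
    (p := fun y hy => p (⟨y, hy⟩ : FreeProd.sub A B)) ?_ ?_ ?_ ?_ ?_ hx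
  · rintro y (⟨a, rfl⟩ | ⟨b, rfl⟩)
    · exact hl a
    · exact hr b
  · intro x y hx hy h1 h2
    exact add _ _ h1 h2
  · exact zero
  · intro x y hx hy h1 h2
    exact mul _ _ h1 h2
  · intro c x hx h1
    exact smul c _ h1

section Lift

variable {C : Type*} [NonUnitalRing C] [Module ℂ C]

/-- Two homomorphisms on a free product agree if they agree on both factors. -/
theorem hom_ext {h k : FreeProd A B →ₙₐ[ℂ] C}
    (hl : ∀ a, h (inl a) = k (inl a)) (hr : ∀ b, h (inr b) = k (inr b)) : h = k := by
  ext x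
  induction x using FreeProd.induction with
  | hl a => exact hl a
  | hr b => exact hr b
  | zero => simp
  | add x y h1 h2 => simp [h1, h2]
  | mul x y h1 h2 => simp [h1, h2]
  | smul c x h1 => simp [h1]

variable [IsScalarTower ℂ C C] [SMulCommClass ℂ C C]

/-- The unital extension of the homomorphism of the free product induced by `f` and `g`. -/
noncomputable def liftAux (f : A →ₙₐ[ℂ] C) (g : B →ₙₐ[ℂ] C) :
    Ambient A B →ₐ[ℂ] Unitization ℂ C :=
  RingQuot.liftAlgHom ℂ ⟨FreeAlgebra.lift ℂ
    (Sum.elim (fun a => (f a : Unitization ℂ C)) (fun b => (g b : Unitization ℂ C))), by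
      intro x y h
      cases h <;> simp⟩

theorem liftAux_ambL (f : A →ₙₐ[ℂ] C) (g : B →ₙₐ[ℂ] C) (a : A) :
    liftAux f g (ambL A B a) = (f a : Unitization ℂ C) := by
  simp [liftAux, ambL]

theorem liftAux_ambR (f : A →ₙₐ[ℂ] C) (g : B →ₙₐ[ℂ] C) (b : B) :
    liftAux f g (ambR A B b) = (g b : Unitization ℂ C) := by
  simp [liftAux, ambR]

theorem fst_liftAux (f : A →ₙₐ[ℂ] C) (g : B →ₙₐ[ℂ] C) (x : FreeProd A B) :
    (liftAux f g (val x)).fst = 0 := by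
  induction x using FreeProd.induction with
  | hl a => rw [val_inl, liftAux_ambL]; simp
  | hr b => rw [val_inr, liftAux_ambR]; simp
  | zero => simp
  | add x y h1 h2 => simp [h1, h2]
  | mul x y h1 h2 => simp [h1]
  | smul c x h1 => simp [h1]

/-- The homomorphism `A ⊔ B → C` induced by homomorphisms `f : A → C` and `g : B → C`. -/
noncomputable def lift (f : A →ₙₐ[ℂ] C) (g : B →ₙₐ[ℂ] C) : FreeProd A B →ₙₐ[ℂ] C where
  toFun x := (liftAux f g (val x)).snd
  map_smul' c x := by simp
  map_zero' := by simp
  map_add' x y := by simp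
  map_mul' x y := by simp [fst_liftAux]

@[simp] theorem lift_inl (f : A →ₙₐ[ℂ] C) (g : B →ₙₐ[ℂ] C) (a : A) : lift f g (inl a) = f a := by
  change (liftAux f g (val (inl a))).snd = f a
  rw [val_inl, liftAux_ambL]; simp

@[simp] theorem lift_inr (f : A →ₙₐ[ℂ] C) (g : B →ₙₐ[ℂ] C) (b : B) : lift f g (inr b) = g b := by
  change (liftAux f g (val (inr b))).snd = g b
  rw [val_inr, liftAux_ambR]; simp

end Lift

end Basic

end FreeProd

/-! ### The involution of a free product of `*`-algebras -/

/-- The opposite of a complex algebra with the complex-conjugate scalar multiplication. -/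
def ConjOp (C : Type u) : Type u := Cᵐᵒᵖ

namespace ConjOp

set_option linter.unusedSectionVars false

variable {C : Type u} [NonUnitalRing C] [Module ℂ C]

instance : NonUnitalRing (ConjOp C) := inferInstanceAs (NonUnitalRing Cᵐᵒᵖ)

noncomputable instance : Module ℂ (ConjOp C) := Module.compHom Cᵐᵒᵖ (starRingEnd ℂ)

/-- The identity map `C → ConjOp C`. -/
def op (x : C) : ConjOp C := MulOpposite.op x

/-- The identity map `ConjOp C → C`. -/
def unop (x : ConjOp C) : C := MulOpposite.unop x

@[simp] theorem unop_op (x : C) : unop (op x) = x := rfl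
@[simp] theorem op_unop (x : ConjOp C) : op (unop x) = x := rfl
theorem op_add (x y : C) : op (x + y) = op x + op y := rfl
theorem op_zero : op (0 : C) = 0 := rfl
theorem op_mul (x y : C) : op (x * y) = op y * op x := rfl
theorem op_smul (c : ℂ) (x : C) : op ((starRingEnd ℂ c) • x) = c • op x := rfl
theorem unop_add (x y : ConjOp C) : unop (x + y) = unop x + unop y := rfl
theorem unop_zero : unop (0 : ConjOp C) = 0 := rfl
theorem unop_mul (x y : ConjOp C) : unop (x * y) = unop y * unop x := rfl
theorem unop_smul (c : ℂ) (x : ConjOp C) : unop (c • x) = (starRingEnd ℂ c) • unop x := rfl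

theorem unop_injective : Function.Injective (unop (C := C)) := MulOpposite.unop_injective

instance [SMulCommClass ℂ C C] : IsScalarTower ℂ (ConjOp C) (ConjOp C) where
  smul_assoc c x y := unop_injective <| by
    simp [unop_mul, unop_smul, smul_eq_mul, mul_smul_comm]

instance [IsScalarTower ℂ C C] : SMulCommClass ℂ (ConjOp C) (ConjOp C) where
  smul_comm c x y := unop_injective <| by
    simp [unop_mul, unop_smul, smul_eq_mul, smul_mul_assoc]

end ConjOp

namespace FreeProd

section Star

variable {A : Type u} {B : Type v}
variable [NonUnitalRing A] [Module ℂ A] [StarRing A] [StarModule ℂ A]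
variable [NonUnitalRing B] [Module ℂ B] [StarRing B] [StarModule ℂ B]

/-- The involution of the free product, as a linear homomorphism to the conjugate opposite. -/
noncomputable def starHom : FreeProd A B →ₙₐ[ℂ] ConjOp (FreeProd A B) :=
  lift
    { toFun := fun a => ConjOp.op (inl (star a))
      map_smul' := fun c a => by
        rw [star_smul, map_smul]; exact ConjOp.op_smul c _
      map_zero' := by rw [star_zero, map_zero]; rfl
      map_add' := fun a b => by rw [star_add, map_add]; rfl
      map_mul' := fun a b => by rw [star_mul, map_mul]; rfl }
    { toFun := fun a => ConjOp.op (inr (star a))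
      map_smul' := fun c a => by
        rw [star_smul, map_smul]; exact ConjOp.op_smul c _
      map_zero' := by rw [star_zero, map_zero]; rfl
      map_add' := fun a b => by rw [star_add, map_add]; rfl
      map_mul' := fun a b => by rw [star_mul, map_mul]; rfl }

theorem starHom_inl (a : A) :
    (starHom (inl a : FreeProd A B)) = ConjOp.op (inl (star a)) := lift_inl _ _ a

theorem starHom_inr (b : B) :
    (starHom (inr b : FreeProd A B)) = ConjOp.op (inr (star b)) := lift_inr _ _ b

theorem starHom_starHom (x : FreeProd A B) :
    (starHom (starHom x).unop).unop = x := by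
  induction x using FreeProd.induction with
  | hl a => simp [starHom_inl]
  | hr b => simp [starHom_inr]
  | zero => simp [ConjOp.unop_zero]
  | add x y h1 h2 => simp [ConjOp.unop_add, h1, h2]
  | mul x y h1 h2 => simp [ConjOp.unop_mul, h1, h2]
  | smul c x h1 => simp [ConjOp.unop_smul, h1]

/-- The involution of the free product of two `*`-algebras: the unique one for which both
inclusions are `*`-homomorphisms. -/
noncomputable instance : StarRing (FreeProd A B) where
  star x := (starHom x).unop
  star_involutive := starHom_starHom
  star_mul x y := by
    change (starHom (x * y)).unop = (starHom y).unop * (starHom x).unop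
    rw [map_mul, ConjOp.unop_mul]
  star_add x y := by
    change (starHom (x + y)).unop = (starHom x).unop + (starHom y).unop
    rw [map_add, ConjOp.unop_add]

instance : StarModule ℂ (FreeProd A B) where
  star_smul c x := by
    change (starHom (c • x)).unop = star c • (starHom x).unop
    rw [map_smul, ConjOp.unop_smul]; rfl

theorem star_inl (a : A) : star (inl a : FreeProd A B) = inl (star a) := by
  change (starHom (inl a)).unop = _
  rw [starHom_inl]; rfl

theorem star_inr (b : B) : star (inr b : FreeProd A B) = inr (star b) := by
  change (starHom (inr b)).unop = _
  rw [starHom_inr]; rfl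

end Star

end FreeProd

/-! ## Multi-faced algebras -/

/-- An `F`-faced algebra: an algebra which is freely generated by given subalgebras, its faces,
that is, it is the coproduct of its faces in the category of algebras. -/
structure MFAlg (F : Type) : Type (u + 1) where
  carrier : Type u
  [ring : NonUnitalRing carrier]
  [module : Module ℂ carrier]
  [tower : IsScalarTower ℂ carrier carrier]
  [smulComm : SMulCommClass ℂ carrier carrier]
  face : F → NonUnitalSubalgebra ℂ carrier
  free : ∀ (C : Type u) [NonUnitalRing C] [Module ℂ C] [IsScalarTower ℂ C C]
    [SMulCommClass ℂ C C] (g : ∀ f, face f →ₙₐ[ℂ] C),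
    ∃! h : carrier →ₙₐ[ℂ] C, ∀ (f : F) (a : face f), h a = g f a

namespace MFAlg

variable {F : Type}

instance : CoeSort (MFAlg.{u} F) (Type u) := ⟨MFAlg.carrier⟩

attribute [instance] MFAlg.ring MFAlg.module MFAlg.tower MFAlg.smulComm

/-- A linear functional on a multi-faced algebra. -/
abbrev Functional (A : MFAlg.{u} F) : Type u := A →ₗ[ℂ] ℂ

/-- The face of colour `f` of the free product `A ⊔ B`: the subalgebra generated by the faces of
colour `f` of `A` and of `B`. -/
noncomputable def coprodFace (A B : MFAlg.{u} F) (f : F) :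
    NonUnitalSubalgebra ℂ (FreeProd A B) :=
  NonUnitalAlgebra.adjoin ℂ (FreeProd.inl '' (A.face f : Set A) ∪ FreeProd.inr '' (B.face f : Set B))

theorem inl_mem_coprodFace (A B : MFAlg.{u} F) (f : F) {a : A} (ha : a ∈ A.face f) :
    FreeProd.inl a ∈ coprodFace A B f :=
  NonUnitalAlgebra.subset_adjoin ℂ (Or.inl ⟨a, ha, rfl⟩)

theorem inr_mem_coprodFace (A B : MFAlg.{u} F) (f : F) {b : B} (hb : b ∈ B.face f) :
    FreeProd.inr b ∈ coprodFace A B f :=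
  NonUnitalAlgebra.subset_adjoin ℂ (Or.inr ⟨b, hb, rfl⟩)

/-- The free product of two multi-faced algebras is freely generated by its faces. -/
theorem coprod_free (A B : MFAlg.{u} F) (C : Type u) [NonUnitalRing C] [Module ℂ C]
    [IsScalarTower ℂ C C] [SMulCommClass ℂ C C] (g : ∀ f, coprodFace A B f →ₙₐ[ℂ] C) :
    ∃! h : FreeProd A B →ₙₐ[ℂ] C, ∀ (f : F) (a : coprodFace A B f), h a = g f a := by
  let iA : ∀ f, A.face f →ₙₐ[ℂ] coprodFace A B f := fun f =>
    NonUnitalAlgHom.codRestrict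
      (FreeProd.inl.comp (NonUnitalSubalgebraClass.subtype (A.face f))) (coprodFace A B f)
      (fun a => inl_mem_coprodFace A B f a.2)
  let iB : ∀ f, B.face f →ₙₐ[ℂ] coprodFace A B f := fun f =>
    NonUnitalAlgHom.codRestrict
      (FreeProd.inr.comp (NonUnitalSubalgebraClass.subtype (B.face f))) (coprodFace A B f)
      (fun b => inr_mem_coprodFace A B f b.2)
  obtain ⟨hA, hA1, hA2⟩ := A.free C (fun f => (g f).comp (iA f))
  obtain ⟨hB, hB1, hB2⟩ := B.free C (fun f => (g f).comp (iB f))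
  refine ⟨FreeProd.lift hA hB, ?_, ?_⟩
  · rintro f ⟨x, hx⟩
    refine NonUnitalAlgebra.adjoin_induction (R := ℂ)
      (p := fun y hy => FreeProd.lift hA hB y = g f ⟨y, hy⟩) ?_ ?_ ?_ ?_ ?_ hx
    · rintro y (⟨a, ha, rfl⟩ | ⟨b, hb, rfl⟩)
      · rw [FreeProd.lift_inl]
        exact hA1 f ⟨a, ha⟩
      · rw [FreeProd.lift_inr]
        exact hB1 f ⟨b, hb⟩
    · intro x y hx hy h1 h2
      rw [map_add, h1, h2, ← map_add]; rfl
    · rw [map_zero]; exact (map_zero (g f)).symm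
    · intro x y hx hy h1 h2
      rw [map_mul, h1, h2, ← map_mul]; rfl
    · intro c x hx h1
      rw [map_smul, h1, ← map_smul]; rfl
  · intro k hk
    have e1 : k.comp FreeProd.inl = hA := hA2 _ fun f a => hk f (iA f a)
    have e2 : k.comp FreeProd.inr = hB := hB2 _ fun f b => hk f (iB f b)
    refine FreeProd.hom_ext (fun a => ?_) (fun b => ?_)
    · rw [FreeProd.lift_inl, ← e1]; rfl
    · rw [FreeProd.lift_inr, ← e2]; rfl

/-- The free product `A ⊔ B` of multi-faced algebras. -/
noncomputable def coprod (A B : MFAlg.{u} F) : MFAlg.{u} F where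
  carrier := FreeProd A B
  face := coprodFace A B
  free := fun C => coprod_free A B C

/-- The inclusion of the first factor of `A ⊔ B`. -/
noncomputable def inl {A B : MFAlg.{u} F} : A →ₙₐ[ℂ] A.coprod B :=
  (FreeProd.inl : A →ₙₐ[ℂ] FreeProd A B)

/-- The inclusion of the second factor of `A ⊔ B`. -/
noncomputable def inr {A B : MFAlg.{u} F} : B →ₙₐ[ℂ] A.coprod B :=
  (FreeProd.inr : B →ₙₐ[ℂ] FreeProd A B)

/-- The homomorphism on `A ⊔ B` which restricts to `f` on `A` and to `g` on `B`. -/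
noncomputable def lift {A B : MFAlg.{u} F} {C : Type*} [NonUnitalRing C] [Module ℂ C]
    [IsScalarTower ℂ C C] [SMulCommClass ℂ C C] (f : A →ₙₐ[ℂ] C) (g : B →ₙₐ[ℂ] C) :
    A.coprod B →ₙₐ[ℂ] C :=
  (FreeProd.lift f g : FreeProd A B →ₙₐ[ℂ] C)

/-- The homomorphism `h₁ ⊔ h₂ : B₁ ⊔ B₂ → A₁ ⊔ A₂`. -/
noncomputable def coprodMap {A₁ A₂ B₁ B₂ : MFAlg.{u} F}
    (h₁ : B₁ →ₙₐ[ℂ] A₁) (h₂ : B₂ →ₙₐ[ℂ] A₂) : B₁.coprod B₂ →ₙₐ[ℂ] A₁.coprod A₂ :=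
  lift (inl.comp h₁) (inr.comp h₂)

/-- The canonical identification `(A ⊔ B) ⊔ C → A ⊔ (B ⊔ C)`. -/
noncomputable def coprodAssoc (A B C : MFAlg.{u} F) :
    (A.coprod B).coprod C →ₙₐ[ℂ] A.coprod (B.coprod C) :=
  lift (lift inl (inr.comp inl)) (inr.comp inr)

/-- The canonical identification `A ⊔ B → B ⊔ A`. -/
noncomputable def coprodSwap (A B : MFAlg.{u} F) : A.coprod B →ₙₐ[ℂ] B.coprod A :=
  lift inr inl

/-- An algebra homomorphism between multi-faced algebras is multi-faced if it maps each face to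
the face of the same colour. -/
def IsFaced {A B : MFAlg.{u} F} (h : B →ₙₐ[ℂ] A) : Prop :=
  ∀ (f : F), ∀ b ∈ B.face f, h b ∈ A.face f

/-- For an involution on a multi-faced algebra: each face is a `*`-subalgebra. -/
def FacesStarClosed (A : MFAlg.{u} F) [StarRing A] : Prop :=
  ∀ (f : F), ∀ a ∈ A.face f, star a ∈ A.face f

/-- The involution on the free product of `*`-algebras. -/
noncomputable instance (A B : MFAlg.{u} F) [StarRing A] [StarModule ℂ A] [StarRing B]
    [StarModule ℂ B] : StarRing (A.coprod B) :=
  inferInstanceAs (StarRing (FreeProd A B))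

instance (A B : MFAlg.{u} F) [StarRing A] [StarModule ℂ A] [StarRing B]
    [StarModule ℂ B] : StarModule ℂ (A.coprod B) :=
  inferInstanceAs (StarModule ℂ (FreeProd A B))

/-- The two-sided ideal of the algebra `A` generated by a set `S`. -/
def idealSpan (A : MFAlg.{u} F) (S : Set A) : Submodule ℂ A :=
  sInf {I : Submodule ℂ A | S ⊆ I ∧ ∀ x ∈ I, ∀ a : A, a * x ∈ I ∧ x * a ∈ I}

/-- `e` is the family of the units of the faces of `A`; in particular, all faces are unital. -/
def IsFaceUnits (A : MFAlg.{u} F) (e : F → A) : Prop :=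
  ∀ f, e f ∈ A.face f ∧ ∀ a ∈ A.face f, e f * a = a ∧ a * e f = a

end MFAlg

/-- A linear functional on a `*`-algebra `A` is a restricted state if its unital extension to the
unitization of `A` is positive, that is, a state. -/
def IsRestrictedState {A : Type u} [NonUnitalRing A] [Module ℂ A] [IsScalarTower ℂ A A]
    [SMulCommClass ℂ A A] [StarRing A] [StarModule ℂ A] (φ : A →ₗ[ℂ] ℂ) : Prop :=
  ∀ x : Unitization ℂ A,
    0 ≤ ((star x * x).fst + φ (star x * x).snd).re ∧ ((star x * x).fst + φ (star x * x).snd).im = 0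

/-! ## Universal products -/

/-- A multi-faced universal product. -/
structure UniversalProduct (F : Type) : Type (u + 1) where
  /-- The functional `φ₁ ⊙ φ₂` on `A₁ ⊔ A₂`. -/
  prod : ∀ {A₁ A₂ : MFAlg.{u} F}, A₁.Functional → A₂.Functional → (A₁.coprod A₂).Functional
  universality : ∀ {A₁ A₂ B₁ B₂ : MFAlg.{u} F} (φ₁ : A₁.Functional) (φ₂ : A₂.Functional)
    (h₁ : B₁ →ₙₐ[ℂ] A₁) (h₂ : B₂ →ₙₐ[ℂ] A₂), MFAlg.IsFaced h₁ → MFAlg.IsFaced h₂ →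
    ∀ x, prod (φ₁ ∘ₗ (h₁ : B₁ →ₗ[ℂ] A₁)) (φ₂ ∘ₗ (h₂ : B₂ →ₗ[ℂ] A₂)) x =
      prod φ₁ φ₂ (MFAlg.coprodMap h₁ h₂ x)
  associativity : ∀ {A₁ A₂ A₃ : MFAlg.{u} F} (φ₁ : A₁.Functional) (φ₂ : A₂.Functional)
    (φ₃ : A₃.Functional) (x : (A₁.coprod A₂).coprod A₃),
    prod (prod φ₁ φ₂) φ₃ x = prod φ₁ (prod φ₂ φ₃) (MFAlg.coprodAssoc A₁ A₂ A₃ x)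
  restriction_left : ∀ {A₁ A₂ : MFAlg.{u} F} (φ₁ : A₁.Functional) (φ₂ : A₂.Functional) (a : A₁),
    prod φ₁ φ₂ (MFAlg.inl a) = φ₁ a
  restriction_right : ∀ {A₁ A₂ : MFAlg.{u} F} (φ₁ : A₁.Functional) (φ₂ : A₂.Functional) (a : A₂),
    prod φ₁ φ₂ (MFAlg.inr a) = φ₂ a

namespace UniversalProduct

variable {F : Type}

/-- `φ₁ ⊙ φ₂ = φ₂ ⊙ φ₁`, under the identification of `A₁ ⊔ A₂` with `A₂ ⊔ A₁`. -/
def IsSymmetric (P : UniversalProduct.{u} F) : Prop :=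
  ∀ {A₁ A₂ : MFAlg.{u} F} (φ₁ : A₁.Functional) (φ₂ : A₂.Functional) (x : A₁.coprod A₂),
    P.prod φ₁ φ₂ x = P.prod φ₂ φ₁ (MFAlg.coprodSwap A₁ A₂ x)

/-- The product of restricted states on multi-faced `*`-algebras is a restricted state. -/
def IsPositive (P : UniversalProduct.{u} F) : Prop :=
  ∀ (A₁ A₂ : MFAlg.{u} F) [StarRing A₁] [StarModule ℂ A₁] [StarRing A₂] [StarModule ℂ A₂],
    A₁.FacesStarClosed → A₂.FacesStarClosed →
    ∀ (φ₁ : A₁.Functional) (φ₂ : A₂.Functional),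
      IsRestrictedState φ₁ → IsRestrictedState φ₂ → IsRestrictedState (P.prod φ₁ φ₂)

/-- Unit preserving universal products. -/
def UnitPreserving (P : UniversalProduct.{u} F) : Prop :=
  ∀ (A₁ A₂ : MFAlg.{u} F) (e₁ : F → A₁) (e₂ : F → A₂),
    A₁.IsFaceUnits e₁ → A₂.IsFaceUnits e₂ →
    ∀ (φ₁ : A₁.Functional) (φ₂ : A₂.Functional),
      (∀ x ∈ A₁.idealSpan {x | ∃ f g, x = e₁ f - e₁ g}, φ₁ x = 0) →
      (∀ x ∈ A₂.idealSpan {x | ∃ f g, x = e₂ f - e₂ g}, φ₂ x = 0) →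
      (∀ f, φ₁ (e₁ f) = 1) → (∀ f, φ₂ (e₂ f) = 1) →
      (∀ x ∈ (A₁.coprod A₂).idealSpan
          {x | ∃ u ∈ Set.range (MFAlg.inl ∘ e₁) ∪ Set.range (MFAlg.inr ∘ e₂),
            ∃ w ∈ Set.range (MFAlg.inl ∘ e₁) ∪ Set.range (MFAlg.inr ∘ e₂), x = u - w},
        P.prod φ₁ φ₂ x = 0) ∧
      (∀ f, P.prod φ₁ φ₂ (MFAlg.inl (e₁ f)) = 1) ∧ (∀ f, P.prod φ₁ φ₂ (MFAlg.inr (e₂ f)) = 1)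

end UniversalProduct

/-! ### Products of several functionals -/

/-- The free product `A 0 ⊔ (A 1 ⊔ (⋯ ⊔ A k))`. -/
noncomputable def MFAlg.iterCoprod {F : Type} :
    (k : ℕ) → (Fin (k + 1) → MFAlg.{u} F) → MFAlg.{u} F
  | 0, A => A 0
  | k + 1, A => (A 0).coprod (MFAlg.iterCoprod k fun i => A i.succ)

/-- The inclusion of the factor `A κ`. -/
noncomputable def MFAlg.iterIncl {F : Type} :
    (k : ℕ) → (A : Fin (k + 1) → MFAlg.{u} F) → (κ : Fin (k + 1)) →
      (A κ →ₙₐ[ℂ] MFAlg.iterCoprod k A)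
  | 0, A => Fin.cases (NonUnitalAlgHom.id ℂ (A 0)) (fun i => i.elim0)
  | k + 1, A => Fin.cases MFAlg.inl
      (fun i => MFAlg.inr.comp (MFAlg.iterIncl k (fun j => A j.succ) i))

/-- The functional `φ 0 ⊙ φ 1 ⊙ ⋯ ⊙ φ k`. -/
noncomputable def UniversalProduct.iterProd {F : Type} (P : UniversalProduct.{u} F) :
    (k : ℕ) → (A : Fin (k + 1) → MFAlg.{u} F) → (∀ κ, (A κ).Functional) →
      (MFAlg.iterCoprod k A).Functional
  | 0, _, φ => φ 0
  | k + 1, A, φ => P.prod (φ 0) (UniversalProduct.iterProd P k (fun i => A i.succ) fun i => φ i.succ)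

/-- The ordered product of a nonempty list; the value `0` at the empty list is never used. -/
def listProd {A : Type*} [NonUnitalRing A] : List A → A
  | [] => 0
  | [a] => a
  | a :: b :: l => a * listProd (b :: l)

/-! ## Partitions and highest coefficients -/

/-- Set partitions of the legs `0, …, n`. -/
abbrev LegPartition (n : ℕ) : Type := Finpartition (Finset.univ : Finset (Fin (n + 1)))

/-- A multi-faced partition: a face structure `f` on a nonempty finite totally ordered set of
legs, together with a set partition. -/
structure MFPartition (F : Type) : Type where
  n : ℕ
  f : Fin (n + 1) → F
  π : LegPartition n

/-- Two legs lie in the same block. -/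
def LegPartition.SameBlock {n : ℕ} (π : LegPartition n) (i j : Fin (n + 1)) : Prop :=
  ∃ β ∈ π.parts, i ∈ β ∧ j ∈ β

/-- The partition `π` is adapted to `s`, where `s ℓ` is a pair of a block index and a face. -/
def LegPartition.Adapted {F : Type} {n k : ℕ} (π : LegPartition n)
    (s : Fin (n + 1) → Fin (k + 1) × F) : Prop :=
  (∀ β ∈ π.parts, ∃ κ, ∀ ℓ ∈ β, (s ℓ).1 = κ) ∧
  ∀ i : Fin n, s i.castSucc = s i.succ → π.SameBlock i.castSucc i.succ

namespace UniversalProduct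

variable {F : Type}

open Classical in
/-- `c k n s π` are the coefficients of the universal product: for all functionals
`φ 0, …, φ k` on `A 0, …, A k` and `s = b × f`, the value of `φ 0 ⊙ ⋯ ⊙ φ k` on a product
`a 0 ⋯ a n` with `a ℓ` in the face of colour `f ℓ` of `A (b ℓ)` is the sum over all `π` adapted to
`s` of `c k n s π` times the product, over all `κ` and all blocks `β` of `π` on which `b = κ`, of
`φ κ` evaluated at the ordered product of the `a ℓ`, `ℓ ∈ β`.
The elements are given as a family `a κ ℓ` in `A κ`, of which only the `a (b ℓ) ℓ` enter. -/
def IsCoefficients (P : UniversalProduct.{u} F)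
    (c : (k n : ℕ) → (Fin (n + 1) → Fin (k + 1) × F) → LegPartition n → ℂ) : Prop :=
  ∀ (k n : ℕ) (s : Fin (n + 1) → Fin (k + 1) × F)
    (A : Fin (k + 1) → MFAlg.{u} F) (φ : ∀ κ, (A κ).Functional)
    (a : ∀ κ, Fin (n + 1) → A κ), (∀ ℓ, a (s ℓ).1 ℓ ∈ (A (s ℓ).1).face (s ℓ).2) →
    P.iterProd k A φ (listProd (List.ofFn fun ℓ => MFAlg.iterIncl k A (s ℓ).1 (a (s ℓ).1 ℓ))) =
      ∑ π : LegPartition n with π.Adapted s, c k n s π *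
        ∏ κ, ∏ β ∈ π.parts with (∀ ℓ ∈ β, (s ℓ).1 = κ),
          φ κ (listProd (β.sort.map (a κ)))

/-- `α` is the family of highest coefficients of a symmetric universal product: for every
multi-faced partition and every enumeration of its blocks, given by the surjective map `b` which
sends a leg to the index of its block, `α` is the coefficient of the partition itself, which is
the maximal partition adapted to `b × f`. -/
def IsHighestCoefficients (P : UniversalProduct.{u} F) (α : MFPartition F → ℂ) : Prop :=
  ∃ c, P.IsCoefficients c ∧
    ∀ (p : MFPartition F) (k : ℕ) (b : Fin (p.n + 1) → Fin (k + 1)), Function.Surjective b →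
      (∀ i j, b i = b j ↔ p.π.SameBlock i j) → α p = c k p.n (fun ℓ => (b ℓ, p.f ℓ)) p.π

/-- The set of the partitions with nonzero highest coefficient. -/
def partitionSet (P : UniversalProduct.{u} F) : Set (MFPartition F) :=
  {p | ∃ α, P.IsHighestCoefficients α ∧ α p ≠ 0}

end UniversalProduct

/-! ## Pure noncrossing partitions -/

namespace MFPartition

variable {F : Type}

/-- A leg is inner if it lies strictly between two legs of a block to which it does not belong. -/
def IsInnerLeg (p : MFPartition F) (ℓ : Fin (p.n + 1)) : Prop :=
  ∃ i j, i < ℓ ∧ ℓ < j ∧ ∃ β ∈ p.π.parts, i ∈ β ∧ j ∈ β ∧ ℓ ∉ β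

/-- Noncrossing partitions. -/
def IsNoncrossing (p : MFPartition F) : Prop :=
  ∀ i j k l, i < j → j < k → k < l → ∀ β ∈ p.π.parts, ∀ γ ∈ p.π.parts,
    i ∈ β → k ∈ β → j ∈ γ → l ∈ γ → β = γ

/-- Pure noncrossing: noncrossing, and every inner block (a block with an inner leg) is
monochrome. -/
def IsPureNoncrossing (p : MFPartition F) : Prop :=
  p.IsNoncrossing ∧ ∀ β ∈ p.π.parts, (∃ ℓ ∈ β, p.IsInnerLeg ℓ) → ∀ i ∈ β, ∀ j ∈ β, p.f i = p.f j

end MFPartition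

/-- The two faces. -/
inductive TwoFaces : Type
  | white
  | black

/-- The set of all pure noncrossing two-faced partitions. -/
def pNC : Set (MFPartition TwoFaces) := {p | p.IsPureNoncrossing}

/-! ## Ordered products -/

section ListProd

variable {A : Type*} [NonUnitalRing A]

/-! The value of a product functional on a word of face elements depends only on the joint laws of
these elements and is linear in each of them. Such a function of laws is determined by the indicator
laws, which are `1` on the words of a partition of the letters into words and `0` elsewhere
(`LawMultilinear.eq_zero`): attaching labels to the letters and expanding by multilinearity isolates
these laws. An indicator law is realized by rank one matrices in a vector state
(`IsWordPartition.indicatorLaw_eq`). Positivity can therefore be exploited in matrix models, and the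
resulting identities hold for arbitrary functionals.

Coefficients. If some word of an indicator law reads two neighbouring letters against the order of
the product, the value is `0`: one end of the product is a null vector of the state, because its
norm is the value of a palindromic word which vanishes by induction (`wordValue_wrongOrder`). What
remains are the increasing words, that is, set partitions. These must be adapted, because neighbours
of equal algebra and face can be merged into one letter. The values at the indicator laws of adapted
partitions are thus coefficients, and they are forced, since an indicator law singles out one term
of the expansion. Symmetry makes the highest ones independent of the enumeration of the blocks.

Unit preservation is equivalent to `AbsorbsUnits`: in a product of the character of two copies of
the complex numbers with any functional, the units of the copies act as an adjoined unit. From unit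
preservation this follows modulo the ideal of the differences of units; conversely, associativity
carries absorption from the auxiliary factor to the units of any factor.

Suppose units are absorbed. A pure noncrossing partition is taken apart block by block: an inner
block which is an interval is monochrome, so its product is a face element and can be removed, and
an initial interval splits off by factorization. All coefficients of pure noncrossing partitions are
therefore `1`.

Conversely, let `c` be the coefficient of three legs of colour `f` with blocks formed by the outer
legs and the middle leg. Inserting two units in place of one shows `c * c = c`, so `c ≠ 0` forces `c
= 1`. Then the unit of colour `f` fixes, modulo null vectors, every vector produced from the state
vector by the face of colour `f`. These vectors exhaust the representation space of a matrix model,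
so the units act as the identity there, and absorption follows in general by the reduction to matrix
models. -/

theorem listProd_cons {a : A} {l : List A} (hl : l ≠ []) : listProd (a :: l) = a * listProd l := by
  cases l with
  | nil => exact absurd rfl hl
  | cons b l => rfl

theorem listProd_append {l₁ l₂ : List A} (h₁ : l₁ ≠ []) (h₂ : l₂ ≠ []) :
    listProd (l₁ ++ l₂) = listProd l₁ * listProd l₂ := by
  induction l₁ with
  | nil => exact absurd rfl h₁
  | cons a l ih =>
    by_cases hl : l = []
    · subst hl; exact listProd_cons h₂
    · rw [List.cons_append, listProd_cons (by simp [hl]), ih hl, listProd_cons hl, mul_assoc]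

theorem listProd_mem {S : Type*} [SetLike S A] [NonUnitalSubsemiringClass S A] (s : S) {l : List A}
    (h : ∀ a ∈ l, a ∈ s) : listProd l ∈ s := by
  induction l with
  | nil => exact zero_mem s
  | cons a l ih =>
    by_cases hl : l = []
    · subst hl; exact h a (by simp)
    · rw [listProd_cons hl]
      exact mul_mem (h a (by simp)) (ih fun b hb => h b (by simp [hb]))

theorem listProd_eq_zero {l : List A} (h : (0 : A) ∈ l) : listProd l = 0 := by
  induction l with
  | nil => rfl
  | cons a l ih =>
    by_cases hl : l = []
    · subst hl; simp at h; simp [listProd, h]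
    · rw [listProd_cons hl]
      rcases List.mem_cons.1 h with h | h
      · rw [← h, zero_mul]
      · rw [ih h, mul_zero]

theorem listProd_middle_add (l₁ l₂ : List A) (x y : A) :
    listProd (l₁ ++ (x + y) :: l₂) = listProd (l₁ ++ x :: l₂) + listProd (l₁ ++ y :: l₂) := by
  induction l₁ with
  | nil =>
    by_cases h : l₂ = []
    · subst h; rfl
    · simp only [List.nil_append]; rw [listProd_cons h, listProd_cons h, listProd_cons h, add_mul]
  | cons a l ih =>
    simp only [List.cons_append]
    rw [listProd_cons (by simp), listProd_cons (by simp), listProd_cons (by simp), ih, mul_add]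

variable [Module ℂ A] {B : Type*} [NonUnitalRing B] [Module ℂ B]

theorem map_listProd (h : A →ₙₐ[ℂ] B) (l : List A) : h (listProd l) = listProd (l.map h) := by
  induction l with
  | nil => exact map_zero h
  | cons a l ih =>
    by_cases hl : l = []
    · subst hl; rfl
    · rw [listProd_cons hl, map_mul, ih, List.map_cons, listProd_cons (by simp [hl])]

theorem coe_listProd [IsScalarTower ℂ A A] [SMulCommClass ℂ A A] {l : List A} (hl : l ≠ []) :
    (Unitization.inr (listProd l) : Unitization ℂ A) = (l.map Unitization.inr).prod := by
  induction l with
  | nil => exact absurd rfl hl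
  | cons a l ih =>
    by_cases h : l = []
    · subst h; simp [listProd]
    · rw [listProd_cons h, Unitization.inr_mul, ih h, List.map_cons, List.prod_cons]

theorem listProd_middle_smul [IsScalarTower ℂ A A] [SMulCommClass ℂ A A] (l₁ l₂ : List A) (c : ℂ)
    (x : A) : listProd (l₁ ++ (c • x) :: l₂) = c • listProd (l₁ ++ x :: l₂) := by
  induction l₁ with
  | nil =>
    by_cases h : l₂ = []
    · subst h; rfl
    · simp only [List.nil_append]; rw [listProd_cons h, listProd_cons h, smul_mul_assoc]
  | cons a l ih =>
    simp only [List.cons_append]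
    rw [listProd_cons (by simp), listProd_cons (by simp), ih, mul_smul_comm]

/-- An element of the algebra generated by `S` is a linear combination of products of elements
of `S`. -/
theorem mem_span_listProd [IsScalarTower ℂ A A] [SMulCommClass ℂ A A] {S : Set A} {x : A}
    (hx : x ∈ NonUnitalAlgebra.adjoin ℂ S) :
    x ∈ Submodule.span ℂ {y | ∃ l : List A, l ≠ [] ∧ (∀ a ∈ l, a ∈ S) ∧ y = listProd l} := by
  induction hx using NonUnitalAlgebra.adjoin_induction with
  | mem x hx => exact Submodule.subset_span ⟨[x], by simp, by simpa using hx, rfl⟩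
  | add x y _ _ h₁ h₂ => exact add_mem h₁ h₂
  | zero => exact zero_mem _
  | smul c x _ h => exact Submodule.smul_mem _ c h
  | mul x y hx hy h₁ h₂ =>
    clear hx hy
    induction h₁ using Submodule.span_induction with
    | zero => simp
    | add a b _ _ ha hb => rw [add_mul]; exact add_mem ha hb
    | smul c a _ ha => rw [smul_mul_assoc]; exact Submodule.smul_mem _ c ha
    | mem a ha =>
      induction h₂ using Submodule.span_induction with
      | zero => simp
      | add a b _ _ ha hb => rw [mul_add]; exact add_mem ha hb
      | smul c a _ ha => rw [mul_smul_comm]; exact Submodule.smul_mem _ c ha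
      | mem b hb =>
        obtain ⟨l, hl, hS, rfl⟩ := ha
        obtain ⟨l', hl', hS', rfl⟩ := hb
        refine Submodule.subset_span ⟨l ++ l', by simp [hl], ?_, (listProd_append hl hl').symm⟩
        intro a ha
        rcases List.mem_append.1 ha with h | h
        · exact hS a h
        · exact hS' a h

end ListProd

/-! ## Multi-faced algebras are generated by their faces -/

namespace MFAlg

variable {F : Type}

/-- The universal property maps `A` into the subalgebra generated by the faces. Followed by the
inclusion, this map agrees with the identity on all faces, hence everywhere by uniqueness. -/
theorem adjoin_faces (A : MFAlg.{u} F) :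
    NonUnitalAlgebra.adjoin ℂ (⋃ f, (A.face f : Set A)) = ⊤ := by
  set S := NonUnitalAlgebra.adjoin ℂ (⋃ f, (A.face f : Set A)) with hS
  have hmem : ∀ f, ∀ a ∈ A.face f, a ∈ S := fun f a ha =>
    NonUnitalAlgebra.subset_adjoin ℂ (Set.mem_iUnion.2 ⟨f, ha⟩)
  obtain ⟨r, hr, -⟩ := A.free S (fun f => NonUnitalAlgHom.codRestrict
    (NonUnitalSubalgebraClass.subtype (A.face f)) S (fun a => hmem f a a.2))
  obtain ⟨i, hi, hu⟩ := A.free A (fun f => NonUnitalSubalgebraClass.subtype (A.face f))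
  have h1 : (NonUnitalSubalgebraClass.subtype S).comp r = i := by
    refine hu _ fun f a => ?_
    change ((r a : S) : A) = _
    rw [hr f a]; rfl
  have h2 : NonUnitalAlgHom.id ℂ A = i := hu _ fun f a => rfl
  rw [eq_top_iff]
  intro x _
  have : ((r x : S) : A) = x := by
    have := congrArg (fun g : A →ₙₐ[ℂ] A => g x) (h1.trans h2.symm)
    exact this
  rw [← this]; exact (r x).2

/-- Induction on elements of a multi-faced algebra. -/
theorem face_induction (A : MFAlg.{u} F) {p : A → Prop} (face : ∀ f, ∀ a ∈ A.face f, p a)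
    (zero : p 0) (add : ∀ x y, p x → p y → p (x + y)) (mul : ∀ x y, p x → p y → p (x * y))
    (smul : ∀ (c : ℂ) x, p x → p (c • x)) (x : A) : p x := by
  have hx : x ∈ NonUnitalAlgebra.adjoin ℂ (⋃ f, (A.face f : Set A)) := by
    rw [adjoin_faces]; trivial
  induction hx using NonUnitalAlgebra.adjoin_induction with
  | mem x hx => obtain ⟨f, hf⟩ := Set.mem_iUnion.1 hx; exact face f x hf
  | add x y _ _ h₁ h₂ => exact add x y h₁ h₂
  | zero => exact zero
  | mul x y _ _ h₁ h₂ => exact mul x y h₁ h₂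
  | smul c x _ h => exact smul c x h

section Coprod

variable {A B : MFAlg.{u} F} {C : Type*} [NonUnitalRing C] [Module ℂ C]

theorem coprod_induction {p : A.coprod B → Prop}
    (hl : ∀ a : A, p (inl a)) (hr : ∀ b : B, p (inr b)) (zero : p 0)
    (add : ∀ x y, p x → p y → p (x + y)) (mul : ∀ x y, p x → p y → p (x * y))
    (smul : ∀ (c : ℂ) x, p x → p (c • x)) (x : A.coprod B) : p x :=
  FreeProd.induction (A := A) (B := B) (p := p) hl hr zero add mul smul x

theorem coprod_hom_ext {h k : A.coprod B →ₙₐ[ℂ] C}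
    (hl : ∀ a : A, h (inl a) = k (inl a)) (hr : ∀ b : B, h (inr b) = k (inr b)) : h = k :=
  FreeProd.hom_ext (A := A) (B := B) hl hr

variable [IsScalarTower ℂ C C] [SMulCommClass ℂ C C]

@[simp] theorem lift_inl (f : A →ₙₐ[ℂ] C) (g : B →ₙₐ[ℂ] C) (a : A) : lift f g (inl a) = f a :=
  FreeProd.lift_inl f g a

@[simp] theorem lift_inr (f : A →ₙₐ[ℂ] C) (g : B →ₙₐ[ℂ] C) (b : B) : lift f g (inr b) = g b :=
  FreeProd.lift_inr f g b

variable {A₁ A₂ B₁ B₂ : MFAlg.{u} F}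

@[simp] theorem coprodMap_inl (h₁ : B₁ →ₙₐ[ℂ] A₁) (h₂ : B₂ →ₙₐ[ℂ] A₂) (x : B₁) :
    coprodMap h₁ h₂ (inl x) = inl (h₁ x) := lift_inl _ _ x

@[simp] theorem coprodMap_inr (h₁ : B₁ →ₙₐ[ℂ] A₁) (h₂ : B₂ →ₙₐ[ℂ] A₂) (x : B₂) :
    coprodMap h₁ h₂ (inr x) = inr (h₂ x) := lift_inr _ _ x

@[simp] theorem coprodSwap_inl (x : A) : coprodSwap A B (inl x) = inr x := lift_inl _ _ x

@[simp] theorem coprodSwap_inr (x : B) : coprodSwap A B (inr x) = inl x := lift_inr _ _ x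

theorem coprodAssoc_inl_inl (A B C : MFAlg.{u} F) (x : A) :
    coprodAssoc A B C (inl (inl x)) = inl x := by simp [coprodAssoc]

theorem coprodAssoc_inl_inr (A B C : MFAlg.{u} F) (x : B) :
    coprodAssoc A B C (inl (inr x)) = inr (inl x) := by simp [coprodAssoc]

theorem coprodAssoc_inr (A B C : MFAlg.{u} F) (x : C) :
    coprodAssoc A B C (inr x) = inr (inr x) := by simp [coprodAssoc]

theorem isFaced_inl : IsFaced (inl : A →ₙₐ[ℂ] A.coprod B) := fun f _ ha =>
  inl_mem_coprodFace A B f ha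

theorem isFaced_inr : IsFaced (inr : B →ₙₐ[ℂ] A.coprod B) := fun f _ hb =>
  inr_mem_coprodFace A B f hb

theorem isFaced_lift {D : MFAlg.{u} F} {g : A →ₙₐ[ℂ] D} {h : B →ₙₐ[ℂ] D} (hg : IsFaced g)
    (hh : IsFaced h) : IsFaced (lift g h) := by
  intro f x hx
  change x ∈ coprodFace A B f at hx
  unfold coprodFace at hx
  induction hx using NonUnitalAlgebra.adjoin_induction with
  | mem x hx =>
    rcases hx with ⟨a, ha, rfl⟩ | ⟨b, hb, rfl⟩
    · exact (lift_inl g h a).symm ▸ hg f a ha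
    · exact (lift_inr g h b).symm ▸ hh f b hb
  | add x y _ _ h₁ h₂ => exact (map_add (lift g h) x y).symm ▸ add_mem h₁ h₂
  | zero => exact (map_zero (lift g h)).symm ▸ zero_mem _
  | mul x y _ _ h₁ h₂ => exact (map_mul (lift g h) x y).symm ▸ mul_mem h₁ h₂
  | smul c x _ h' => exact (map_smul (lift g h) c x).symm ▸ SMulMemClass.smul_mem c h'

theorem IsFaced.comp {D : MFAlg.{u} F} {g : B →ₙₐ[ℂ] D} {h : A →ₙₐ[ℂ] B} (hg : IsFaced g)
    (hh : IsFaced h) : IsFaced (g.comp h) := fun f a ha => hg f _ (hh f a ha)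

theorem isFaced_id (A : MFAlg.{u} F) : IsFaced (NonUnitalAlgHom.id ℂ A) := fun _ _ ha => ha

theorem isFaced_coprodMap {h₁ : B₁ →ₙₐ[ℂ] A₁} {h₂ : B₂ →ₙₐ[ℂ] A₂} (H₁ : IsFaced h₁)
    (H₂ : IsFaced h₂) : IsFaced (coprodMap h₁ h₂) :=
  isFaced_lift (isFaced_inl.comp H₁) (isFaced_inr.comp H₂)

end Coprod

end MFAlg

/-! ## The free multi-faced algebra on a set of coloured letters -/

namespace FreeSemigroup

/-- The word of letters of an element of the free semigroup. -/
def word {X : Type*} (x : FreeSemigroup X) : List X := x.head :: x.tail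

theorem word_mul {X : Type*} (x y : FreeSemigroup X) : (x * y).word = x.word ++ y.word := rfl

theorem word_ne_nil {X : Type*} (x : FreeSemigroup X) : x.word ≠ [] := List.cons_ne_nil _ _

end FreeSemigroup

/-- The algebra of noncommutative polynomials without constant term. -/
abbrev WordAlg (X : Type) : Type u := MonoidAlgebra ℂ (FreeSemigroup (ULift.{u} X))

namespace WordAlg

variable {F : Type} {X : Type}

/-- The generator given by a letter. -/
noncomputable def gen (x : X) : WordAlg.{u} X :=
  MonoidAlgebra.single (FreeSemigroup.of (ULift.up x)) 1

theorem single_eq_listProd (w : FreeSemigroup (ULift.{u} X)) :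
    (MonoidAlgebra.single w 1 : WordAlg.{u} X) = listProd (w.word.map fun x => gen x.down) := by
  induction w using FreeSemigroup.recOnMul with
  | ih1 x => rfl
  | ih2 x y h₁ h₂ =>
    rw [FreeSemigroup.word_mul, List.map_append,
      listProd_append (by simp [FreeSemigroup.word_ne_nil]) (by simp [FreeSemigroup.word_ne_nil]),
      ← h₁, ← h₂, MonoidAlgebra.single_mul_single, one_mul]

theorem adjoin_gen : NonUnitalAlgebra.adjoin ℂ (Set.range (gen (X := X))) = 
    (⊤ : NonUnitalSubalgebra ℂ (WordAlg.{u} X)) := by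
  rw [eq_top_iff]
  intro x _
  induction x using MonoidAlgebra.induction_linear with
  | zero => exact zero_mem _
  | add x y hx hy => exact add_mem (hx trivial) (hy trivial)
  | single w c =>
    have : (MonoidAlgebra.single w c : WordAlg.{u} X) = c • MonoidAlgebra.single w 1 := by simp
    rw [this, single_eq_listProd]
    refine SMulMemClass.smul_mem c (listProd_mem _ fun a ha => ?_)
    obtain ⟨x, -, rfl⟩ := List.mem_map.1 ha
    exact NonUnitalAlgebra.subset_adjoin ℂ ⟨_, rfl⟩

theorem gen_mem_adjoin (c : X → F) (x : X) : (gen x : WordAlg.{u} X) ∈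
    NonUnitalAlgebra.adjoin ℂ (gen '' {y | c y = c x}) :=
  NonUnitalAlgebra.subset_adjoin ℂ ⟨x, rfl, rfl⟩

section Lift

variable {C : Type*} [NonUnitalRing C] [Module ℂ C]

theorem hom_ext {g h : WordAlg.{u} X →ₙₐ[ℂ] C} (H : ∀ x, g (gen x) = h (gen x)) : g = h := by
  refine NonUnitalAlgHom.ext fun y => ?_
  have hy : y ∈ NonUnitalAlgebra.adjoin ℂ (Set.range (gen (X := X))) := by
    rw [adjoin_gen]; trivial
  induction hy using NonUnitalAlgebra.adjoin_induction with
  | mem x hx => obtain ⟨x, rfl⟩ := hx; exact H x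
  | add x y _ _ h₁ h₂ => simp_all
  | zero => simp
  | mul x y _ _ h₁ h₂ => simp_all
  | smul c x _ h => simp_all

variable [IsScalarTower ℂ C C] [SMulCommClass ℂ C C]

/-- The homomorphism given by the images of the letters. -/
noncomputable def lift (g : X → C) : WordAlg.{u} X →ₙₐ[ℂ] C :=
  MonoidAlgebra.liftMagma ℂ (FreeSemigroup.lift fun x => g x.down)

@[simp] theorem lift_gen (g : X → C) (x : X) : lift.{u} g (gen x) = g x := by
  unfold lift gen
  rw [MonoidAlgebra.liftMagma_apply_apply]
  simp

end Lift

end WordAlg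

/-- The free multi-faced algebra on letters `x : X` of colour `c x`. -/
noncomputable def freeMF {F : Type} (X : Type) (c : X → F) : MFAlg.{u} F where
  carrier := WordAlg.{u} X
  face f := NonUnitalAlgebra.adjoin ℂ (WordAlg.gen '' {x | c x = f})
  free := by
    intro C _ _ _ _ g
    have hx := WordAlg.gen_mem_adjoin.{u} c
    refine ⟨WordAlg.lift fun x => g (c x) ⟨WordAlg.gen x, hx x⟩, ?_, ?_⟩
    · rintro f ⟨y, hy⟩
      induction hy using NonUnitalAlgebra.adjoin_induction with
      | mem y hy =>
        obtain ⟨x, rfl, rfl⟩ := hy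
        exact WordAlg.lift_gen _ x
      | add x y h₁ h₂ h₃ h₄ =>
        simp only at h₃ h₄ ⊢
        rw [map_add, h₃, h₄, ← map_add]; rfl
      | zero => simp only; rw [map_zero]; exact (map_zero (g f)).symm
      | mul x y h₁ h₂ h₃ h₄ =>
        simp only at h₃ h₄ ⊢
        rw [map_mul, h₃, h₄, ← map_mul]; rfl
      | smul r x h₁ h₃ =>
        simp only at h₃ ⊢
        rw [map_smul, h₃, ← map_smul]; rfl
    · intro h hh
      refine WordAlg.hom_ext fun x => ?_
      rw [WordAlg.lift_gen]
      exact hh (c x) ⟨WordAlg.gen x, hx x⟩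

namespace freeMF

variable {F : Type} {X : Type} {c : X → F}

/-- The letters of the free multi-faced algebra. -/
noncomputable def gen (x : X) : freeMF.{u} X c := WordAlg.gen x

theorem gen_mem (x : X) : (gen x : freeMF.{u} X c) ∈ (freeMF.{u} X c).face (c x) :=
  WordAlg.gen_mem_adjoin c x

/-- The homomorphism given by the images of the letters. -/
noncomputable def lift {C : Type*} [NonUnitalRing C] [Module ℂ C] [IsScalarTower ℂ C C]
    [SMulCommClass ℂ C C] (g : X → C) : freeMF.{u} X c →ₙₐ[ℂ] C :=
  (WordAlg.lift g : WordAlg.{u} X →ₙₐ[ℂ] C)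

@[simp] theorem lift_gen {C : Type*} [NonUnitalRing C] [Module ℂ C] [IsScalarTower ℂ C C]
    [SMulCommClass ℂ C C] (g : X → C) (x : X) : lift (c := c) g (gen x) = g x :=
  WordAlg.lift_gen g x

theorem isFaced_lift {A : MFAlg.{u} F} {g : X → A} (hg : ∀ x, g x ∈ A.face (c x)) :
    MFAlg.IsFaced (lift (c := c) g) := by
  intro f y hy
  change y ∈ NonUnitalAlgebra.adjoin ℂ (WordAlg.gen '' {x | c x = f}) at hy
  induction hy using NonUnitalAlgebra.adjoin_induction with
  | mem y hy =>
    obtain ⟨x, rfl, rfl⟩ := hy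
    exact (lift_gen g x).symm ▸ hg x
  | add x y _ _ h₁ h₂ => exact (map_add (lift (c := c) g) x y).symm ▸ add_mem h₁ h₂
  | zero => exact (map_zero (lift (c := c) g)).symm ▸ zero_mem _
  | mul x y _ _ h₁ h₂ => exact (map_mul (lift (c := c) g) x y).symm ▸ mul_mem h₁ h₂
  | smul r x _ h => exact (map_smul (lift (c := c) g) r x).symm ▸ SMulMemClass.smul_mem r h

/-- The functional with prescribed values on words. -/
noncomputable def functional (c : X → F) (μ : List X → ℂ) : (freeMF.{u} X c).Functional :=
  (Finsupp.lsum ℂ (M := ℂ) (R := ℂ) (N := ℂ) fun w : FreeSemigroup (ULift.{u} X) =>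
    (μ (w.word.map ULift.down)) • (LinearMap.id : ℂ →ₗ[ℂ] ℂ)) ∘ₗ
      (MonoidAlgebra.coeffLinearEquiv ℂ : WordAlg.{u} X ≃ₗ[ℂ] _).toLinearMap

theorem functional_single (μ : List X → ℂ) (w : FreeSemigroup (ULift.{u} X)) :
    functional c μ (MonoidAlgebra.single w 1 : WordAlg.{u} X) = μ (w.word.map ULift.down) := by
  change (Finsupp.lsum ℂ (M := ℂ) (R := ℂ) (N := ℂ) fun w : FreeSemigroup (ULift.{u} X) =>
    (μ (w.word.map ULift.down)) • (LinearMap.id : ℂ →ₗ[ℂ] ℂ)) (Finsupp.single w 1) = _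
  simp

theorem functional_word (μ : List X → ℂ) {v : List X} (hv : v ≠ []) :
    functional.{u} c μ (listProd (v.map gen)) = μ v := by
  obtain ⟨x, v, rfl⟩ := List.exists_cons_of_ne_nil hv
  have := functional_single.{u} (c := c) μ ⟨ULift.up x, v.map ULift.up⟩
  rw [WordAlg.single_eq_listProd] at this
  simp only [FreeSemigroup.word, List.map_cons, List.map_map, Function.comp_def,
    List.map_id'] at this
  exact this

theorem functional_ext {φ ψ : (freeMF.{u} X c).Functional}
    (H : ∀ v : List X, v ≠ [] → φ (listProd (v.map gen)) = ψ (listProd (v.map gen))) : φ = ψ := by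
  refine LinearMap.ext fun y => ?_
  change WordAlg.{u} X at y
  induction y using MonoidAlgebra.induction_linear with
  | zero => exact (map_zero φ).trans (map_zero ψ).symm
  | add x y hx hy => 
    exact (map_add φ x y).trans ((congrArg₂ (· + ·) hx hy).trans (map_add ψ x y).symm)
  | single w r =>
    have : (MonoidAlgebra.single w r : WordAlg.{u} X) = r • MonoidAlgebra.single w 1 := by simp
    rw [this, WordAlg.single_eq_listProd]
    have h := H (w.word.map ULift.down) (by simp [FreeSemigroup.word_ne_nil])
    rw [List.map_map] at h
    exact (map_smul φ r _).trans ((congrArg (r • ·) h).trans (map_smul ψ r _).symm)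

end freeMF

/-! ## Reduction of multilinear functions of joint laws to indicator laws -/

/-- The joint law of the elements `a ℓ` under a functional `φ`. -/
def jointLaw {A : Type*} [NonUnitalRing A] [Module ℂ A] {L : Type} (φ : A →ₗ[ℂ] ℂ) (a : L → A) :
    List L → ℂ :=
  fun w => φ (listProd (w.map a))

/-- A function of joint laws of letters of colours `f ℓ` is multilinear if it is multilinear in the
letters. -/
def LawMultilinear {F L : Type} (f : L → F) (D : (List L → ℂ) → ℂ) : Prop :=
  ∀ (X : Type) (c : X → F) (μ : List X → ℂ), ∃ m : MultilinearMap ℂ (fun _ : L => freeMF.{u} X c) ℂ,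
    ∀ a : L → freeMF.{u} X c, (∀ ℓ, a ℓ ∈ (freeMF.{u} X c).face (f ℓ)) →
      m a = D (jointLaw (freeMF.functional c μ) a)

/-- A partition of `L` into words: `e ℓ` is the word which contains the letter `ℓ`. -/
structure IsWordPartition {L : Type} (e : L → List L) : Prop where
  mem : ∀ ℓ, ℓ ∈ e ℓ
  nodup : ∀ ℓ, (e ℓ).Nodup
  eq_of_mem : ∀ ℓ, ∀ m ∈ e ℓ, e m = e ℓ

open Classical in
/-- The joint law which is `1` at the words of a partition into words and `0` elsewhere. -/
noncomputable def indicatorLaw {L : Type} (e : L → List L) : List L → ℂ :=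
  fun w => if ∃ ℓ, e ℓ = w then 1 else 0

namespace LawMultilinear

section Algebra

variable {F L : Type} {f : L → F} {D D' : (List L → ℂ) → ℂ}

theorem sub (h : LawMultilinear.{u} f D) (h' : LawMultilinear.{u} f D') :
    LawMultilinear.{u} f (fun μ => D μ - D' μ) := by
  intro X c μ
  obtain ⟨m, hm⟩ := h X c μ
  obtain ⟨m', hm'⟩ := h' X c μ
  exact ⟨m - m', fun a ha => by simp [hm a ha, hm' a ha]⟩

theorem const_mul (r : ℂ) (h : LawMultilinear.{u} f D) :
    LawMultilinear.{u} f (fun μ => r * D μ) := by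
  intro X c μ
  obtain ⟨m, hm⟩ := h X c μ
  exact ⟨r • m, fun a ha => by simp [hm a ha]⟩

theorem sum {ι : Type*} (s : Finset ι) {D : ι → (List L → ℂ) → ℂ}
    (h : ∀ i ∈ s, LawMultilinear.{u} f (D i)) :
    LawMultilinear.{u} f (fun μ => ∑ i ∈ s, D i μ) := by
  classical
  intro X c μ
  choose! m hm using fun i (hi : i ∈ s) => h i hi X c μ
  refine ⟨∑ i ∈ s, m i, fun a ha => ?_⟩
  rw [_root_.sum_apply]
  exact Finset.sum_congr rfl fun i hi => hm i hi a ha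

end Algebra

/-- The labels which are attached to letters in order to separate the words. -/
abbrev Label (L : Type) : Type := {l : List L // l.Nodup} ⊕ Bool

section Canonical

variable {L : Type} [DecidableEq L]

/-- A labelling of words with repeated letters. -/
def markRepeated : List L → List (L × Label L)
  | [] => []
  | a :: w => (a, Sum.inr (decide (a ∈ w))) :: markRepeated w

/-- A labelling of words for which a labelling by a function on the letters occurs only if the word
has no repeated letters and all of them are labelled by the word. -/
def canonical (w : List L) : List (L × Label L) :=
  if h : w.Nodup then w.map fun ℓ => (ℓ, Sum.inl ⟨w, h⟩) else markRepeated w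

theorem map_fst_canonical (w : List L) : (canonical w).map Prod.fst = w := by
  unfold canonical
  split_ifs with h
  · simp [Function.comp_def]
  · clear h
    induction w with
    | nil => rfl
    | cons a w ih => simp [markRepeated, ih]

/-- A mark records whether the letter recurs later in the word. The last occurrence of a repeated
letter and its earlier ones are marked differently, which a labelling depending on the letter alone
cannot do. -/
theorem nodup_of_markRepeated {ε : L → Label L} {w : List L}
    (h : w.map (fun ℓ => (ℓ, ε ℓ)) = markRepeated w) :
    w.Nodup ∧ ∀ a ∈ w, ε a = Sum.inr false := by
  induction w with
  | nil => simp
  | cons a w ih =>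
    simp only [List.map_cons, markRepeated, List.cons.injEq, Prod.mk.injEq, true_and] at h
    obtain ⟨h₁, h₂⟩ := ih h.2
    have ha : a ∉ w := by
      intro ha
      have := h₂ a ha
      rw [h.1] at this
      simp [ha] at this
    refine ⟨List.nodup_cons.2 ⟨ha, h₁⟩, ?_⟩
    intro b hb
    rcases List.mem_cons.1 hb with rfl | hb
    · rw [h.1]; simp [ha]
    · exact h₂ b hb

theorem nodup_of_canonical {ε : L → Label L} {w : List L}
    (h : w.map (fun ℓ => (ℓ, ε ℓ)) = canonical w) :
    ∃ hw : w.Nodup, ∀ ℓ ∈ w, ε ℓ = Sum.inl ⟨w, hw⟩ := by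
  unfold canonical at h
  split_ifs at h with hw
  · refine ⟨hw, fun ℓ hℓ => ?_⟩
    have := List.map_inj_left.1 h ℓ hℓ
    simpa using this
  · exact absurd (nodup_of_markRepeated h).1 hw

end Canonical

theorem listProd_middle_sum {A : Type*} [NonUnitalRing A] {J : Type*} (s : Finset J) (x : J → A)
    (l₁ l₂ : List A) :
    listProd (l₁ ++ (∑ j ∈ s, x j) :: l₂) = ∑ j ∈ s, listProd (l₁ ++ x j :: l₂) := by
  classical
  induction s using Finset.induction_on with
  | empty => simp [listProd_eq_zero]
  | insert j s hj ih => rw [Finset.sum_insert hj, listProd_middle_add, ih, Finset.sum_insert hj]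

theorem functional_word' {F X : Type} {c : X → F} {μ : List X → ℂ} (hμ : μ [] = 0) (v : List X) :
    freeMF.functional.{u} c μ (listProd (v.map freeMF.gen)) = μ v := by
  by_cases hv : v = []
  · subst hv; rw [hμ]; exact map_zero _
  · exact freeMF.functional_word μ hv

/-- The joint law of sums of labelled letters. -/
theorem functional_sum_labels {F L J : Type} [Fintype J] [DecidableEq (L × J)] [DecidableEq L]
    {c : L × J → F}
    {μ : List (L × J) → ℂ} (hμ : μ [] = 0) (r : ℂ) (w : List L) (p v₀ : List (L × J))
    (h : ∀ v, v.map Prod.fst = w → μ (p ++ v) = if v = v₀ then r else 0) :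
    freeMF.functional.{u} c μ (listProd (p.map freeMF.gen ++
      w.map fun ℓ => ∑ j, freeMF.gen (ℓ, j))) = if v₀.map Prod.fst = w then r else 0 := by
  induction w generalizing p v₀ r with
  | nil =>
    have := h [] rfl
    simp only [List.map_nil, List.append_nil] at this ⊢
    rw [functional_word' hμ, this]
    cases v₀ <;> simp
  | cons ℓ w ih =>
    -- The sum at the first letter is expanded, and the chosen labelled copy joins the prefix `p`.
    -- Only the copy which is the head of `v₀` can retain weight.
    rw [List.map_cons, listProd_middle_sum, map_sum]
    have key : ∀ j, p.map freeMF.gen ++ freeMF.gen (ℓ, j) :: w.map (fun ℓ => ∑ j, freeMF.gen.{u} (c := c) (ℓ, j))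
        = (p ++ [(ℓ, j)]).map freeMF.gen ++ w.map (fun ℓ => ∑ j, freeMF.gen (ℓ, j)) := by
      intro j; simp
    simp only [key]
    cases v₀ with
    | nil =>
      rw [Finset.sum_eq_zero]
      · simp
      · intro j _
        rw [ih 0 (p ++ [(ℓ, j)]) []]
        · simp
        · intro v hv
          have := h ((ℓ, j) :: v) (by simp [hv])
          simpa using this
    | cons x v₀ =>
      obtain ⟨ℓ', j'⟩ := x
      have : ∀ j, freeMF.functional.{u} c μ (listProd ((p ++ [(ℓ, j)]).map freeMF.gen ++
          w.map fun ℓ => ∑ j, freeMF.gen (ℓ, j))) =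
          if v₀.map Prod.fst = w then (if (ℓ', j') = (ℓ, j) then r else 0) else 0 := by
        intro j
        refine ih _ (p ++ [(ℓ, j)]) v₀ ?_
        intro v hv
        have := h ((ℓ, j) :: v) (by simp [hv])
        rw [List.append_assoc, List.singleton_append, this]
        by_cases h1 : v = v₀ <;> by_cases h2 : (ℓ', j') = (ℓ, j)
        · simp [h1, h2]
        · rw [if_neg (fun h => h2 (List.cons.inj h).1.symm)]; simp [h2]
        · rw [if_neg (fun h => h1 (List.cons.inj h).2)]; simp [h1]
        · rw [if_neg (fun h => h1 (List.cons.inj h).2)]; simp [h1]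
      simp only [this]
      by_cases h1 : v₀.map Prod.fst = w <;> by_cases h2 : ℓ' = ℓ
      · subst h2
        rw [Finset.sum_eq_single j'] <;> simp +contextual [h1, eq_comm]
      · simp [h1, h2]
      · simp [h1]
      · simp [h1]

section Reduction

variable {F L : Type} [Fintype L] {f : L → F} {D : (List L → ℂ) → ℂ}

/-- A multilinear function of joint laws vanishes if the law gives no weight to words which contain
a certain letter. -/
theorem eq_zero_of_dead (hD : LawMultilinear.{u} f D) {ν : List L → ℂ} (h0 : ν [] = 0) {ℓ : L}
    (h : ∀ w, ℓ ∈ w → ν w = 0) : D ν = 0 := by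
  classical
  obtain ⟨m, hm⟩ := hD L f ν
  -- Replacing `ℓ` by zero leaves the joint law unchanged, as words through `ℓ` have no weight,
  -- whereas a multilinear map vanishes at a zero argument.
  have h1 := hm (Function.update freeMF.gen ℓ 0) fun k => by
    by_cases hk : k = ℓ
    · subst hk; simp
    · simpa [hk] using freeMF.gen_mem k
  have h2 : jointLaw (freeMF.functional.{u} f ν) (Function.update freeMF.gen ℓ 0) = ν := by
    funext w
    unfold jointLaw
    by_cases hw : ℓ ∈ w
    · rw [h w hw, listProd_eq_zero, map_zero]
      exact List.mem_map.2 ⟨ℓ, hw, by simp⟩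
    · rw [List.map_congr_left (g := freeMF.gen) (fun k hk => ?_), functional_word' h0]
      have hkℓ : k ≠ ℓ := fun h' => hw (h' ▸ hk)
      exact Function.update_of_ne hkℓ _ _
  rw [h2] at h1
  rw [← h1]
  exact m.map_coord_zero ℓ (by simp)

theorem listProd_map_smul {A : Type*} [NonUnitalRing A] [Module ℂ A] [IsScalarTower ℂ A A]
    [SMulCommClass ℂ A A] {X : Type*} (t : X → ℂ) (a : X → A) (w : List X) :
    listProd (w.map fun x => t x • a x) = (w.map t).prod • listProd (w.map a) := by
  induction w with
  | nil => simp [listProd]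
  | cons x w ih =>
    by_cases hw : w = []
    · subst hw; simp [listProd]
    · rw [List.map_cons, listProd_cons (by simp [hw]), ih, List.map_cons, List.map_cons,
        listProd_cons (by simp [hw]), List.prod_cons, smul_mul_smul_comm]

/-- Multilinear functions of joint laws scale with the letters. -/
theorem map_scale (hD : LawMultilinear.{u} f D) {ν : List L → ℂ} (h0 : ν [] = 0) (t : L → ℂ) :
    D (fun w => (w.map t).prod * ν w) = (∏ ℓ, t ℓ) * D ν := by
  obtain ⟨m, hm⟩ := hD L f ν
  have h1 := hm (fun ℓ => t ℓ • freeMF.gen ℓ) fun k => SMulMemClass.smul_mem _ (freeMF.gen_mem k)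
  have h2 := hm freeMF.gen freeMF.gen_mem
  have h3 : jointLaw (freeMF.functional.{u} f ν) freeMF.gen = ν :=
    funext fun w => functional_word' h0 w
  have h4 : jointLaw (freeMF.functional.{u} f ν) (fun ℓ => t ℓ • freeMF.gen ℓ) =
      fun w => (w.map t).prod * ν w := by
    funext w
    unfold jointLaw
    rw [listProd_map_smul, map_smul, functional_word' h0, smul_eq_mul]
  rw [h3] at h2
  rw [h4, m.map_smul_univ, h2] at h1
  exact h1.symm

/-- Multilinear functions of joint laws are determined by the indicator laws of partitions into
words. -/
theorem eq_zero (hD : LawMultilinear.{u} f D) {μ : List L → ℂ} (hμ : μ [] = 0)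
    (H : ∀ e, IsWordPartition e → D (indicatorLaw e) = 0 ∨ ∃ ℓ, μ (e ℓ) = 0) : D μ = 0 := by
  classical
  -- Every letter is replaced by the sum of its labelled copies, and `ν` puts the whole weight of a
  -- word `w` on the one labelled word `canonical w`. The sums then have joint law `μ`, and
  -- multilinearity leaves one term for each labelling `ε`.
  let c : L × Label L → F := fun x => f x.1
  let ν : List (L × Label L) → ℂ := fun v =>
    if v = canonical (v.map Prod.fst) then μ (v.map Prod.fst) else 0
  have hν0 : ν [] = 0 := by simp [ν, hμ]
  obtain ⟨m, hm⟩ := hD (L × Label L) c ν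
  have hsum := hm (fun ℓ => ∑ j, freeMF.gen (ℓ, j)) fun ℓ => sum_mem fun j _ =>
    freeMF.gen_mem (c := c) (ℓ, j)
  have hlaw : jointLaw (freeMF.functional.{u} c ν) (fun ℓ => ∑ j, freeMF.gen (ℓ, j)) = μ := by
    funext w
    have := functional_sum_labels.{u} (c := c) hν0 (μ w) w [] (canonical w) (by
      rintro v rfl
      simp only [List.nil_append, ν])
    rw [map_fst_canonical, if_pos rfl] at this
    exact this
  rw [hlaw, m.map_sum] at hsum
  rw [← hsum]
  refine Finset.sum_eq_zero fun ε _ => ?_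
  rw [hm _ fun ℓ => freeMF.gen_mem (c := c) (ℓ, ε ℓ)]
  set ρ := jointLaw (freeMF.functional.{u} c ν) (fun ℓ => freeMF.gen (ℓ, ε ℓ)) with hρ
  have hρw : ∀ w, ρ w = if w.map (fun ℓ => (ℓ, ε ℓ)) = canonical w then μ w else 0 := by
    intro w
    have : w.map (fun ℓ => freeMF.gen.{u} (c := c) (ℓ, ε ℓ)) =
        (w.map (fun ℓ => (ℓ, ε ℓ))).map freeMF.gen := by
      simp [Function.comp_def]
    rw [hρ, jointLaw, this, functional_word' hν0]
    simp [ν, Function.comp_def]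
  have hρ0 : ρ [] = 0 := by rw [hρw]; simp [hμ]
  -- For a consistent labelling the labels are the words of a partition `e`, and `ρ` is the
  -- indicator law of `e` with weights `μ (e ℓ)`.
  by_cases hg : ∀ ℓ, ∃ w : {l : List L // l.Nodup}, ε ℓ = Sum.inl w ∧ ℓ ∈ w.1 ∧
      ∀ k ∈ w.1, ε k = Sum.inl w
  · choose w hw₁ hw₂ hw₃ using hg
    let e : L → List L := fun ℓ => (w ℓ).1
    have he : IsWordPartition e := ⟨hw₂, fun ℓ => (w ℓ).2, fun ℓ k hk => by
      have := (hw₁ k).symm.trans (hw₃ ℓ k hk)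
      exact congrArg Subtype.val (Sum.inl.inj this)⟩
    -- The weight of a word is charged to its first letter, so that `ρ` arises from the indicator
    -- law by rescaling the letters.
    let t : L → ℂ := fun ℓ => if (e ℓ).head? = some ℓ then μ (e ℓ) else 1
    have ht : ∀ ℓ, ((e ℓ).map t).prod = μ (e ℓ) := by
      intro ℓ
      have h1 := he.eq_of_mem ℓ
      have h2 := he.nodup ℓ
      obtain ⟨x, v, hv⟩ := List.exists_cons_of_ne_nil (List.ne_nil_of_mem (he.mem ℓ))
      have hx : t x = μ (e ℓ) := by
        have := h1 x (by simp [hv])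
        simp [t, this, hv]
      rw [hv] at h2
      have hv' : ∀ y ∈ v, t y = 1 := by
        intro y hy
        have := h1 y (by simp [hv, hy])
        simp only [t, this, hv, List.head?_cons, Option.some.injEq]
        rw [if_neg]
        rintro rfl
        exact (List.nodup_cons.1 h2).1 hy
      conv_lhs => rw [hv]
      rw [List.map_cons, List.prod_cons, hx, List.prod_eq_one, mul_one]
      intro z hz
      obtain ⟨y, hy, rfl⟩ := List.mem_map.1 hz
      exact hv' y hy
    have hρe : ρ = fun v => (v.map t).prod * indicatorLaw e v := by
      funext v
      rw [hρw]
      by_cases hv0 : v = []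
      · subst hv0
        have : ¬ ∃ ℓ, e ℓ = [] := by
          rintro ⟨ℓ, h⟩
          have := he.mem ℓ
          simp [h] at this
        simp [hμ, indicatorLaw, this]
      by_cases hv : ∃ ℓ, e ℓ = v
      · obtain ⟨ℓ, rfl⟩ := hv
        have h1 : (e ℓ).map (fun ℓ => (ℓ, ε ℓ)) = canonical (e ℓ) := by
          rw [canonical, dif_pos (he.nodup ℓ)]
          refine List.map_congr_left fun k hk => ?_
          rw [hw₃ ℓ k hk]
        rw [if_pos h1, ht, indicatorLaw, if_pos ⟨ℓ, rfl⟩, mul_one]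
      · rw [indicatorLaw, if_neg hv, mul_zero, if_neg]
        intro h
        obtain ⟨hn, h⟩ := nodup_of_canonical h
        obtain ⟨x, v', rfl⟩ := List.exists_cons_of_ne_nil hv0
        refine hv ⟨x, ?_⟩
        have := (hw₁ x).symm.trans (h x (by simp))
        exact congrArg Subtype.val (Sum.inl.inj this)
    have hi0 : indicatorLaw e [] = 0 := by
      rw [indicatorLaw, if_neg]
      rintro ⟨ℓ, h⟩
      have := he.mem ℓ
      simp [h] at this
    rw [hρe, hD.map_scale hi0]
    rcases H e he with h | ⟨ℓ, hℓ⟩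
    · rw [h, mul_zero]
    · obtain ⟨x, v, hv⟩ := List.exists_cons_of_ne_nil (List.ne_nil_of_mem (he.mem ℓ))
      rw [Finset.prod_eq_zero (Finset.mem_univ x), zero_mul]
      have := he.eq_of_mem ℓ x (by simp [hv])
      simp only [t, this, hv, List.head?_cons, if_true]
      rw [← hv, hℓ]
  -- A letter violating consistency occurs in no word of nonzero weight, so it is dead.
  · push Not at hg
    obtain ⟨ℓ, hℓ⟩ := hg
    refine hD.eq_zero_of_dead hρ0 (ℓ := ℓ) fun w hw => ?_
    rw [hρw, if_neg]
    intro h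
    obtain ⟨hn, h⟩ := nodup_of_canonical h
    obtain ⟨k, hk, hk'⟩ := hℓ ⟨w, hn⟩ (h ℓ hw) hw
    exact hk' (h k hk)

end Reduction

end LawMultilinear

theorem indicatorLaw_nil {L : Type} {e : L → List L} (he : IsWordPartition e) :
    indicatorLaw e [] = 0 := by
  rw [indicatorLaw, if_neg]
  rintro ⟨ℓ, h⟩
  have := he.mem ℓ
  simp [h] at this

/-! ## Natural multilinear evaluations -/

/-- A family of functions on lists of constants from `K` and elements of multi-faced algebras
decorated by an index from `I`, natural with respect to homomorphisms and linear in each of the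
elements. -/
structure EvalFamily (F : Type) (K I : Type*) where
  ev : ∀ A : MFAlg.{u} F, A.Functional → List (K ⊕ I × A) → ℂ
  nat : ∀ {A B : MFAlg.{u} F} (φ : A.Functional) (h : B →ₙₐ[ℂ] A), MFAlg.IsFaced h →
    ∀ l : List (K ⊕ I × B), ev B (φ ∘ₗ (h : B →ₗ[ℂ] A)) l =
      ev A φ (l.map (Sum.map id (Prod.map id h)))
  map_add : ∀ {A : MFAlg.{u} F} (φ : A.Functional) (i : I) (x y : A) (l₁ l₂ : List (K ⊕ I × A)),
    ev A φ (l₁ ++ Sum.inr (i, x + y) :: l₂) =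
      ev A φ (l₁ ++ Sum.inr (i, x) :: l₂) + ev A φ (l₁ ++ Sum.inr (i, y) :: l₂)
  map_smul : ∀ {A : MFAlg.{u} F} (φ : A.Functional) (i : I) (r : ℂ) (x : A)
    (l₁ l₂ : List (K ⊕ I × A)),
    ev A φ (l₁ ++ Sum.inr (i, r • x) :: l₂) = r * ev A φ (l₁ ++ Sum.inr (i, x) :: l₂)

namespace EvalFamily

variable {F L : Type} {K I : Type*} (E : EvalFamily.{u} F K I)

/-- The substitution of elements for letters in a pattern. -/
abbrev subst {A : Type*} (a : L → A) (q : List (K ⊕ I × L)) : List (K ⊕ I × A) :=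
  q.map (Sum.map id (Prod.map id a))

/-- The value of a pattern as a function of the joint law of the elements substituted for the
letters. -/
noncomputable def ofLaw (f : L → F) (q : List (K ⊕ I × L)) (μ : List L → ℂ) : ℂ :=
  E.ev (freeMF.{u} L f) (freeMF.functional f μ) (subst freeMF.gen q)

theorem functional_jointLaw {f : L → F} {A : MFAlg.{u} F} (φ : A.Functional) (a : L → A) :
    freeMF.functional.{u} f (jointLaw φ a) =
      φ ∘ₗ (freeMF.lift a : freeMF.{u} L f →ₙₐ[ℂ] A) := by
  refine freeMF.functional_ext fun v hv => ?_
  rw [freeMF.functional_word _ hv]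
  change φ _ = φ (freeMF.lift a _)
  rw [map_listProd, List.map_map]
  congr 2
  refine List.map_congr_left fun x _ => ?_
  simp

/-- Naturality along the homomorphism from the free algebra which substitutes the elements for the
letters: the pulled back functional is the one given by the joint law. -/
theorem ev_subst {f : L → F} (q : List (K ⊕ I × L)) {A : MFAlg.{u} F} (φ : A.Functional)
    {a : L → A} (ha : ∀ ℓ, a ℓ ∈ A.face (f ℓ)) :
    E.ev A φ (subst a q) = E.ofLaw f q (jointLaw φ a) := by
  unfold ofLaw
  rw [functional_jointLaw, E.nat φ _ (freeMF.isFaced_lift ha), subst, subst, List.map_map]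
  congr 2
  funext x
  rcases x with k | ⟨i, ℓ⟩ <;> simp

/-- A pattern which contains each letter once. -/
def Once (q : List (K ⊕ I × L)) : Prop :=
  ∀ ℓ, ∃ (q₁ q₂ : List (K ⊕ I × L)) (i : I), q = q₁ ++ Sum.inr (i, ℓ) :: q₂ ∧
    ∀ i' : I, (Sum.inr (i', ℓ) : K ⊕ I × L) ∉ q₁ ∧ (Sum.inr (i', ℓ) : K ⊕ I × L) ∉ q₂

theorem subst_update [DecidableEq L] {A : Type*} (a : L → A) (ℓ : L) (x : A) {q : List (K ⊕ I × L)}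
    (h : ∀ i' : I, (Sum.inr (i', ℓ) : K ⊕ I × L) ∉ q) :
    subst (Function.update a ℓ x) q = subst a q := by
  refine List.map_congr_left fun y hy => ?_
  rcases y with k | ⟨i, k⟩
  · rfl
  · have : k ≠ ℓ := by rintro rfl; exact h i hy
    simp [this]

theorem lawMultilinear_ofLaw (f : L → F) {q : List (K ⊕ I × L)} (hq : Once q) :
    LawMultilinear.{u} f (E.ofLaw f q) := by
  intro X c μ
  refine ⟨{ toFun := fun a => E.ev _ (freeMF.functional c μ) (subst a q)
            map_update_add' := ?_
            map_update_smul' := ?_ }, fun a ha => E.ev_subst q _ ha⟩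
  · intro _ a ℓ x y
    obtain ⟨q₁, q₂, i, rfl, h⟩ := hq ℓ
    simp only [subst, List.map_append, List.map_cons]
    have h₁ := fun z => subst_update a ℓ z fun i' => (h i').1
    have h₂ := fun z => subst_update a ℓ z fun i' => (h i').2
    simp only [subst] at h₁ h₂
    simp only [h₁, h₂, Sum.map_inr, Prod.map, id_eq, Function.update_self, E.map_add]
  · intro _ a ℓ r x
    obtain ⟨q₁, q₂, i, rfl, h⟩ := hq ℓ
    simp only [subst, List.map_append, List.map_cons]
    have h₁ := fun z => subst_update a ℓ z fun i' => (h i').1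
    have h₂ := fun z => subst_update a ℓ z fun i' => (h i').2
    simp only [subst] at h₁ h₂
    simp only [h₁, h₂, Sum.map_inr, Prod.map, id_eq, Function.update_self, E.map_smul, smul_eq_mul]

theorem ev_eq_zero [Fintype L] {f : L → F} {q : List (K ⊕ I × L)} (hq : Once q)
    {A : MFAlg.{u} F} (φ : A.Functional) {a : L → A} (ha : ∀ ℓ, a ℓ ∈ A.face (f ℓ))
    (H : ∀ e, IsWordPartition e → E.ofLaw f q (indicatorLaw e) = 0 ∨ ∃ ℓ, jointLaw φ a (e ℓ) = 0) :
    E.ev A φ (subst a q) = 0 := by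
  rw [E.ev_subst q φ ha]
  exact (E.lawMultilinear_ofLaw f hq).eq_zero (map_zero φ) H

end EvalFamily

/-! ## Matrix models -/

/-- The two-faced algebra both of whose faces are the algebra of `ι × ι` matrices. -/
noncomputable def matrixMF (ι : Type u) [Fintype ι] [DecidableEq ι] : MFAlg.{u} TwoFaces where
  carrier := FreeProd (Matrix ι ι ℂ) (Matrix ι ι ℂ)
  face
    | TwoFaces.white => NonUnitalAlgHom.range FreeProd.inl
    | TwoFaces.black => NonUnitalAlgHom.range FreeProd.inr
  free := by
    intro C _ _ _ _ g
    refine ⟨FreeProd.lift ((g TwoFaces.white).comp (NonUnitalAlgHom.codRestrict FreeProd.inl _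
        fun m => ⟨m, rfl⟩)) ((g TwoFaces.black).comp (NonUnitalAlgHom.codRestrict FreeProd.inr _
        fun m => ⟨m, rfl⟩)), ?_, ?_⟩
    · rintro (_ | _) ⟨_, m, rfl⟩
      · exact FreeProd.lift_inl _ _ m
      · exact FreeProd.lift_inr _ _ m
    · intro k hk
      refine FreeProd.hom_ext (fun m => ?_) (fun m => ?_)
      · rw [FreeProd.lift_inl]; exact hk TwoFaces.white ⟨_, m, rfl⟩
      · rw [FreeProd.lift_inr]; exact hk TwoFaces.black ⟨_, m, rfl⟩

namespace matrixMF

variable {ι : Type u} [Fintype ι] [DecidableEq ι]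

/-- The embedding of the matrices as the face of colour `f`. -/
noncomputable def emb : TwoFaces → (Matrix ι ι ℂ →ₙₐ[ℂ] matrixMF ι)
  | TwoFaces.white => (FreeProd.inl : _ →ₙₐ[ℂ] FreeProd (Matrix ι ι ℂ) (Matrix ι ι ℂ))
  | TwoFaces.black => (FreeProd.inr : _ →ₙₐ[ℂ] FreeProd (Matrix ι ι ℂ) (Matrix ι ι ℂ))

theorem mem_face {f : TwoFaces} {x : matrixMF ι} :
    x ∈ (matrixMF ι).face f ↔ ∃ m, emb f m = x := by
  cases f <;> exact Iff.rfl

theorem emb_mem (f : TwoFaces) (m : Matrix ι ι ℂ) : emb f m ∈ (matrixMF ι).face f :=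
  mem_face.2 ⟨m, rfl⟩

/-- The representation of the doubled matrix algebra by matrices. -/
noncomputable def rep : matrixMF ι →ₙₐ[ℂ] Matrix ι ι ℂ :=
  (FreeProd.lift (NonUnitalAlgHom.id ℂ _) (NonUnitalAlgHom.id ℂ _) :
    FreeProd (Matrix ι ι ℂ) (Matrix ι ι ℂ) →ₙₐ[ℂ] _)

@[simp] theorem rep_emb (f : TwoFaces) (m : Matrix ι ι ℂ) : rep (emb f m) = m := by
  cases f
  · exact FreeProd.lift_inl _ _ m
  · exact FreeProd.lift_inr _ _ m

/-- The vector state given by a basis vector. -/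
noncomputable def vec (o : ι) : (matrixMF ι).Functional :=
  (Matrix.entryLinearMap ℂ ℂ o o) ∘ₗ
    ((rep : matrixMF ι →ₙₐ[ℂ] Matrix ι ι ℂ) : matrixMF ι →ₗ[ℂ] Matrix ι ι ℂ)

theorem vec_apply (o : ι) (x : matrixMF ι) : vec o x = rep x o o := rfl

noncomputable instance : StarRing (matrixMF ι) :=
  inferInstanceAs (StarRing (FreeProd (Matrix ι ι ℂ) (Matrix ι ι ℂ)))

instance : StarModule ℂ (matrixMF ι) :=
  inferInstanceAs (StarModule ℂ (FreeProd (Matrix ι ι ℂ) (Matrix ι ι ℂ)))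

theorem star_emb (f : TwoFaces) (m : Matrix ι ι ℂ) : star (emb f m) = emb f (star m) := by
  cases f
  · exact FreeProd.star_inl m
  · exact FreeProd.star_inr m

theorem facesStarClosed : (matrixMF ι).FacesStarClosed := by
  intro f a ha
  obtain ⟨m, rfl⟩ := mem_face.1 ha
  rw [star_emb]
  exact emb_mem f _

theorem induction {p : matrixMF ι → Prop} (emb : ∀ f m, p (emb f m))
    (zero : p 0) (add : ∀ x y, p x → p y → p (x + y)) (mul : ∀ x y, p x → p y → p (x * y))
    (smul : ∀ (c : ℂ) x, p x → p (c • x)) (x : matrixMF ι) : p x := by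
  refine MFAlg.face_induction (matrixMF ι) ?_ zero add mul smul x
  intro f a ha
  obtain ⟨m, rfl⟩ := mem_face.1 ha
  exact emb f m

theorem rep_star (x : matrixMF ι) : rep (star x) = star (rep x) := by
  induction x using matrixMF.induction with
  | emb f m => simp [star_emb]
  | zero => simp
  | add x y h₁ h₂ => simp [h₁, h₂]
  | mul x y h₁ h₂ => simp [h₁, h₂]
  | smul c x h => simp [h]

theorem jointLaw_vec {L : Type} (o : ι) (f : L → TwoFaces) (X : L → Matrix ι ι ℂ) {v : List L}
    (hv : v ≠ []) : jointLaw (vec o) (fun ℓ => emb (f ℓ) (X ℓ)) v = (v.map X).prod o o := by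
  have : ∀ l : List (Matrix ι ι ℂ), l ≠ [] → listProd l = l.prod := by
    intro l hl
    induction l with
    | nil => exact absurd rfl hl
    | cons a l ih =>
      by_cases h : l = []
      · subst h; simp [listProd]
      · rw [List.prod_cons, ← ih h, listProd_cons h]
  rw [jointLaw, vec_apply, map_listProd, List.map_map, ← this _ (by simpa using hv)]
  have h : v.map (rep ∘ fun ℓ => emb (f ℓ) (X ℓ)) = v.map X := List.map_congr_left fun x _ => by simp
  rw [h]

/-- The unital extension of the representation turns the value at `star x * x` into the squared norm
of a column. -/
theorem isRestrictedState_vec (o : ι) : IsRestrictedState (vec o) := by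
  intro x
  let ρ : Matrix ι ι ℂ := x.fst • 1 + rep x.snd
  have key : (star x * x).fst + vec o (star x * x).snd = (star ρ * ρ) o o := by
    rw [vec_apply]
    simp only [Unitization.fst_mul, Unitization.fst_star, Unitization.snd_mul,
      Unitization.snd_star, map_add, map_smul, map_mul, rep_star, ρ, star_add, star_smul, star_one,
      add_mul, mul_add, smul_mul_assoc, mul_smul_comm, one_mul, mul_one, Matrix.add_apply,
      Matrix.smul_apply, Matrix.one_apply_eq, smul_eq_mul]
    ring
  have h2 : (star ρ * ρ) o o = ∑ i, ((Complex.normSq (ρ i o) : ℝ) : ℂ) := by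
    rw [Matrix.mul_apply]
    refine Finset.sum_congr rfl fun i _ => ?_
    rw [Matrix.star_apply, Complex.normSq_eq_conj_mul_self]
    rfl
  rw [key, h2, ← Complex.ofReal_sum]
  exact ⟨by rw [Complex.ofReal_re]; exact Finset.sum_nonneg fun i _ => Complex.normSq_nonneg _,
    Complex.ofReal_im _⟩

end matrixMF

/-! ## Indicator laws as laws of matrices -/

namespace IsWordPartition

theorem split_unique {L : Type} {l u v u' v' : List L} {x : L} (hn : l.Nodup) (h : l = u ++ x :: v)
    (h' : l = u' ++ x :: v') : u = u' ∧ v = v' := by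
  subst h
  induction u generalizing u' with
  | nil =>
    cases u' with
    | nil => simpa using h'
    | cons a u' =>
      simp only [List.nil_append, List.cons_append, List.cons.injEq] at h'
      obtain ⟨rfl, rfl⟩ := h'
      simp at hn
  | cons b u ih =>
    cases u' with
    | nil =>
      simp only [List.nil_append, List.cons_append, List.cons.injEq] at h'
      obtain ⟨rfl, rfl⟩ := h'
      simp at hn
    | cons a u' =>
      simp only [List.cons_append, List.cons.injEq] at h'
      obtain ⟨rfl, h'⟩ := h'
      obtain ⟨h1, h2⟩ := ih (List.nodup_cons.1 hn).2 h'
      exact ⟨by rw [h1], h2⟩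

section Model

variable {L : Type} [Fintype L] [DecidableEq L]

/-- The index set of the matrices which realize an indicator law. -/
abbrev Idx (L : Type) : Type u := ULift.{u} (L ⊕ Bool)

/-- The index of the state vector. -/
abbrev base : Idx.{u} L := ⟨Sum.inr true⟩

open Classical in
/-- The image vector of the rank one matrix assigned to a letter. -/
noncomputable def target (e : L → List L) (ℓ : L) : Idx.{u} L → ℂ
  | ⟨Sum.inl t⟩ => if (e ℓ).head? ≠ some ℓ ∧ t = ℓ then 1 else 0
  | ⟨Sum.inr _⟩ => if (e ℓ).head? = some ℓ then 1 else 0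

open Classical in
/-- The covector of the rank one matrix assigned to a letter. -/
noncomputable def source (e : L → List L) (ℓ : L) : Idx.{u} L → ℂ
  | ⟨Sum.inl t⟩ => if [ℓ, t] <:+: e ℓ then 1 else 0
  | ⟨Sum.inr true⟩ => if [ℓ] <:+ e ℓ then 1 else 0
  | ⟨Sum.inr false⟩ => if [ℓ] <:+ e ℓ then -1 else 0

/-- The rank one matrix assigned to a letter. -/
noncomputable def model (e : L → List L) (ℓ : L) : Matrix (Idx.{u} L) (Idx.{u} L) ℂ :=
  Matrix.vecMulVec (target e ℓ) (source e ℓ)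

open Classical in
-- The second extra index serves this formula. If `x` ends a word and `y` begins one, the entries at
-- the state vector alone would give `1`, and concatenations of words would acquire weight; the
-- entry `-1` at the index `false` cancels this.
theorem source_dotProduct_target (e : L → List L) (x y : L) :
    dotProduct (source.{u} e x) (target e y) =
      if (e y).head? ≠ some y ∧ [x, y] <:+: e x then 1 else 0 := by
  rw [dotProduct, ← Equiv.sum_comp Equiv.ulift.symm, Fintype.sum_sum_type]
  simp only [Fintype.sum_bool]
  rw [Finset.sum_eq_single y]
  · simp only [Equiv.ulift, Equiv.coe_fn_symm_mk, source, target]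
    split_ifs <;> simp_all
  · intro t _ ht
    simp [target, ht, Equiv.ulift]
  · simp

variable {e : L → List L} (he : IsWordPartition e)

include he

open Classical in
-- Letters act from right to left. The state vector is seen only by letters ending a word, and each
-- further letter has to be the predecessor of the one applied before it, so a product survives
-- precisely while it spells a suffix of a word.
theorem model_mulVec_list (x : L) (v : List L) :
    ((x :: v).map (model.{u} e)).prod.mulVec (Pi.single base 1) =
      if x :: v <:+ e x then target e x else 0 := by
  induction v generalizing x with
  | nil =>
    funext i
    simp only [List.map_cons, List.map_nil, List.prod_cons, List.prod_nil, mul_one, model]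
    rw [Matrix.mulVec_single_one]
    simp only [Matrix.col_apply, Matrix.vecMulVec_apply, source]
    split_ifs <;> simp
  | cons y v ih =>
    rw [List.map_cons, List.prod_cons, ← Matrix.mulVec_mulVec, ih]
    by_cases hy : y :: v <:+ e y
    · rw [if_pos hy, model, Matrix.vecMulVec_mulVec, source_dotProduct_target]
      have hiff : ((e y).head? ≠ some y ∧ [x, y] <:+: e x) ↔ x :: y :: v <:+ e x := by
        constructor
        · rintro ⟨-, u, w, h⟩
          have hyx : e y = e x := he.eq_of_mem x y (by rw [← h]; simp)
          rw [hyx] at hy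
          obtain ⟨u', h'⟩ := hy
          obtain ⟨h1, h2⟩ := split_unique (he.nodup x) (x := y) (u := u ++ [x]) (v := w)
            (by rw [← h]; simp) h'.symm
          exact ⟨u, by rw [← h, h2]; simp⟩
        · rintro ⟨u, h⟩
          have hyx : e y = e x := he.eq_of_mem x y (by rw [← h]; simp)
          refine ⟨?_, u, v, by rw [← h]; simp⟩
          intro hh
          rw [hyx] at hh
          obtain ⟨w, hw⟩ : ∃ w, e x = y :: w := by
            cases hx : e x with
            | nil => rw [hx] at hh; simp at hh
            | cons z w => rw [hx] at hh; simp at hh; exact ⟨w, by rw [hh]⟩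
          obtain ⟨h1, h2⟩ := split_unique (he.nodup x) (x := y) (u := []) (v := w)
            (u' := u ++ [x]) (v' := v) hw (by rw [← h]; simp)
          simp at h1
      by_cases h : x :: y :: v <:+ e x
      · rw [if_pos h, if_pos (hiff.2 h)]; simp
      · rw [if_neg h, if_neg (fun h' => h (hiff.1 h'))]; simp
    · rw [if_neg hy, Matrix.mulVec_zero, if_neg]
      rintro ⟨u, h⟩
      have hyx : e y = e x := he.eq_of_mem x y (by rw [← h]; simp)
      exact hy (hyx ▸ ⟨u ++ [x], by rw [← h]; simp⟩)

/-- An indicator law is the law of the assigned rank one matrices in a vector state. -/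
theorem indicatorLaw_eq (v : List L) (hv : v ≠ []) :
    indicatorLaw e v = (v.map (model.{u} e)).prod base base := by
  classical
  obtain ⟨x, v, rfl⟩ := List.exists_cons_of_ne_nil hv
  have h := congrFun (he.model_mulVec_list x v) base
  rw [Matrix.mulVec_single_one, Matrix.col_apply] at h
  rw [h]
  by_cases h' : ∃ ℓ, e ℓ = x :: v
  · obtain ⟨ℓ, hℓ⟩ := h'
    have hx : e x = x :: v := by rw [he.eq_of_mem ℓ x (by simp [hℓ]), hℓ]
    rw [indicatorLaw, if_pos ⟨ℓ, hℓ⟩, if_pos (hx ▸ List.suffix_refl _)]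
    simp [target, hx]
  · rw [indicatorLaw, if_neg h']
    split_ifs with hs
    · simp only [target]
      rw [if_neg]
      intro hh
      obtain ⟨w, hw⟩ : ∃ w, e x = x :: w := by
        cases hx : e x with
        | nil => rw [hx] at hh; simp at hh
        | cons z w => rw [hx] at hh; simp at hh; exact ⟨w, by rw [hh]⟩
      obtain ⟨u, hu⟩ := hs
      obtain ⟨h1, h2⟩ := split_unique (he.nodup x) (x := x) (u := []) (v := w) hw hu.symm
      exact h' ⟨x, by rw [hw, h2]⟩
    · rfl

/-- An indicator law is the joint law of elements of a matrix model. -/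
theorem indicatorLaw_eq_jointLaw (f : L → TwoFaces) :
    indicatorLaw e = jointLaw (matrixMF.vec (base.{u} (L := L)))
      (fun ℓ => matrixMF.emb (f ℓ) (model e ℓ)) := by
  funext v
  by_cases hv : v = []
  · subst hv; rw [indicatorLaw_nil he]; exact (map_zero _).symm
  · rw [he.indicatorLaw_eq v hv, matrixMF.jointLaw_vec _ _ _ hv]

end Model

end IsWordPartition

/-- Natural multilinear evaluations vanish if they vanish on matrix models. -/
theorem EvalFamily.ev_eq_zero_of_model {L : Type} [Fintype L] {K I : Type*}
    (E : EvalFamily.{u} TwoFaces K I) {f : L → TwoFaces} {q : List (K ⊕ I × L)} (hq : Once q)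
    (H : ∀ (ι : Type u) [Fintype ι] [DecidableEq ι] (o : ι) (X : L → Matrix ι ι ℂ),
      E.ev (matrixMF ι) (matrixMF.vec o) (subst (fun ℓ => matrixMF.emb (f ℓ) (X ℓ)) q) = 0)
    {A : MFAlg.{u} TwoFaces} (φ : A.Functional) {a : L → A} (ha : ∀ ℓ, a ℓ ∈ A.face (f ℓ)) :
    E.ev A φ (subst a q) = 0 := by
  classical
  refine E.ev_eq_zero hq φ ha fun e he => Or.inl ?_
  rw [he.indicatorLaw_eq_jointLaw f, ← E.ev_subst q _ fun ℓ => matrixMF.emb_mem _ _]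
  exact H _ _ _

/-! ## Null vectors of restricted states -/

section UnitExt

variable {A : Type u} [NonUnitalRing A] [Module ℂ A]

/-- The unital extension of a functional to the unitization. -/
noncomputable def unitExt (φ : A →ₗ[ℂ] ℂ) : Unitization ℂ A →ₗ[ℂ] ℂ where
  toFun x := x.fst + φ x.snd
  map_add' x y := by simp only [Unitization.fst_add, Unitization.snd_add, map_add]; ring
  map_smul' c x := by
    simp only [Unitization.fst_smul, Unitization.snd_smul, map_smul, smul_eq_mul, RingHom.id_apply]
    ring

theorem unitExt_apply (φ : A →ₗ[ℂ] ℂ) (x : Unitization ℂ A) : unitExt φ x = x.fst + φ x.snd := rfl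

@[simp] theorem unitExt_inr (φ : A →ₗ[ℂ] ℂ) (x : A) : unitExt φ (x : Unitization ℂ A) = φ x := by
  simp [unitExt_apply]

@[simp] theorem unitExt_one (φ : A →ₗ[ℂ] ℂ) : unitExt φ (1 : Unitization ℂ A) = 1 := by
  simp [unitExt_apply]

variable [IsScalarTower ℂ A A] [SMulCommClass ℂ A A] [StarRing A] [StarModule ℂ A]

/-- For a null vector `x` the value at the square of `y + t * c • x` is affine in the real parameter
`t`. An affine function which is nonnegative on the whole line is constant, so the mixed terms
cancel for each `c`; the choices `1` and `Complex.I` separate them. -/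
theorem IsRestrictedState.null {φ : A →ₗ[ℂ] ℂ} (hφ : IsRestrictedState φ) {x : Unitization ℂ A}
    (hx : unitExt φ (star x * x) = 0) (y : Unitization ℂ A) :
    unitExt φ (star y * x) = 0 ∧ unitExt φ (star x * y) = 0 := by
  have hpos : ∀ z : Unitization ℂ A, 0 ≤ (unitExt φ (star z * z)).re ∧
      (unitExt φ (star z * z)).im = 0 := hφ
  set p := unitExt φ (star y * x) with hp
  set q := unitExt φ (star x * y) with hq
  set n := unitExt φ (star y * y) with hn
  have expand : ∀ c : ℂ, unitExt φ (star (y + c • x) * (y + c • x)) =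
      n + c * p + (starRingEnd ℂ c) * q := by
    intro c
    simp only [star_add, star_smul, add_mul, mul_add, smul_mul_assoc, mul_smul_comm, map_add,
      map_smul, hx, smul_eq_mul]
    rw [hp, hq, hn, starRingEnd_apply]
    ring
  have main : ∀ c : ℂ, c * p + (starRingEnd ℂ c) * q = 0 := by
    intro c
    have him : ∀ t : ℝ, (n + (t * c) * p + (starRingEnd ℂ (t * c)) * q).im = 0 := fun t => by
      rw [← expand]; exact (hpos _).2
    have hre : ∀ t : ℝ, 0 ≤ (n + (t * c) * p + (starRingEnd ℂ (t * c)) * q).re := fun t => by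
      rw [← expand]; exact (hpos _).1
    set z := c * p + (starRingEnd ℂ c) * q with hz
    have e1 : ∀ t : ℝ, n + (t * c) * p + (starRingEnd ℂ (t * c)) * q = n + t * z := by
      intro t; rw [hz, map_mul, Complex.conj_ofReal]; ring
    simp only [e1, Complex.add_im, Complex.add_re, Complex.im_ofReal_mul,
      Complex.re_ofReal_mul] at him hre
    have h0 := him 0
    have h1 := him 1
    refine Complex.ext ?_ ?_
    · by_contra hne
      have hne' : z.re ≠ 0 := hne
      -- At this parameter the real part would be `-1`.
      have := hre (-(n.re + 1) / z.re)
      rw [div_mul_cancel₀ _ hne'] at this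
      linarith
    · change z.im = 0
      linarith
  have h1 := main 1
  have h2 := main Complex.I
  simp only [map_one, one_mul, Complex.conj_I] at h1 h2
  have h3 : p - q = 0 := by
    have : Complex.I * (p - q) = 0 := by rw [← h2]; ring
    exact (mul_eq_zero.1 this).resolve_left Complex.I_ne_zero
  have h4 : p = q := sub_eq_zero.1 h3
  constructor
  · have : 2 * p = 0 := by rw [← h1, h4]; ring
    simpa using this
  · have : 2 * q = 0 := by rw [← h1, h4]; ring
    simpa using this

theorem IsRestrictedState.null_left {φ : A →ₗ[ℂ] ℂ} (hφ : IsRestrictedState φ) {x : Unitization ℂ A}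
    (hx : unitExt φ (star x * x) = 0) (y : Unitization ℂ A) : unitExt φ (y * x) = 0 := by
  simpa using (hφ.null hx (star y)).1

theorem IsRestrictedState.null_right {φ : A →ₗ[ℂ] ℂ} (hφ : IsRestrictedState φ)
    {x : Unitization ℂ A} (hx : unitExt φ (x * star x) = 0) (y : Unitization ℂ A) :
    unitExt φ (x * y) = 0 := by
  simpa using (hφ.null (x := star x) (by simpa using hx) y).2

end UnitExt

theorem MFAlg.star_mem_coprodFace {F : Type} {A B : MFAlg.{u} F} [StarRing A] [StarModule ℂ A]
    [StarRing B] [StarModule ℂ B] (hA : A.FacesStarClosed) (hB : B.FacesStarClosed) {f : F}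
    {x : FreeProd A B} (hx : x ∈ MFAlg.coprodFace A B f) : star x ∈ MFAlg.coprodFace A B f := by
  induction hx using NonUnitalAlgebra.adjoin_induction with
  | mem x hx =>
    rcases hx with ⟨a, ha, rfl⟩ | ⟨b, hb, rfl⟩
    · rw [FreeProd.star_inl]
      exact MFAlg.inl_mem_coprodFace _ _ f (hA f a ha)
    · rw [FreeProd.star_inr]
      exact MFAlg.inr_mem_coprodFace _ _ f (hB f b hb)
  | add x y _ _ h₁ h₂ => rw [star_add]; exact add_mem h₁ h₂
  | zero => rw [star_zero]; exact zero_mem _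
  | mul x y _ _ h₁ h₂ => rw [star_mul]; exact mul_mem h₂ h₁
  | smul c x _ h => rw [star_smul]; exact SMulMemClass.smul_mem _ h

/-! ## Products of several functionals -/

namespace UniversalProduct

variable {F : Type} (P : UniversalProduct.{u} F)

/-- Universality for several factors; `H` is the free product of the `h κ`, built along the
recursion which defines the iterated product. -/
theorem exists_iterMap (k : ℕ) (A B : Fin (k + 1) → MFAlg.{u} F) (h : ∀ κ, B κ →ₙₐ[ℂ] A κ)
    (hh : ∀ κ, MFAlg.IsFaced (h κ)) :
    ∃ H : MFAlg.iterCoprod k B →ₙₐ[ℂ] MFAlg.iterCoprod k A, MFAlg.IsFaced H ∧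
      (∀ κ x, H (MFAlg.iterIncl k B κ x) = MFAlg.iterIncl k A κ (h κ x)) ∧
      ∀ (φ : ∀ κ, (A κ).Functional) (x : MFAlg.iterCoprod k B),
        P.iterProd k B (fun κ => φ κ ∘ₗ (h κ : B κ →ₗ[ℂ] A κ)) x = P.iterProd k A φ (H x) := by
  induction k with
  | zero =>
    refine ⟨h 0, hh 0, fun κ x => ?_, fun φ x => rfl⟩
    obtain rfl : κ = 0 := Fin.fin_one_eq_zero κ
    rfl
  | succ k ih =>
    obtain ⟨H, hH, hincl, hprod⟩ := ih (fun i => A i.succ) (fun i => B i.succ)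
      (fun i => h i.succ) (fun i => hh i.succ)
    refine ⟨MFAlg.coprodMap (h 0) H, MFAlg.isFaced_coprodMap (hh 0) hH, fun κ x => ?_,
      fun φ x => ?_⟩
    · induction κ using Fin.cases with
      | zero => exact MFAlg.coprodMap_inl _ _ x
      | succ i =>
        refine (MFAlg.coprodMap_inr _ _ _).trans ?_
        exact congrArg _ (hincl i x)
    · have h1 : P.iterProd k (fun i => B i.succ)
          (fun i => φ i.succ ∘ₗ (h i.succ : B i.succ →ₗ[ℂ] A i.succ)) =
          P.iterProd k (fun i => A i.succ) (fun i => φ i.succ) ∘ₗ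
            (H : MFAlg.iterCoprod k (fun i => B i.succ) →ₗ[ℂ] _) :=
        LinearMap.ext fun y => hprod (fun i => φ i.succ) y
      change P.prod _ (P.iterProd k (fun i => B i.succ)
          (fun i => φ i.succ ∘ₗ (h i.succ : B i.succ →ₗ[ℂ] A i.succ))) x = _
      rw [h1]
      exact P.universality (φ 0) _ (h 0) H (hh 0) hH x

variable {P}

/-- The iterated free product is defined by recursion, so its involution is constructed along the
same recursion, and positivity for two factors is applied at each stage. -/
theorem IsPositive.exists_star_iter (hP : P.IsPositive) (k : ℕ) (A : Fin (k + 1) → MFAlg.{u} F)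
    [∀ κ, StarRing (A κ)] [∀ κ, StarModule ℂ (A κ)] (hA : ∀ κ, (A κ).FacesStarClosed) :
    ∃ (_ : StarRing (MFAlg.iterCoprod k A)) (_ : StarModule ℂ (MFAlg.iterCoprod k A)),
      (MFAlg.iterCoprod k A).FacesStarClosed ∧
      (∀ κ x, star (MFAlg.iterIncl k A κ x) = MFAlg.iterIncl k A κ (star x)) ∧
      ∀ φ : ∀ κ, (A κ).Functional, (∀ κ, IsRestrictedState (φ κ)) →
        IsRestrictedState (P.iterProd k A φ) := by
  induction k with
  | zero =>
    refine ⟨(inferInstance : StarRing (A 0)), (inferInstance : StarModule ℂ (A 0)), hA 0,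
      fun κ x => ?_, fun φ hφ => hφ 0⟩
    obtain rfl : κ = 0 := Fin.fin_one_eq_zero κ
    rfl
  | succ k ih =>
    obtain ⟨s, m, hc, hi, hs⟩ := ih (fun i => A i.succ) (fun i => hA i.succ)
    refine ⟨(inferInstance : StarRing ((A 0).coprod (MFAlg.iterCoprod k fun i => A i.succ))),
      (inferInstance : StarModule ℂ ((A 0).coprod (MFAlg.iterCoprod k fun i => A i.succ))),
      ?_, fun κ x => ?_, fun φ hφ => ?_⟩
    · exact fun f x hx => MFAlg.star_mem_coprodFace (hA 0) hc hx
    · induction κ using Fin.cases with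
      | zero => exact FreeProd.star_inl x
      | succ i =>
        refine (FreeProd.star_inr _).trans ?_
        exact congrArg _ (hi i x)
    · exact hP _ _ (hA 0) hc _ _ (hφ 0) (hs _ fun i => hφ i.succ)

variable (P)

/-- The products of several copies of a functional as a natural evaluation. -/
noncomputable def iterFamily (k : ℕ) : EvalFamily.{u} F Empty (Fin (k + 1)) where
  ev A φ l := P.iterProd k (fun _ => A) (fun _ => φ) (listProd (l.map
    (Sum.elim Empty.elim fun x => MFAlg.iterIncl k (fun _ => A) x.1 x.2)))
  nat := by
    intro A B φ h hh l
    obtain ⟨H, -, h₂, h₃⟩ := P.exists_iterMap k (fun _ => A) (fun _ => B) (fun _ => h) fun _ => hh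
    rw [h₃ fun _ => φ, map_listProd, List.map_map, List.map_map]
    congr 3
    funext x
    rcases x with x | x
    · exact x.elim
    · exact h₂ x.1 x.2
  map_add := by
    intro A φ i x y l₁ l₂
    simp only [List.map_append, List.map_cons, Sum.elim_inr, map_add, listProd_middle_add]
  map_smul := by
    intro A φ i r x l₁ l₂
    simp only [List.map_append, List.map_cons, Sum.elim_inr, map_smul, listProd_middle_smul,
      smul_eq_mul]

/-- The pattern of a word in letters which are assigned to algebras. -/
abbrev pattern {L : Type} {k : ℕ} (b : L → Fin (k + 1)) (w : List L) :
    List (Empty ⊕ Fin (k + 1) × L) :=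
  w.map fun ℓ => Sum.inr (b ℓ, ℓ)

/-- The value of a product of functionals on a word in letters `ℓ` with algebras and colours `s ℓ`,
as a function of the joint law of the letters. -/
noncomputable def wordValue {L : Type} {k : ℕ} (s : L → Fin (k + 1) × F) (w : List L)
    (μ : List L → ℂ) : ℂ :=
  (P.iterFamily k).ofLaw (fun ℓ => (s ℓ).2) (pattern (fun ℓ => (s ℓ).1) w) μ

section WordValue

variable {L : Type} {k : ℕ} (s : L → Fin (k + 1) × F) (w : List L)

theorem iterFamily_ev_subst {A : MFAlg.{u} F} (φ : A.Functional) (a : L → A) :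
    (P.iterFamily k).ev A φ (EvalFamily.subst a (pattern (fun ℓ => (s ℓ).1) w)) =
      P.iterProd k (fun _ => A) (fun _ => φ) (listProd (w.map fun ℓ =>
        MFAlg.iterIncl k (fun _ => A) (s ℓ).1 (a ℓ))) := by
  simp [iterFamily, EvalFamily.subst, pattern, Function.comp_def]

/-- Universality along the homomorphisms that send the letters of foreign algebras to zero. In the
free algebra number `κ` only words all of whose letters belong to `κ` keep a weight, so mixed words
are irrelevant. -/
theorem iterProd_eq_free {A : Fin (k + 1) → MFAlg.{u} F} (φ : ∀ κ, (A κ).Functional)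
    (a : ∀ κ, L → A κ) (ha : ∀ ℓ, a (s ℓ).1 ℓ ∈ (A (s ℓ).1).face (s ℓ).2) :
    P.iterProd k A φ (listProd (w.map fun ℓ => MFAlg.iterIncl k A (s ℓ).1 (a (s ℓ).1 ℓ))) =
      P.iterProd k (fun _ => freeMF.{u} L fun ℓ => (s ℓ).2)
        (fun κ => freeMF.functional _ fun v => open Classical in
          if ∀ ℓ ∈ v, (s ℓ).1 = κ then φ κ (listProd (v.map (a κ))) else 0)
        (listProd (w.map fun ℓ => MFAlg.iterIncl k _ (s ℓ).1 (freeMF.gen ℓ))) := by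
  classical
  let g : ∀ κ, L → A κ := fun κ ℓ => if (s ℓ).1 = κ then a κ ℓ else 0
  have hg : ∀ κ ℓ, g κ ℓ ∈ (A κ).face (s ℓ).2 := by
    intro κ ℓ
    simp only [g]
    split_ifs with h
    · subst h; exact ha ℓ
    · exact zero_mem _
  obtain ⟨H, -, h₂, h₃⟩ := P.exists_iterMap k A (fun _ => freeMF.{u} L fun ℓ => (s ℓ).2)
    (fun κ => freeMF.lift (g κ)) (fun κ => freeMF.isFaced_lift (hg κ))
  have key : (fun κ => freeMF.functional.{u} (fun ℓ => (s ℓ).2) fun v =>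
      if ∀ ℓ ∈ v, (s ℓ).1 = κ then φ κ (listProd (v.map (a κ))) else 0) =
      fun κ => φ κ ∘ₗ ((freeMF.lift (g κ) : freeMF.{u} L (fun ℓ => (s ℓ).2) →ₙₐ[ℂ] A κ) : _ →ₗ[ℂ] A κ) := by
    funext κ
    refine freeMF.functional_ext fun v hv => ?_
    rw [freeMF.functional_word _ hv]
    change _ = φ κ (freeMF.lift (g κ) _)
    rw [map_listProd, List.map_map]
    by_cases h : ∀ ℓ ∈ v, (s ℓ).1 = κ
    · rw [if_pos h]
      congr 2
      refine List.map_congr_left fun ℓ hℓ => ?_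
      simp [g, h ℓ hℓ]
    · rw [if_neg h, listProd_eq_zero, map_zero]
      push Not at h
      obtain ⟨ℓ, hℓ, hne⟩ := h
      exact List.mem_map.2 ⟨ℓ, hℓ, by simp [g, hne]⟩
  rw [key, h₃ φ, map_listProd, List.map_map]
  congr 2
  refine List.map_congr_left fun ℓ _ => ?_
  simp [h₂, g]

/-- The value of a product of functionals on a word depends only on the joint laws. -/
theorem iterProd_eq_wordValue {A : Fin (k + 1) → MFAlg.{u} F} (φ : ∀ κ, (A κ).Functional)
    (a : ∀ κ, L → A κ) (ha : ∀ ℓ, a (s ℓ).1 ℓ ∈ (A (s ℓ).1).face (s ℓ).2) (μ : List L → ℂ)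
    (hμ : ∀ κ v, v ≠ [] → (∀ ℓ ∈ v, (s ℓ).1 = κ) → μ v = φ κ (listProd (v.map (a κ)))) :
    P.iterProd k A φ (listProd (w.map fun ℓ => MFAlg.iterIncl k A (s ℓ).1 (a (s ℓ).1 ℓ))) =
      P.wordValue s w μ := by
  classical
  rw [P.iterProd_eq_free s w φ a ha, wordValue, EvalFamily.ofLaw, iterFamily_ev_subst,
    P.iterProd_eq_free s w (fun _ => freeMF.functional.{u} (fun ℓ => (s ℓ).2) μ)
      (fun _ => freeMF.gen) (fun ℓ => freeMF.gen_mem ℓ)]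
  have key : ∀ κ, freeMF.functional.{u} (fun ℓ => (s ℓ).2) (fun v =>
      if ∀ ℓ ∈ v, (s ℓ).1 = κ then φ κ (listProd (v.map (a κ))) else 0) =
      freeMF.functional.{u} (fun ℓ => (s ℓ).2) (fun v => if ∀ ℓ ∈ v, (s ℓ).1 = κ then
        freeMF.functional.{u} (fun ℓ => (s ℓ).2) μ (listProd (v.map freeMF.gen)) else 0) := by
    intro κ
    refine freeMF.functional_ext fun v hv => ?_
    rw [freeMF.functional_word _ hv, freeMF.functional_word _ hv]
    split_ifs with h
    · rw [freeMF.functional_word _ hv, hμ κ v hv h]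
    · rfl
  simp only [key]

theorem once_pattern {b : L → Fin (k + 1)} {w : List L} (hw : w.Nodup) (hw' : ∀ ℓ, ℓ ∈ w) :
    EvalFamily.Once (pattern b w) := by
  intro ℓ
  obtain ⟨w₁, w₂, rfl⟩ := List.append_of_mem (hw' ℓ)
  refine ⟨pattern b w₁, pattern b w₂, b ℓ, by simp [pattern], fun i => ?_⟩
  have : ℓ ∉ w₁ ∧ ℓ ∉ w₂ := by
    rw [List.nodup_append] at hw
    obtain ⟨-, h₂, h₃⟩ := hw
    exact ⟨fun h => h₃ ℓ h ℓ (by simp) rfl, (List.nodup_cons.1 h₂).1⟩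
  constructor
  · intro h
    obtain ⟨x, hx, hx'⟩ := List.mem_map.1 h
    simp only [Sum.inr.injEq, Prod.mk.injEq] at hx'
    exact this.1 (hx'.2 ▸ hx)
  · intro h
    obtain ⟨x, hx, hx'⟩ := List.mem_map.1 h
    simp only [Sum.inr.injEq, Prod.mk.injEq] at hx'
    exact this.2 (hx'.2 ▸ hx)

theorem lawMultilinear_wordValue {w : List L} (hw : w.Nodup) (hw' : ∀ ℓ, ℓ ∈ w) :
    LawMultilinear.{u} (fun ℓ => (s ℓ).2) (P.wordValue s w) :=
  (P.iterFamily k).lawMultilinear_ofLaw _ (once_pattern hw hw')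

/-- A letter with vanishing joint law makes the value of a word vanish. -/
theorem wordValue_eq_zero_of_dead {w : List L} {μ : List L → ℂ} {ℓ : L} (hℓ : ℓ ∈ w)
    (h : ∀ v, (∀ m ∈ v, (s m).1 = (s ℓ).1) → ℓ ∈ v → μ v = 0) : P.wordValue s w μ = 0 := by
  classical
  rw [← P.iterProd_eq_wordValue s w (fun _ => freeMF.functional.{u} (fun ℓ => (s ℓ).2) μ)
      (fun _ => Function.update freeMF.gen ℓ 0) (fun m => ?_) μ]
  · rw [listProd_eq_zero, map_zero]
    exact List.mem_map.2 ⟨ℓ, hℓ, by simp⟩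
  · intro κ v hv hκ
    by_cases hm : ℓ ∈ v
    · rw [listProd_eq_zero, map_zero, h v (fun m hm' => (hκ m hm').trans (hκ ℓ hm).symm) hm]
      exact List.mem_map.2 ⟨ℓ, hm, by simp⟩
    · have : v.map (Function.update freeMF.gen.{u} ℓ 0) = v.map (freeMF.gen (c := fun ℓ => (s ℓ).2)) :=
        List.map_congr_left fun m hm' => by
          have : m ≠ ℓ := fun h' => hm (h' ▸ hm')
          simp [this]
      rw [this, freeMF.functional_word _ hv]
  · by_cases hm : m = ℓ
    · subst hm; simp
    · simpa [hm] using freeMF.gen_mem m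

end WordValue

end UniversalProduct

/-! ## Wrongly ordered words have no weight -/

theorem star_list_prod {R : Type*} [Semiring R] [StarRing R] (l : List R) :
    star l.prod = (l.reverse.map star).prod := by
  induction l with
  | nil => simp
  | cons a l ih => simp [ih]

theorem mem_of_length_lt {α : Type*} {p r : List α} {d : α} {i : ℕ}
    (hi : i < (p ++ d :: r).length) (h : p.length < i) : (p ++ d :: r)[i] ∈ r := by
  rw [List.getElem_append_right h.le, List.getElem_cons, dif_neg (by omega)]
  exact List.getElem_mem _

theorem mem_of_lt_length {α : Type*} {p r : List α} {i : ℕ}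
    (hi : i < (p ++ r).length) (h : i < p.length) : (p ++ r)[i] ∈ p := by
  rw [List.getElem_append_left h]
  exact List.getElem_mem _

theorem finRange_split {n : ℕ} {a : Fin n} {y z : List (Fin n)}
    (h : List.finRange n = y ++ a :: z) :
    y.length = a ∧ (∀ j ∈ y, j < a) ∧ ∀ j ∈ z, a < j := by
  have hs : (y ++ a :: z).Pairwise (· < ·) := h ▸ List.pairwise_lt_finRange n
  rw [List.pairwise_append] at hs
  refine ⟨?_, fun j hj => hs.2.2 j hj a (by simp), (List.pairwise_cons.1 hs.2.1).1⟩
  have h1 : y.length < (List.finRange n).length := by rw [h]; simp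
  have h2 : (List.finRange n)[y.length] = a := by simp [h]
  rw [List.getElem_finRange] at h2
  rw [← h2]; simp

namespace UniversalProduct

section Datum

variable {k : ℕ} {ι : Type u} [Fintype ι] [DecidableEq ι]

/-- The element given by the number of an algebra, a colour, and a matrix. -/
noncomputable def matrixLetter (x : Fin (k + 1) × TwoFaces × Matrix ι ι ℂ) :
    MFAlg.iterCoprod k (fun _ => matrixMF ι) :=
  MFAlg.iterIncl k (fun _ => matrixMF ι) x.1 (matrixMF.emb x.2.1 x.2.2)

variable (P : UniversalProduct.{u} TwoFaces)

theorem wordValue_matrix {L : Type} (s : L → Fin (k + 1) × TwoFaces) (w : List L)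
    (X : L → Matrix ι ι ℂ) (o : ι) :
    P.wordValue s w (jointLaw (matrixMF.vec o) fun ℓ => matrixMF.emb (s ℓ).2 (X ℓ)) =
      P.iterProd k (fun _ => matrixMF ι) (fun _ => matrixMF.vec o)
        (listProd (w.map fun ℓ => matrixLetter ((s ℓ).1, (s ℓ).2, X ℓ))) := by
  rw [wordValue, ← EvalFamily.ev_subst _ _ _ fun ℓ => matrixMF.emb_mem _ _, iterFamily_ev_subst]
  rfl

/-- The reduction to indicator laws with the positions of `q` as letters. The second alternative
says that some word of the partition has moment zero in the vector state. -/
theorem iterProd_matrix_eq_zero (q : List (Fin (k + 1) × TwoFaces × Matrix ι ι ℂ)) (o : ι)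
    (H : ∀ e : Fin q.length → List (Fin q.length), IsWordPartition e →
      P.wordValue (fun i => (q[i].1, q[i].2.1)) (List.finRange q.length) (indicatorLaw e) = 0 ∨
        ∃ i, ((e i).map fun j => q[j].2.2).prod o o = 0) :
    P.iterProd k (fun _ => matrixMF ι) (fun _ => matrixMF.vec o)
        (listProd (q.map matrixLetter)) = 0 := by
  have h := P.wordValue_matrix (fun i : Fin q.length => (q[i].1, q[i].2.1))
    (List.finRange q.length) (fun i => q[i].2.2) o
  have h2 : (List.finRange q.length).map (fun i => matrixLetter (q[i].1, q[i].2.1, q[i].2.2)) =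
      q.map matrixLetter := by
    conv_rhs => rw [← List.map_get_finRange q, List.map_map]
    rfl
  rw [h2] at h
  rw [← h]
  refine (P.lawMultilinear_wordValue _ (List.nodup_finRange _) (List.mem_finRange)).eq_zero
    (map_zero _) fun e he => ?_
  rcases H e he with h | ⟨i, hi⟩
  · exact Or.inl h
  · refine Or.inr ⟨i, ?_⟩
    rw [matrixMF.jointLaw_vec o (fun i : Fin q.length => q[i].2.1) (fun i => q[i].2.2)
      (List.ne_nil_of_mem (he.mem i))]
    exact hi

end Datum

theorem model_mul_eq_zero {n : ℕ} {e : Fin n → List (Fin n)} {x y : Fin n}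
    (h : ¬ [x, y] <:+: e x) :
    IsWordPartition.model.{u} e x * IsWordPartition.model e y = 0 := by
  rw [IsWordPartition.model, IsWordPartition.model, Matrix.vecMulVec_mul_vecMulVec,
    IsWordPartition.source_dotProduct_target, if_neg (fun h' => h h'.2), zero_smul,
    Matrix.vecMulVec_zero]

section WrongOrder

variable {P : UniversalProduct.{u} TwoFaces} (hP : P.IsPositive)

include hP

/-- The value of a word in an indicator law vanishes if two legs are in the wrong order. -/
theorem wordValue_wrongOrder (m : ℕ) : ∀ (n k : ℕ) (s : Fin n → Fin (k + 1) × TwoFaces)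
    (e : Fin n → List (Fin n)), IsWordPartition e → ∀ a t : Fin n, t < a → [a, t] <:+: e a →
    (n < a.val + 1 + m ∨ t.val < m) →
    P.wordValue s (List.finRange n) (indicatorLaw e) = 0 := by
  -- The number `m` bounds the legs to the right of `a` or those to the left of `t`. Each step
  -- passes from one alternative to the other with a smaller bound, and for `m = 0` both are
  -- impossible.
  induction m with
  | zero => intro n k s e he a t _ _ h; omega
  | succ m ih =>
    intro n k s e he a t hta hat hm
    let o : IsWordPartition.Idx.{u} (Fin n) := IsWordPartition.base
    let X : Fin n → Matrix (IsWordPartition.Idx.{u} (Fin n)) (IsWordPartition.Idx.{u} (Fin n)) ℂ :=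
      IsWordPartition.model e
    let dat : Fin n → Fin (k + 1) × TwoFaces × Matrix (IsWordPartition.Idx.{u} (Fin n))
      (IsWordPartition.Idx.{u} (Fin n)) ℂ := fun ℓ => ((s ℓ).1, (s ℓ).2, X ℓ)
    let sdat : Fin n → Fin (k + 1) × TwoFaces × Matrix (IsWordPartition.Idx.{u} (Fin n))
      (IsWordPartition.Idx.{u} (Fin n)) ℂ := fun ℓ => ((s ℓ).1, (s ℓ).2, star (X ℓ))
    set Φ := P.iterProd k (fun _ => matrixMF (IsWordPartition.Idx.{u} (Fin n)))
      (fun _ => matrixMF.vec o) with hΦ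
    obtain ⟨_, _, -, hstar, hstate⟩ := hP.exists_star_iter k
      (fun _ => matrixMF (IsWordPartition.Idx.{u} (Fin n))) (fun _ => matrixMF.facesStarClosed)
    have hstate' : IsRestrictedState Φ := hstate _ fun _ => matrixMF.isRestrictedState_vec o
    let U : Fin n → Unitization ℂ (MFAlg.iterCoprod k
      (fun _ => matrixMF (IsWordPartition.Idx.{u} (Fin n)))) := fun ℓ =>
        Unitization.inr (matrixLetter (dat ℓ))
    have hU : ∀ ℓ, star (U ℓ) = Unitization.inr (matrixLetter (sdat ℓ)) := by
      intro ℓ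
      simp only [U, matrixLetter, dat, sdat]
      rw [← Unitization.inr_star, hstar, matrixMF.star_emb]
    have hval : P.wordValue s (List.finRange n) (indicatorLaw e) =
        unitExt Φ ((List.finRange n).map U).prod := by
      rw [he.indicatorLaw_eq_jointLaw fun ℓ => (s ℓ).2, wordValue_matrix]
      rw [← unitExt_inr, coe_listProd (by simpa using List.ne_nil_of_mem (List.mem_finRange a)),
        List.map_map]
      rfl
    have hUl : ∀ l : List (Fin n), (l.map dat).map (Unitization.inr ∘ matrixLetter) = l.map U :=
      fun l => by rw [List.map_map]; rfl
    have hsUl : ∀ l : List (Fin n), (l.reverse.map sdat).map (Unitization.inr ∘ matrixLetter) =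
        ((l.map U).reverse.map star) := fun l => by
      rw [← List.map_reverse, List.map_map, List.map_map]
      exact List.map_congr_left fun x _ => (hU x).symm
    have hXmul : ∀ x y : Fin n, ¬ [x, y] <:+: e x → X x * X y = 0 := fun x y => model_mul_eq_zero
    rw [hval]
    obtain ⟨i₁, i₂, hi⟩ := hat
    have hnd := he.nodup a
    have hi' : e a = i₁ ++ a :: t :: i₂ := by rw [← hi]; simp
    have het : e t = e a := he.eq_of_mem a t (by rw [hi']; simp)
    rcases hm with hm | hm
    · obtain ⟨y, z, hyz⟩ := List.append_of_mem (List.mem_finRange a)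
      obtain ⟨hya, hy, hz⟩ := finRange_split hyz
      have hlen : y.length + (z.length + 1) = n := by
        have := congrArg List.length hyz
        simpa using this.symm
      rw [hyz, List.map_append, List.map_cons, List.prod_append, List.prod_cons]
      -- The letter `a` together with everything after it is a null vector: its norm is the value of
      -- a palindromic word with the single letter `star (X a) * X a`, an element of the face of
      -- `a`, in the middle.
      refine hstate'.null_left ?_ _
      have hq : star (U a * (z.map U).prod) * (U a * (z.map U).prod) =
          Unitization.inr (listProd ((z.reverse.map sdat ++
            ((s a).1, (s a).2, star (X a) * X a) :: z.map dat).map matrixLetter)) := by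
        rw [coe_listProd (by simp), List.map_map, List.map_append, List.prod_append, List.map_cons,
          List.prod_cons, star_mul, star_list_prod, hUl, hsUl]
        have h1 : (Unitization.inr ∘ matrixLetter) ((s a).1, (s a).2, star (X a) * X a) =
            star (U a) * U a := by
          rw [hU]
          simp only [Function.comp_apply, matrixLetter, map_mul, Unitization.inr_mul, U, dat, sdat]
        rw [h1]
        simp only [mul_assoc]
      rw [hq, unitExt_inr]
      obtain ⟨q, hqdef⟩ : ∃ q, q = z.reverse.map sdat ++
        ((s a).1, (s a).2, star (X a) * X a) :: z.map dat := ⟨_, rfl⟩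
      rw [← hqdef]
      have hql : q.length = 2 * z.length + 1 := by simp [hqdef]; omega
      refine P.iterProd_matrix_eq_zero _ o fun e' he' => ?_
      let d : Fin q.length := ⟨z.length, by omega⟩
      have hqd : q[d].2.2 = star (X a) * X a := by
        have : q[d] = ((s a).1, (s a).2, star (X a) * X a) := by simp [hqdef, d]
        rw [this]
      -- The successor of the middle letter `d` in its word decides. Without a successor, the column
      -- of `X a` at the state vector enters, which is zero because `a` is followed by `t`. A
      -- successor to the right of `d` is some `X j` with `j > a`, but `X a * X j` is nonzero only
      -- for `j = t < a`. A successor to the left of `d` forms with `d` a wrongly ordered pair with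
      -- fewer than `m` legs before it, and the induction hypothesis applies.
      obtain ⟨u, v, huv⟩ := List.append_of_mem (he'.mem d)
      cases v with
      | nil =>
        refine Or.inr ⟨d, ?_⟩
        have h0 : ∀ i, X a i o = 0 := by
          intro i
          have : IsWordPartition.source.{u} e a o = 0 := by
            simp only [IsWordPartition.source, o]
            rw [if_neg]
            rintro ⟨w, hw⟩
            have := (IsWordPartition.split_unique hnd hi' hw.symm).2
            simp at this
          simp only [X, IsWordPartition.model, Matrix.vecMulVec_apply, this, mul_zero]
        rw [huv, List.map_append, List.map_cons, List.map_nil, List.prod_append, List.prod_cons,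
          List.prod_nil, mul_one, hqd, ← mul_assoc, Matrix.mul_apply]
        exact Finset.sum_eq_zero fun i _ => by rw [h0, mul_zero]
      | cons i v =>
        by_cases hid : d < i
        · refine Or.inr ⟨d, ?_⟩
          obtain ⟨j, hj, hqj⟩ : ∃ j ∈ z, q[i].2.2 = X j := by
            have : q[i.val] ∈ z.map dat := by
              subst hqdef
              exact mem_of_length_lt i.2 (by rw [List.length_map, List.length_reverse]; exact hid)
            obtain ⟨j, hj, hj'⟩ := List.mem_map.1 this
            exact ⟨j, hj, by rw [Fin.getElem_fin, ← hj']⟩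
          have h0 : X a * X j = 0 := by
            refine hXmul a j ?_
            rintro ⟨w₁, w₂, hw⟩
            have h3 := IsWordPartition.split_unique hnd hi' (u' := w₁) (v' := j :: w₂)
              (by rw [← hw]; simp)
            have h4 : t = j := (List.cons.inj h3.2).1
            have h5 := hz j hj
            rw [← h4] at h5
            exact lt_asymm h5 hta
          rw [huv, List.map_append, List.map_cons, List.map_cons, List.prod_append, List.prod_cons,
            List.prod_cons, hqd, hqj, ← mul_assoc (star (X a) * X a), mul_assoc (star (X a)), h0]
          simp
        · have hne : i ≠ d := by
            rintro rfl
            have := he'.nodup d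
            rw [huv] at this
            simp [List.nodup_append] at this
          have hlt : i < d := lt_of_le_of_ne (not_lt.1 hid) hne
          refine Or.inl (ih _ k _ e' he' d i hlt ⟨u, v, by rw [huv]; simp⟩ (Or.inr ?_))
          have : i.val < z.length := hlt
          omega
    · obtain ⟨y, z, hyz⟩ := List.append_of_mem (List.mem_finRange t)
      obtain ⟨hyt, hy, hz⟩ := finRange_split hyz
      rw [hyz, List.map_append, List.map_cons, List.prod_append, List.prod_cons, ← mul_assoc]
      -- The mirror image: everything up to and including `t` is a null vector for multiplication
      -- from the other side.
      refine hstate'.null_right ?_ _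
      have hq : (y.map U).prod * U t * star ((y.map U).prod * U t) =
          Unitization.inr (listProd ((y.map dat ++
            ((s t).1, (s t).2, X t * star (X t)) :: y.reverse.map sdat).map matrixLetter)) := by
        rw [coe_listProd (by simp), List.map_map, List.map_append, List.prod_append, List.map_cons,
          List.prod_cons, star_mul, star_list_prod, hUl, hsUl]
        have h1 : (Unitization.inr ∘ matrixLetter) ((s t).1, (s t).2, X t * star (X t)) =
            U t * star (U t) := by
          rw [hU]
          simp only [Function.comp_apply, matrixLetter, map_mul, Unitization.inr_mul, U, dat, sdat]
        rw [h1]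
        simp only [mul_assoc]
      rw [hq, unitExt_inr]
      obtain ⟨q, hqdef⟩ : ∃ q, q = y.map dat ++
        ((s t).1, (s t).2, X t * star (X t)) :: y.reverse.map sdat := ⟨_, rfl⟩
      rw [← hqdef]
      have hql : q.length = 2 * y.length + 1 := by simp [hqdef]; omega
      refine P.iterProd_matrix_eq_zero _ o fun e' he' => ?_
      let d : Fin q.length := ⟨y.length, by omega⟩
      have hqd : q[d].2.2 = X t * star (X t) := by
        have : q[d] = ((s t).1, (s t).2, X t * star (X t)) := by simp [hqdef, d]
        rw [this]
      obtain ⟨u, v, huv⟩ := List.append_of_mem (he'.mem d)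
      -- Now the predecessor of `d` decides. Without one, the row of `X t` at the state vector is
      -- zero, as `t` does not begin its word; to the left of `d`, only `X a` could precede `X t`,
      -- but `a > t`; to the right of `d`, the pair is wrongly ordered with fewer than `m` legs
      -- after it.
      rcases List.eq_nil_or_concat' u with rfl | ⟨u, i, rfl⟩
      · refine Or.inr ⟨d, ?_⟩
        have h0 : ∀ i, X t o i = 0 := by
          intro i
          have : IsWordPartition.target.{u} e t o = 0 := by
            simp only [IsWordPartition.target, o]
            rw [if_neg]
            intro hh
            rw [het] at hh
            cases hw : e a with
            | nil => rw [hw] at hh; simp at hh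
            | cons x w =>
              rw [hw] at hh
              obtain rfl : x = t := by simpa using hh
              have := (IsWordPartition.split_unique hnd (u := []) hw (u' := i₁ ++ [a]) (v' := i₂)
                (by rw [hi']; simp)).1
              simp at this
          simp only [X, IsWordPartition.model, Matrix.vecMulVec_apply, this, zero_mul]
        rw [huv, List.nil_append, List.map_cons, List.prod_cons, hqd, mul_assoc, Matrix.mul_apply]
        exact Finset.sum_eq_zero fun i _ => by rw [h0, zero_mul]
      · by_cases hid : i < d
        · refine Or.inr ⟨d, ?_⟩
          obtain ⟨j, hj, hqj⟩ : ∃ j ∈ y, q[i].2.2 = X j := by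
            have : q[i.val] ∈ y.map dat := by
              subst hqdef
              exact mem_of_lt_length i.2 (by rw [List.length_map]; exact hid)
            obtain ⟨j, hj, hj'⟩ := List.mem_map.1 this
            exact ⟨j, hj, by rw [Fin.getElem_fin, ← hj']⟩
          have h0 : X j * X t = 0 := by
            refine hXmul j t ?_
            rintro ⟨w₁, w₂, hw⟩
            have hej : e t = e j := he.eq_of_mem j t (by rw [← hw]; simp)
            have h3 := IsWordPartition.split_unique hnd (x := t) (u := i₁ ++ [a]) (v := i₂)
              (by rw [hi']; simp) (u' := w₁ ++ [j]) (v' := w₂) (by rw [← het, hej, ← hw]; simp)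
            have h4 : a = j := by
              have := List.append_inj' h3.1 rfl
              simpa using this.2
            exact lt_asymm (h4 ▸ hy j hj) hta
          rw [huv, List.map_append, List.map_append, List.map_cons, List.map_cons, List.map_nil,
            List.prod_append, List.prod_append, List.prod_cons, List.prod_cons, List.prod_nil,
            mul_one, hqd, hqj, mul_assoc _ (X j), ← mul_assoc (X j), ← mul_assoc (X j), h0]
          simp
        · have hne : d ≠ i := by
            rintro rfl
            have := he'.nodup d
            rw [huv] at this
            simp [List.nodup_append] at this
          have hlt : d < i := lt_of_le_of_ne (not_lt.1 hid) hne
          have hei : e' i = e' d := he'.eq_of_mem d i (by rw [huv]; simp)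
          refine Or.inl (ih _ k _ e' he' i d hlt ⟨u, v, by rw [hei, huv]; simp⟩ (Or.inl ?_))
          have : y.length < i.val := hlt
          omega

end WrongOrder

end UniversalProduct

/-! ## Coefficients -/

namespace LegPartition

variable {n : ℕ} (π : LegPartition n)

/-- The words of a partition: the ordered blocks. -/
def word (ℓ : Fin (n + 1)) : List (Fin (n + 1)) := (π.part ℓ).sort

theorem mem_word {i j : Fin (n + 1)} : i ∈ π.word j ↔ π.SameBlock i j := by
  rw [word, Finset.mem_sort, Finpartition.mem_part_iff_exists]; rfl

theorem isWordPartition_word : IsWordPartition π.word where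
  mem ℓ := by rw [word, Finset.mem_sort]; exact π.mem_part (Finset.mem_univ _)
  nodup ℓ := Finset.sort_nodup _ _
  eq_of_mem ℓ m hm := by
    rw [word, Finset.mem_sort] at hm
    rw [word, word, π.part_eq_of_mem (π.part_mem.2 (Finset.mem_univ _)) hm]

theorem word_of_mem {β : Finset (Fin (n + 1))} (hβ : β ∈ π.parts) {ℓ : Fin (n + 1)} (h : ℓ ∈ β) :
    π.word ℓ = β.sort := by
  rw [word, π.part_eq_of_mem hβ h]

theorem word_eq_iff {i j : Fin (n + 1)} : π.word i = π.word j ↔ π.SameBlock i j := by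
  rw [← mem_word]
  exact ⟨fun h => h ▸ π.isWordPartition_word.mem i, fun h => π.isWordPartition_word.eq_of_mem j i h⟩

theorem word_injective : Function.Injective (word : LegPartition n → _) := by
  intro π ρ h
  have hp : ∀ ℓ, π.part ℓ = ρ.part ℓ := fun ℓ => by
    have := congrArg List.toFinset (congrFun h ℓ)
    simpa [word, Finset.sort_toFinset] using this
  have key : ∀ σ τ : LegPartition n, (∀ ℓ, σ.part ℓ = τ.part ℓ) → σ.parts ⊆ τ.parts := by
    intro σ τ hστ β hβ
    obtain ⟨ℓ, hℓ⟩ := σ.nonempty_of_mem_parts hβ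
    rw [← σ.part_eq_of_mem hβ hℓ, hστ]
    exact τ.part_mem.2 (Finset.mem_univ _)
  exact Finpartition.ext (Finset.Subset.antisymm (key _ _ hp) (key _ _ fun ℓ => (hp ℓ).symm))

/-- A partition into increasing words comes from a set partition. -/
theorem exists_word_eq {e : Fin (n + 1) → List (Fin (n + 1))} (he : IsWordPartition e)
    (hs : ∀ ℓ, (e ℓ).Pairwise (· < ·)) : ∃ π : LegPartition n, π.word = e := by
  classical
  let S : Setoid (Fin (n + 1)) := ⟨fun i j => e i = e j, fun _ => rfl, fun h => h.symm,
    fun h h' => h.trans h'⟩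
  refine ⟨Finpartition.ofSetoid S, funext fun ℓ => ?_⟩
  have h1 : (Finpartition.ofSetoid S).part ℓ = (e ℓ).toFinset := by
    ext j
    rw [Finpartition.mem_part_ofSetoid_iff_rel, List.mem_toFinset]
    exact ⟨fun h : e ℓ = e j => h ▸ he.mem j, fun h => (he.eq_of_mem ℓ j h).symm⟩
  rw [word, h1]
  exact (List.toFinset_sort _ (he.nodup ℓ)).2 ((hs ℓ).imp fun h => h.le)

open Classical in
-- Indicator laws are dual to set partitions: the product is nonzero only if every sorted block is a
-- word of `e`, and two partitions of the legs with this relation coincide.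
theorem prod_indicatorLaw {e : Fin (n + 1) → List (Fin (n + 1))} (he : IsWordPartition e) :
    ∏ β ∈ π.parts, indicatorLaw e β.sort = if π.word = e then 1 else 0 := by
  split_ifs with h
  · refine Finset.prod_eq_one fun β hβ => ?_
    obtain ⟨ℓ, hℓ⟩ := π.nonempty_of_mem_parts hβ
    rw [indicatorLaw, if_pos ⟨ℓ, by rw [← h, π.word_of_mem hβ hℓ]⟩]
  · by_contra hne
    refine h (funext fun ℓ => ?_)
    have hβ := π.part_mem.2 (Finset.mem_univ ℓ)
    have h1 : indicatorLaw e (π.part ℓ).sort ≠ 0 := fun h0 => hne (Finset.prod_eq_zero hβ h0)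
    rw [indicatorLaw] at h1
    obtain ⟨m, hm⟩ := of_not_not fun h2 => h1 (if_neg h2)
    rw [word, ← hm, he.eq_of_mem m ℓ]
    rw [hm, Finset.mem_sort]
    exact π.mem_part (Finset.mem_univ _)

/-- The product over the blocks of the values of a law is multilinear. -/
theorem lawMultilinear_prod {F : Type} (f : Fin (n + 1) → F) :
    LawMultilinear.{u} f fun μ => ∏ β ∈ π.parts, μ β.sort := by
  classical
  intro X c μ
  set φ := freeMF.functional.{u} c μ
  have key : ∀ (ℓ : Fin (n + 1)), ∃ l₁ l₂ : List (Fin (n + 1)),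
      (π.part ℓ).sort = l₁ ++ ℓ :: l₂ ∧ ℓ ∉ l₁ ∧ ℓ ∉ l₂ := by
    intro ℓ
    have hm : ℓ ∈ (π.part ℓ).sort := π.isWordPartition_word.mem ℓ
    have hn : (π.part ℓ).sort.Nodup := π.isWordPartition_word.nodup ℓ
    obtain ⟨l₁, l₂, h⟩ := List.append_of_mem hm
    rw [h, List.nodup_append] at hn
    exact ⟨l₁, l₂, h, fun h => hn.2.2 ℓ h ℓ (by simp) rfl, (List.nodup_cons.1 hn.2.1).1⟩
  have hupd : ∀ (a : Fin (n + 1) → freeMF.{u} X c) (ℓ : Fin (n + 1)) (x : freeMF.{u} X c)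
      (l : List (Fin (n + 1))), ℓ ∉ l → l.map (Function.update a ℓ x) = l.map a := by
    intro a ℓ x l hl
    refine List.map_congr_left fun j hj => Function.update_of_ne ?_ _ _
    rintro rfl; exact hl hj
  have hprod : ∀ (a : Fin (n + 1) → freeMF.{u} X c) (ℓ : Fin (n + 1)) (x : freeMF.{u} X c),
      ∏ β ∈ π.parts, φ (listProd (β.sort.map (Function.update a ℓ x))) =
        φ (listProd ((π.part ℓ).sort.map (Function.update a ℓ x))) *
          ∏ β ∈ π.parts.erase (π.part ℓ), φ (listProd (β.sort.map a)) := by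
    intro a ℓ x
    rw [← Finset.mul_prod_erase _ _ (π.part_mem.2 (Finset.mem_univ ℓ))]
    congr 1
    refine Finset.prod_congr rfl fun β hβ => ?_
    rw [hupd]
    rw [Finset.mem_sort]
    intro h
    exact (Finset.mem_erase.1 hβ).1 (π.part_eq_of_mem (Finset.mem_erase.1 hβ).2 h).symm
  have hadd : ∀ (a : Fin (n + 1) → freeMF.{u} X c) (ℓ : Fin (n + 1)) (x y : freeMF.{u} X c),
      ∏ β ∈ π.parts, φ (listProd (β.sort.map (Function.update a ℓ (x + y)))) =
      ∏ β ∈ π.parts, φ (listProd (β.sort.map (Function.update a ℓ x))) +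
      ∏ β ∈ π.parts, φ (listProd (β.sort.map (Function.update a ℓ y))) := by
    intro a ℓ x y
    obtain ⟨l₁, l₂, h, h₁, h₂⟩ := key ℓ
    simp only [hprod, h, List.map_append, List.map_cons, hupd a ℓ _ _ h₁, hupd a ℓ _ _ h₂,
      Function.update_self]
    rw [listProd_middle_add, map_add, add_mul]
  have hsmul : ∀ (a : Fin (n + 1) → freeMF.{u} X c) (ℓ : Fin (n + 1)) (r : ℂ)
      (x : freeMF.{u} X c),
      ∏ β ∈ π.parts, φ (listProd (β.sort.map (Function.update a ℓ (r • x)))) =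
      r • ∏ β ∈ π.parts, φ (listProd (β.sort.map (Function.update a ℓ x))) := by
    intro a ℓ r x
    obtain ⟨l₁, l₂, h, h₁, h₂⟩ := key ℓ
    simp only [hprod, h, List.map_append, List.map_cons, hupd a ℓ _ _ h₁, hupd a ℓ _ _ h₂,
      Function.update_self]
    rw [listProd_middle_smul, map_smul, smul_mul_assoc]
  let m : MultilinearMap ℂ (fun _ : Fin (n + 1) => freeMF.{u} X c) ℂ :=
    { toFun := fun a => ∏ β ∈ π.parts, φ (listProd (β.sort.map a))
      -- The axioms of a multilinear map quantify over the decidability of equality of the legs; the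
      -- given instance is replaced by the standard one.
      map_update_add' := fun {inst} a ℓ x y => by
        rw [Subsingleton.elim inst (instDecidableEqFin (n + 1))]; exact hadd a ℓ x y
      map_update_smul' := fun {inst} a ℓ r x => by
        rw [Subsingleton.elim inst (instDecidableEqFin (n + 1))]; exact hsmul a ℓ r x }
  exact ⟨m, fun a _ => rfl⟩

open Classical in
-- Each block belongs to exactly one algebra and so contributes exactly one factor to the double
-- product. Mixed words never occur, which leaves `μ` free on them.
theorem prod_blocks_eq {F : Type} {k : ℕ} {s : Fin (n + 1) → Fin (k + 1) × F}
    (h : ∀ β ∈ π.parts, ∃ κ, ∀ ℓ ∈ β, (s ℓ).1 = κ) (g : Fin (k + 1) → List (Fin (n + 1)) → ℂ)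
    (μ : List (Fin (n + 1)) → ℂ)
    (hμ : ∀ κ v, v ≠ [] → (∀ ℓ ∈ v, (s ℓ).1 = κ) → μ v = g κ v) :
    ∏ κ, ∏ β ∈ π.parts with (∀ ℓ ∈ β, (s ℓ).1 = κ), g κ β.sort = ∏ β ∈ π.parts, μ β.sort := by
  simp only [Finset.prod_filter]
  rw [Finset.prod_comm]
  refine Finset.prod_congr rfl fun β hβ => ?_
  obtain ⟨κ, hκ⟩ := h β hβ
  obtain ⟨ℓ, hℓ⟩ := π.nonempty_of_mem_parts hβ
  rw [Finset.prod_eq_single κ, if_pos hκ, hμ κ]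
  · exact List.ne_nil_of_mem ((Finset.mem_sort _).2 hℓ)
  · intro i hi; exact hκ i ((Finset.mem_sort _).1 hi)
  · intro κ' _ hne
    rw [if_neg]
    intro h'
    exact hne ((h' ℓ hℓ).symm.trans (hκ ℓ hℓ))
  · simp

end LegPartition

theorem listProd_map_flatMap {A X Y : Type*} [NonUnitalRing A] (g : X → List Y) (hg : ∀ x, g x ≠ [])
    (h : Y → A) (v : List X) :
    listProd ((v.flatMap g).map h) = listProd (v.map fun x => listProd ((g x).map h)) := by
  induction v with
  | nil => rfl
  | cons x v ih =>
    by_cases hv : v = []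
    · subst hv; simp [listProd]
    · rw [List.flatMap_cons, List.map_append, listProd_append (by simp [hg]), ih, List.map_cons,
        listProd_cons (by simp [hv])]
      obtain ⟨y, v, rfl⟩ := List.exists_cons_of_ne_nil hv
      simp [hg]

namespace UniversalProduct

section

variable {F : Type} (P : UniversalProduct.{u} F)

theorem listProd_merge {B : Type*} [NonUnitalRing B] (l₁ l₂ : List B) (p q : B) :
    listProd (l₁ ++ p :: q :: l₂) = listProd (l₁ ++ (p * q) :: l₂) := by
  have h0 : listProd (p :: q :: l₂) = listProd ((p * q) :: l₂) := by
    cases l₂ with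
    | nil => rfl
    | cons r l₂ => simp only [listProd, mul_assoc]
  by_cases hl : l₁ = []
  · subst hl; exact h0
  · rw [listProd_append hl (by simp), h0, listProd_append hl (by simp)]

/-- Neighbouring letters of the same algebra and colour have to lie in a common word. -/
theorem wordValue_eq_zero_of_neighbours {L : Type} {k : ℕ} (s : L → Fin (k + 1) × F)
    {w₁ w₂ : List L} {x y : L} (hw : (w₁ ++ x :: y :: w₂).Nodup) (hxy : s x = s y) {e : L → List L}
    (he : IsWordPartition e) (hne : e x ≠ e y) :
    P.wordValue s (w₁ ++ x :: y :: w₂) (indicatorLaw e) = 0 := by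
  classical
  let φ := freeMF.functional.{u} (fun ℓ => (s ℓ).2) (indicatorLaw e)
  rw [← P.iterProd_eq_wordValue s _ (fun _ => φ) (fun _ => freeMF.gen) (fun ℓ => freeMF.gen_mem ℓ)
    (indicatorLaw e) (fun κ v hv _ => (freeMF.functional_word _ hv).symm)]
  -- The product of the two neighbours lies in a single face, so the letter `x` is made to stand for
  -- it and `y` is dropped from the word.
  let g : L → List L := fun z => if z = x then [x, y] else [z]
  have hg : ∀ z, g z ≠ [] := fun z => by simp only [g]; split_ifs <;> simp
  let A := freeMF.{u} L fun ℓ => (s ℓ).2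
  let a : L → A := fun z => listProd ((g z).map freeMF.gen)
  have hax : a x = freeMF.gen x * freeMF.gen y := by simp [a, g, listProd]
  have hay : ∀ z ≠ x, a z = freeMF.gen z := fun z hz => by simp [a, g, hz, listProd]
  have ha : ∀ z, a z ∈ A.face (s z).2 := by
    intro z
    by_cases hz : z = x
    · subst hz
      rw [hax]
      exact mul_mem (freeMF.gen_mem z) (by rw [hxy]; exact freeMF.gen_mem y)
    · rw [hay z hz]; exact freeMF.gen_mem z
  have hw₁ : ∀ z ∈ w₁, z ≠ x := by
    rintro z hz rfl
    exact (List.nodup_append.1 hw).2.2 z hz z (by simp) rfl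
  have hw₂ : ∀ z ∈ w₂, z ≠ x := by
    rintro z hz rfl
    exact (List.nodup_cons.1 (List.nodup_append.1 hw).2.1).1 (by simp [hz])
  have h1 : (w₁ ++ x :: w₂).map (fun ℓ => MFAlg.iterIncl k (fun _ => A) (s ℓ).1 (a ℓ)) =
      w₁.map (fun ℓ => MFAlg.iterIncl k (fun _ => A) (s ℓ).1 (freeMF.gen ℓ)) ++
        (MFAlg.iterIncl k (fun _ => A) (s x).1 (freeMF.gen x) *
          MFAlg.iterIncl k (fun _ => A) (s y).1 (freeMF.gen y)) ::
        w₂.map (fun ℓ => MFAlg.iterIncl k (fun _ => A) (s ℓ).1 (freeMF.gen ℓ)) := by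
    rw [List.map_append, List.map_cons, hax, map_mul, ← hxy,
      List.map_congr_left fun z hz => by rw [hay z (hw₁ z hz)],
      List.map_congr_left (l := w₂) fun z hz => by rw [hay z (hw₂ z hz)]]
  rw [List.map_append, List.map_cons, List.map_cons, listProd_merge, ← h1,
    P.iterProd_eq_wordValue s _ (fun _ => φ) (fun _ => a) ha (jointLaw φ a) fun _ _ _ _ => rfl]
  -- A word through the merged letter contains both `x` and `y` after substitution and is therefore
  -- not a word of `e`: the merged letter is dead.
  refine P.wordValue_eq_zero_of_dead s (ℓ := x) (by simp) fun v _ hv => ?_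
  rw [jointLaw, ← listProd_map_flatMap g hg,
    LawMultilinear.functional_word' (indicatorLaw_nil he), indicatorLaw, if_neg]
  rintro ⟨ℓ, hℓ⟩
  have hx : x ∈ v.flatMap g := List.mem_flatMap.2 ⟨x, hv, by simp [g]⟩
  have hy : y ∈ v.flatMap g := List.mem_flatMap.2 ⟨x, hv, by simp [g]⟩
  rw [← hℓ] at hx hy
  exact hne ((he.eq_of_mem ℓ x hx).trans (he.eq_of_mem ℓ y hy).symm)

variable {n k : ℕ} (s : Fin (n + 1) → Fin (k + 1) × F)

/-- Adaptedness fails in two ways. A block meeting two algebras has a leg without weight in its own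
algebra, and separated neighbours of equal algebra and face are excluded by merging them. -/
theorem wordValue_eq_zero_of_not_adapted {π : LegPartition n} (h : ¬ π.Adapted s) :
    P.wordValue s (List.finRange (n + 1)) (indicatorLaw π.word) = 0 := by
  rw [LegPartition.Adapted, not_and_or] at h
  rcases h with h | h
  · push Not at h
    obtain ⟨β, hβ, h⟩ := h
    obtain ⟨i, hi⟩ := π.nonempty_of_mem_parts hβ
    obtain ⟨j, hj, hij⟩ := h (s i).1
    refine P.wordValue_eq_zero_of_dead s (List.mem_finRange i) fun v hv hiv => ?_
    rw [indicatorLaw, if_neg]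
    rintro ⟨ℓ, rfl⟩
    refine hij (hv j ?_)
    rw [← π.isWordPartition_word.eq_of_mem ℓ i hiv, π.mem_word]
    exact ⟨β, hβ, hj, hi⟩
  · push Not at h
    obtain ⟨i, hi, hne⟩ := h
    obtain ⟨w₁, w₂, h⟩ : ∃ w₁ w₂, List.finRange (n + 1) = w₁ ++ i.castSucc :: i.succ :: w₂ := by
      obtain ⟨y, z, hyz⟩ := List.append_of_mem (List.mem_finRange i.castSucc)
      obtain ⟨hy, -, -⟩ := finRange_split hyz
      have hlen := congrArg List.length hyz
      simp only [List.length_finRange, List.length_append, List.length_cons] at hlen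
      cases z with
      | nil =>
        simp only [List.length_nil, Fin.val_castSucc] at hlen hy
        have := i.2
        omega
      | cons t z =>
        refine ⟨y, z, ?_⟩
        have h2 : (List.finRange (n + 1)) = (y ++ [i.castSucc]) ++ t :: z := by rw [hyz]; simp
        obtain ⟨h3, -, -⟩ := finRange_split h2
        have : t = i.succ := by
          ext
          rw [← h3]; simp [hy]
        rw [hyz, this]
    rw [h]
    exact P.wordValue_eq_zero_of_neighbours s (h ▸ List.nodup_finRange _) hi
      π.isWordPartition_word (mt π.word_eq_iff.1 hne)

end

/-! ### Expansion of words in coefficients -/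

section Coefficients

variable {P : UniversalProduct.{u} TwoFaces} {n k : ℕ} (s : Fin (n + 1) → Fin (k + 1) × TwoFaces)

/-- A word which is not increasing has a descent at two neighbouring letters, which null vectors
exclude. A partition into increasing words is a set partition. -/
theorem wordValue_indicatorLaw (hP : P.IsPositive) {e : Fin (n + 1) → List (Fin (n + 1))} (he : IsWordPartition e) :
    P.wordValue s (List.finRange (n + 1)) (indicatorLaw e) = 0 ∨
      ∃ π : LegPartition n, π.Adapted s ∧ π.word = e := by
  by_cases hs : ∀ ℓ, (e ℓ).Pairwise (· < ·)
  · obtain ⟨π, rfl⟩ := LegPartition.exists_word_eq he hs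
    by_cases h : π.Adapted s
    · exact Or.inr ⟨π, h, rfl⟩
    · exact Or.inl (P.wordValue_eq_zero_of_not_adapted s h)
  · push Not at hs
    obtain ⟨ℓ, hℓ⟩ := hs
    rw [← List.isChain_iff_pairwise, List.isChain_iff_forall_rel_of_append_cons_cons] at hℓ
    push Not at hℓ
    obtain ⟨a, t, u, v, h, hle⟩ := hℓ
    have hn := he.nodup ℓ
    have hne : t ≠ a := by
      rintro rfl
      rw [h] at hn
      simp [List.nodup_append] at hn
    have hea : e a = e ℓ := he.eq_of_mem ℓ a (by rw [h]; simp)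
    -- With the bound `n + 1` the second alternative holds for every leg `t`.
    exact Or.inl (wordValue_wrongOrder hP (n + 1) _ k s e he a t (lt_of_le_of_ne hle hne)
      ⟨u, v, by rw [hea, h]; simp⟩ (Or.inr t.2))

open Classical in
-- Both sides are multilinear in the law, so they are compared at indicator laws, where duality
-- leaves at most one term of the sum.
theorem wordValue_eq_sum (hP : P.IsPositive) {μ : List (Fin (n + 1)) → ℂ} (hμ : μ [] = 0) :
    P.wordValue s (List.finRange (n + 1)) μ =
      ∑ π : LegPartition n with π.Adapted s,
        P.wordValue s (List.finRange (n + 1)) (indicatorLaw π.word) * ∏ β ∈ π.parts, μ β.sort := by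
  have hD := (P.lawMultilinear_wordValue s (List.nodup_finRange _) List.mem_finRange).sub
    (LawMultilinear.sum (Finset.univ.filter fun π : LegPartition n => π.Adapted s)
      fun π _ => (π.lawMultilinear_prod fun ℓ => (s ℓ).2).const_mul
        (P.wordValue s (List.finRange (n + 1)) (indicatorLaw π.word)))
  refine sub_eq_zero.1 (hD.eq_zero hμ fun e he => Or.inl ?_)
  simp only [LegPartition.prod_indicatorLaw _ he]
  rw [sub_eq_zero]
  by_cases h : ∃ π : LegPartition n, π.Adapted s ∧ π.word = e
  · obtain ⟨π, hπ, rfl⟩ := h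
    rw [Finset.sum_eq_single π]
    · simp
    · intro ρ _ hρ
      rw [if_neg (fun h => hρ (LegPartition.word_injective h)), mul_zero]
    · intro h; exact absurd (Finset.mem_filter.2 ⟨Finset.mem_univ π, hπ⟩) h
  · rw [(wordValue_indicatorLaw s hP he).resolve_right h, Finset.sum_eq_zero]
    intro ρ hρ
    rw [if_neg (fun h' => h ⟨ρ, (Finset.mem_filter.1 hρ).2, h'⟩), mul_zero]

theorem isCoefficients_wordValue (hP : P.IsPositive) :
    P.IsCoefficients fun _ n s π => P.wordValue s (List.finRange (n + 1)) (indicatorLaw π.word) := by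
  classical
  intro k n s A φ a ha
  let g : Fin (k + 1) → List (Fin (n + 1)) → ℂ := fun κ v => φ κ (listProd (v.map (a κ)))
  -- The functional of the algebra of the first letter evaluates the word. The values on mixed words
  -- do not matter; the empty word must get `0` for the reduction to indicator laws.
  let μ : List (Fin (n + 1)) → ℂ := fun v => v.head?.elim 0 fun i => g (s i).1 v
  have hμ : ∀ κ v, v ≠ [] → (∀ ℓ ∈ v, (s ℓ).1 = κ) → μ v = g κ v := by
    intro κ v hv hκ
    obtain ⟨x, v, rfl⟩ := List.exists_cons_of_ne_nil hv
    simp only [μ, List.head?_cons, Option.elim_some, hκ x (by simp)]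
  rw [List.ofFn_eq_map, P.iterProd_eq_wordValue s (List.finRange (n + 1)) φ a ha μ hμ,
    wordValue_eq_sum s hP (by simp [μ])]
  refine Finset.sum_congr (by congr) fun π hπ => ?_
  rw [← π.prod_blocks_eq (Finset.mem_filter.1 hπ).2.1 g μ hμ]

/-- Inserting the indicator law of `π` for all functionals annihilates every other term of the
expansion, so the coefficients are forced. -/
theorem IsCoefficients.eq_wordValue {c} (hc : P.IsCoefficients c) {π : LegPartition n}
    (hπ : π.Adapted s) :
    c k n s π = P.wordValue s (List.finRange (n + 1)) (indicatorLaw π.word) := by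
  classical
  have he := π.isWordPartition_word
  let φ := freeMF.functional.{u} (fun ℓ => (s ℓ).2) (indicatorLaw π.word)
  have hμ : ∀ v : List (Fin (n + 1)), v ≠ [] → indicatorLaw π.word v =
      φ (listProd (v.map freeMF.gen)) := fun v hv => (freeMF.functional_word _ hv).symm
  have h := hc k n s (fun _ => freeMF.{u} (Fin (n + 1)) fun ℓ => (s ℓ).2) (fun _ => φ)
    (fun _ => freeMF.gen) fun ℓ => freeMF.gen_mem ℓ
  rw [List.ofFn_eq_map, P.iterProd_eq_wordValue s (List.finRange (n + 1)) (fun _ => φ)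
    (fun _ => freeMF.gen) (fun ℓ => freeMF.gen_mem ℓ) _ fun κ v hv _ => hμ v hv] at h
  rw [h, Finset.sum_eq_single π]
  · have := π.prod_blocks_eq hπ.1 (fun _ v => φ (listProd (v.map freeMF.gen))) _
      fun κ v hv _ => hμ v hv
    rw [π.prod_indicatorLaw he, if_pos rfl] at this
    rw [this, mul_one]
  · intro ρ hρ hne
    have hρ' := (Finset.mem_filter.1 hρ).2
    have := ρ.prod_blocks_eq hρ'.1 (fun _ v => φ (listProd (v.map freeMF.gen))) _
      fun κ v hv _ => hμ v hv
    rw [ρ.prod_indicatorLaw he, if_neg fun h => hne (LegPartition.word_injective h)] at this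
    rw [this, mul_zero]
  · intro h; exact absurd (Finset.mem_filter.2 ⟨Finset.mem_univ π, hπ⟩) h

end Coefficients

/-! ### Permutations of the factors -/

section Symmetric

variable {F : Type} {P : UniversalProduct.{u} F}

/-- The exchange of the first two of three factors. -/
noncomputable def exchange (A B C : MFAlg.{u} F) :
    A.coprod (B.coprod C) →ₙₐ[ℂ] B.coprod (A.coprod C) :=
  MFAlg.lift (MFAlg.inr.comp MFAlg.inl)
    (MFAlg.coprodMap (NonUnitalAlgHom.id ℂ _) MFAlg.inr)

theorem exchange_inl (A B C : MFAlg.{u} F) (x : A) :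
    exchange A B C (MFAlg.inl x) = MFAlg.inr (MFAlg.inl x) := by simp [exchange]

theorem exchange_inr_inl (A B C : MFAlg.{u} F) (x : B) :
    exchange A B C (MFAlg.inr (MFAlg.inl x)) = MFAlg.inl x := by simp [exchange]

theorem exchange_inr_inr (A B C : MFAlg.{u} F) (x : C) :
    exchange A B C (MFAlg.inr (MFAlg.inr x)) = MFAlg.inr (MFAlg.inr x) := by simp [exchange]

/-- The inverse of the canonical identification `(A ⊔ B) ⊔ C → A ⊔ (B ⊔ C)`. -/
noncomputable def unassoc (A B C : MFAlg.{u} F) :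
    A.coprod (B.coprod C) →ₙₐ[ℂ] (A.coprod B).coprod C :=
  MFAlg.lift (MFAlg.inl.comp MFAlg.inl) (MFAlg.coprodMap MFAlg.inr (NonUnitalAlgHom.id ℂ _))

theorem coprodAssoc_unassoc (A B C : MFAlg.{u} F) (x : A.coprod (B.coprod C)) :
    MFAlg.coprodAssoc A B C (unassoc A B C x) = x := by
  have : (MFAlg.coprodAssoc A B C).comp (unassoc A B C) = NonUnitalAlgHom.id ℂ _ := by
    refine MFAlg.coprod_hom_ext (fun a => ?_) fun y => ?_
    · simp [unassoc, MFAlg.coprodAssoc_inl_inl]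
    · have : ((MFAlg.coprodAssoc A B C).comp (unassoc A B C)).comp MFAlg.inr = MFAlg.inr := by
        refine MFAlg.coprod_hom_ext (fun b => ?_) fun c => ?_
        · simp [unassoc, MFAlg.coprodAssoc_inl_inr]
        · simp [unassoc, MFAlg.coprodAssoc_inr]
      exact DFunLike.congr_fun this y
  exact DFunLike.congr_fun this x

theorem prod_assoc' (P : UniversalProduct.{u} F) {A B C : MFAlg.{u} F} (φ : A.Functional)
    (ψ : B.Functional) (ρ : C.Functional)
    (x : A.coprod (B.coprod C)) :
    P.prod φ (P.prod ψ ρ) x = P.prod (P.prod φ ψ) ρ (unassoc A B C x) := by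
  rw [P.associativity, coprodAssoc_unassoc]

theorem prod_comp (P : UniversalProduct.{u} F) {A₁ A₂ B₁ B₂ : MFAlg.{u} F} {φ₁ : A₁.Functional}
    {φ₂ : A₂.Functional} {ψ₁ : B₁.Functional} {ψ₂ : B₂.Functional} {h₁ : B₁ →ₙₐ[ℂ] A₁}
    {h₂ : B₂ →ₙₐ[ℂ] A₂} (H₁ : MFAlg.IsFaced h₁) (H₂ : MFAlg.IsFaced h₂)
    (e₁ : ∀ x, ψ₁ x = φ₁ (h₁ x)) (e₂ : ∀ x, ψ₂ x = φ₂ (h₂ x)) (x : B₁.coprod B₂) :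
    P.prod ψ₁ ψ₂ x = P.prod φ₁ φ₂ (MFAlg.coprodMap h₁ h₂ x) := by
  rw [← P.universality φ₁ φ₂ h₁ h₂ H₁ H₂]
  have h1 : ψ₁ = φ₁ ∘ₗ (h₁ : B₁ →ₗ[ℂ] A₁) := LinearMap.ext e₁
  have h2 : ψ₂ = φ₂ ∘ₗ (h₂ : B₂ →ₗ[ℂ] A₂) := LinearMap.ext e₂
  rw [h1, h2]

theorem isFaced_coprodSwap (A B : MFAlg.{u} F) : MFAlg.IsFaced (MFAlg.coprodSwap A B) :=
  MFAlg.isFaced_lift MFAlg.isFaced_inr MFAlg.isFaced_inl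

theorem IsSymmetric.prod_exchange (hS : P.IsSymmetric) {A B C : MFAlg.{u} F} (φ : A.Functional)
    (ψ : B.Functional) (ρ : C.Functional) (x : A.coprod (B.coprod C)) :
    P.prod φ (P.prod ψ ρ) x = P.prod ψ (P.prod φ ρ) (exchange A B C x) := by
  rw [prod_assoc', P.prod_comp (isFaced_coprodSwap A B) (MFAlg.isFaced_id C) (hS φ ψ)
    (fun _ => rfl), P.associativity]
  congr 1
  have : ((MFAlg.coprodAssoc B A C).comp (MFAlg.coprodMap (MFAlg.coprodSwap A B)
      (NonUnitalAlgHom.id ℂ C))).comp (unassoc A B C) = exchange A B C := by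
    refine MFAlg.coprod_hom_ext (fun a => ?_) fun y => ?_
    · simp [unassoc, exchange, MFAlg.coprodAssoc_inl_inr]
    · refine DFunLike.congr_fun (f := (((MFAlg.coprodAssoc B A C).comp
        (MFAlg.coprodMap (MFAlg.coprodSwap A B)
        (NonUnitalAlgHom.id ℂ C))).comp (unassoc A B C)).comp MFAlg.inr)
        (g := (exchange A B C).comp MFAlg.inr) ?_ y
      refine MFAlg.coprod_hom_ext (fun b => ?_) fun c => ?_
      · simp [unassoc, exchange, MFAlg.coprodAssoc_inl_inl]
      · simp [unassoc, exchange, MFAlg.coprodAssoc_inr]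
  exact DFunLike.congr_fun this x

/-- In a product of copies of a functional, the factors can be permuted. -/
def Permutes (P : UniversalProduct.{u} F) (A : MFAlg.{u} F) (φ : A.Functional) (k : ℕ)
    (σ : Fin (k + 1) → Fin (k + 1)) : Prop :=
  ∃ Θ : MFAlg.iterCoprod k (fun _ => A) →ₙₐ[ℂ] MFAlg.iterCoprod k (fun _ => A),
    MFAlg.IsFaced Θ ∧
    (∀ κ x, Θ (MFAlg.iterIncl k (fun _ => A) κ x) = MFAlg.iterIncl k (fun _ => A) (σ κ) x) ∧
    ∀ x, P.iterProd k (fun _ => A) (fun _ => φ) (Θ x) = P.iterProd k (fun _ => A) (fun _ => φ) x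

theorem isFaced_exchange (A B C : MFAlg.{u} F) : MFAlg.IsFaced (exchange A B C) :=
  MFAlg.isFaced_lift (MFAlg.isFaced_inr.comp MFAlg.isFaced_inl)
    (MFAlg.isFaced_coprodMap (MFAlg.isFaced_id _) MFAlg.isFaced_inr)

/-- Later transpositions act inside the tail and come from the induction hypothesis, so only the
exchange of the first two factors is new. -/
theorem IsSymmetric.permutes_swap (hS : P.IsSymmetric) (A : MFAlg.{u} F) (φ : A.Functional)
    {k : ℕ} (i : Fin k) : P.Permutes A φ k (Equiv.swap i.castSucc i.succ) := by
  induction k with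
  | zero => exact i.elim0
  | succ k ih =>
    induction i using Fin.cases with
    | zero =>
      cases k with
      -- With two factors in all, the tail is a single algebra without further factors, and the
      -- plain swap replaces `exchange`.
      | zero =>
        refine ⟨MFAlg.coprodSwap A A, isFaced_coprodSwap A A, fun κ x => ?_,
          fun x => (hS φ φ x).symm⟩
        induction κ using Fin.cases with
        | zero => exact MFAlg.coprodSwap_inl x
        | succ κ =>
          obtain rfl : κ = 0 := Fin.fin_one_eq_zero κ
          exact MFAlg.coprodSwap_inr x
      | succ k =>
        refine ⟨exchange A A _, isFaced_exchange _ _ _, fun κ x => ?_,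
          fun x => (hS.prod_exchange φ φ _ x).symm⟩
        induction κ using Fin.cases with
        | zero => exact exchange_inl _ _ _ x
        | succ κ =>
          induction κ using Fin.cases with
          | zero => exact exchange_inr_inl _ _ _ x
          | succ κ =>
            have : Equiv.swap (Fin.castSucc 0) (Fin.succ 0) κ.succ.succ = κ.succ.succ :=
              Equiv.swap_apply_of_ne_of_ne (Fin.succ_ne_zero _)
                fun h => Fin.succ_ne_zero κ (Fin.succ_injective _ h)
            refine Eq.trans ?_ (congrArg
              (fun j => MFAlg.iterIncl (k + 1 + 1) (fun _ => A) j x) this.symm)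
            exact exchange_inr_inr _ _ _ _
    | succ i =>
      obtain ⟨Θ, hΘ, h₁, h₂⟩ := ih i
      refine ⟨MFAlg.coprodMap (NonUnitalAlgHom.id ℂ A) Θ,
        MFAlg.isFaced_coprodMap (MFAlg.isFaced_id A) hΘ, fun κ x => ?_, fun x => ?_⟩
      · induction κ using Fin.cases with
        | zero =>
          rw [Equiv.swap_apply_of_ne_of_ne (fun h => ?_) (Fin.succ_ne_zero _).symm]
          · exact MFAlg.coprodMap_inl _ _ x
          · exact Fin.succ_ne_zero i.castSucc (by rw [Fin.succ_castSucc, ← h])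
        | succ κ =>
          have : Equiv.swap i.succ.castSucc i.succ.succ κ.succ =
              (Equiv.swap i.castSucc i.succ κ).succ := by
            rw [← Fin.succ_castSucc]
            exact ((Fin.succ_injective _).map_swap i.castSucc i.succ κ).symm
          rw [this]
          exact (MFAlg.coprodMap_inr _ _ _).trans (congrArg _ (h₁ κ x))
      · exact (P.prod_comp (MFAlg.isFaced_id A) hΘ (fun _ => rfl) (fun y => (h₂ y).symm) x).symm

/-- Adjacent transpositions generate all permutations, already as a monoid. -/
theorem IsSymmetric.permutes (hS : P.IsSymmetric) (A : MFAlg.{u} F) (φ : A.Functional)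
    {k : ℕ} (σ : Equiv.Perm (Fin (k + 1))) : P.Permutes A φ k σ := by
  have hσ : σ ∈ Submonoid.closure (Set.range fun i : Fin k => Equiv.swap i.castSucc i.succ) := by
    rw [Equiv.Perm.mclosure_swap_castSucc_succ]; trivial
  induction hσ using Submonoid.closure_induction with
  | mem σ hσ =>
    obtain ⟨i, rfl⟩ := hσ
    exact hS.permutes_swap A φ i
  | one => exact ⟨NonUnitalAlgHom.id ℂ _, MFAlg.isFaced_id _, fun _ _ => rfl, fun _ => rfl⟩
  | mul σ τ _ _ h h' =>
    obtain ⟨Θ, hΘ, h₁, h₂⟩ := h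
    obtain ⟨Θ', hΘ', h₁', h₂'⟩ := h'
    exact ⟨Θ.comp Θ', hΘ.comp hΘ', fun κ x => by simp [h₁, h₁'], fun x => by simp [h₂, h₂']⟩

theorem IsSymmetric.wordValue_perm (hS : P.IsSymmetric) {L : Type} {k : ℕ}
    (s : L → Fin (k + 1) × F) (σ : Equiv.Perm (Fin (k + 1))) (w : List L) (μ : List L → ℂ) :
    P.wordValue (fun ℓ => (σ (s ℓ).1, (s ℓ).2)) w μ = P.wordValue s w μ := by
  obtain ⟨Θ, -, h₁, h₂⟩ := hS.permutes (freeMF.{u} L fun ℓ => (s ℓ).2)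
    (freeMF.functional _ μ) σ
  rw [wordValue, wordValue, EvalFamily.ofLaw, EvalFamily.ofLaw,
    P.iterFamily_ev_subst (fun ℓ => (σ (s ℓ).1, (s ℓ).2)), P.iterFamily_ev_subst s]
  conv_rhs => rw [← h₂, map_listProd, List.map_map]
  congr 2
  exact List.map_congr_left fun ℓ _ => (h₁ _ _).symm

/-- Both maps are surjective with the same fibres, so they differ by a bijection of the index sets,
which is a permutation of the factors. -/
theorem IsSymmetric.wordValue_enumeration (hS : P.IsSymmetric) {L : Type} {k k' : ℕ}
    {b : L → Fin (k + 1)} {b' : L → Fin (k' + 1)} (f : L → F) (hb : Function.Surjective b)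
    (hb' : Function.Surjective b') (h : ∀ i j, b i = b j ↔ b' i = b' j) (w : List L)
    (μ : List L → ℂ) :
    P.wordValue (fun ℓ => (b ℓ, f ℓ)) w μ = P.wordValue (fun ℓ => (b' ℓ, f ℓ)) w μ := by
  let τ : Fin (k + 1) ≃ Fin (k' + 1) := Equiv.ofBijective
    (fun κ => b' (Function.surjInv hb κ)) ⟨fun κ κ' hκ => by
      have := (h _ _).2 hκ
      rwa [Function.surjInv_eq hb, Function.surjInv_eq hb] at this, fun κ => by
      obtain ⟨ℓ, rfl⟩ := hb' κ
      exact ⟨b ℓ, (h _ _).1 (Function.surjInv_eq hb (b ℓ))⟩⟩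
  have hτ : ∀ ℓ, τ (b ℓ) = b' ℓ := fun ℓ => (h _ _).1 (Function.surjInv_eq hb (b ℓ))
  obtain rfl : k = k' := by simpa using Fintype.card_congr τ
  rw [← hS.wordValue_perm (fun ℓ => (b ℓ, f ℓ)) τ]
  simp only [hτ]

end Symmetric

/-! ### Highest coefficients -/

section Highest

theorem _root_.LegPartition.exists_enumeration {n : ℕ} (π : LegPartition n) :
    ∃ (k : ℕ) (b : Fin (n + 1) → Fin (k + 1)), Function.Surjective b ∧
      ∀ i j, b i = b j ↔ π.SameBlock i j := by
  have hpos : 0 < π.parts.card := Finset.card_pos.2 ⟨_, π.part_mem.2 (Finset.mem_univ 0)⟩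
  obtain ⟨k, hk⟩ : ∃ k, π.parts.card = k + 1 := ⟨π.parts.card - 1, by omega⟩
  let ε := π.parts.equivFinOfCardEq hk
  refine ⟨k, fun ℓ => ε ⟨π.part ℓ, π.part_mem.2 (Finset.mem_univ ℓ)⟩, fun κ => ?_, fun i j => ?_⟩
  · obtain ⟨⟨β, hβ⟩, rfl⟩ := ε.surjective κ
    obtain ⟨ℓ, hℓ⟩ := π.nonempty_of_mem_parts hβ
    exact ⟨ℓ, by simp only [π.part_eq_of_mem hβ hℓ]⟩
  · rw [ε.injective.eq_iff, Subtype.mk.injEq,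
      ← π.mem_part_iff_part_eq_part (Finset.mem_univ i) (Finset.mem_univ j),
      Finpartition.mem_part_iff_exists]
    rfl

theorem _root_.LegPartition.adapted_enumeration {F : Type} {n k : ℕ} {π : LegPartition n}
    {b : Fin (n + 1) → Fin (k + 1)} (h : ∀ i j, b i = b j ↔ π.SameBlock i j)
    (f : Fin (n + 1) → F) : π.Adapted fun ℓ => (b ℓ, f ℓ) := by
  refine ⟨fun β hβ => ?_, fun i hi => (h _ _).1 (congrArg Prod.fst hi)⟩
  obtain ⟨ℓ, hℓ⟩ := π.nonempty_of_mem_parts hβ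
  exact ⟨b ℓ, fun m hm => (h _ _).2 ⟨β, hβ, hm, hℓ⟩⟩

variable {P : UniversalProduct.{u} TwoFaces}

theorem IsHighestCoefficients.eq_wordValue {α : MFPartition TwoFaces → ℂ}
    (h : P.IsHighestCoefficients α) (p : MFPartition TwoFaces) {k : ℕ}
    {b : Fin (p.n + 1) → Fin (k + 1)} (hb : Function.Surjective b)
    (hb' : ∀ i j, b i = b j ↔ p.π.SameBlock i j) :
    α p = P.wordValue (fun ℓ => (b ℓ, p.f ℓ)) (List.finRange (p.n + 1)) (indicatorLaw p.π.word) := by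
  obtain ⟨c, hc, hα⟩ := h
  rw [hα p k b hb hb', hc.eq_wordValue _ (LegPartition.adapted_enumeration hb' p.f)]

/-- A positive symmetric universal product has unique highest coefficients. -/
theorem existsUnique_isHighestCoefficients (hP : P.IsPositive) (hS : P.IsSymmetric) :
    ∃! α : MFPartition TwoFaces → ℂ, P.IsHighestCoefficients α := by
  refine existsUnique_of_exists_of_unique ?_ fun α α' h h' => funext fun p => ?_
  · choose k b hb hb' using fun p : MFPartition TwoFaces => p.π.exists_enumeration
    refine ⟨fun p => P.wordValue (fun ℓ => (b p ℓ, p.f ℓ)) (List.finRange (p.n + 1))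
      (indicatorLaw p.π.word), _, isCoefficients_wordValue hP, fun p k' b' h h' => ?_⟩
    exact hS.wordValue_enumeration p.f (hb p) h (fun i j => (hb' p i j).trans (h' i j).symm) _ _
  · obtain ⟨k, b, hb, hb'⟩ := p.π.exists_enumeration
    rw [h.eq_wordValue p hb hb', h'.eq_wordValue p hb hb']

end Highest

end UniversalProduct

/-! ## Natural functionals -/

/-- Elements of `B` are broken up into face elements because the reduction to indicator laws needs
coloured letters. Elements of `A` may stay arbitrary: they will be the constants of a pattern. -/
theorem MFAlg.coprod_span {F : Type} {A B : MFAlg.{u} F} (x : A.coprod B) :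
    x ∈ Submodule.span ℂ {y | ∃ l : List (A ⊕ B), l ≠ [] ∧
      (∀ b, Sum.inr b ∈ l → ∃ f, b ∈ B.face f) ∧
      y = listProd (l.map (Sum.elim (MFAlg.inl : A →ₙₐ[ℂ] A.coprod B) MFAlg.inr))} := by
  let S : Set (A.coprod B) := Set.range (MFAlg.inl : A →ₙₐ[ℂ] A.coprod B) ∪
    (MFAlg.inr : B →ₙₐ[ℂ] A.coprod B) '' {b | ∃ f, b ∈ B.face f}
  have hx : x ∈ NonUnitalAlgebra.adjoin ℂ S := by
    induction x using MFAlg.coprod_induction with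
    | hl a => exact NonUnitalAlgebra.subset_adjoin ℂ (Or.inl ⟨a, rfl⟩)
    | hr b =>
      induction b using MFAlg.face_induction with
      | face f b hb => exact NonUnitalAlgebra.subset_adjoin ℂ (Or.inr ⟨b, ⟨f, hb⟩, rfl⟩)
      | zero => rw [map_zero]; exact zero_mem _
      | add x y h₁ h₂ => rw [map_add]; exact add_mem h₁ h₂
      | mul x y h₁ h₂ => rw [map_mul]; exact mul_mem h₁ h₂
      | smul c x h => rw [map_smul]; exact SMulMemClass.smul_mem c h
    | zero => exact zero_mem _
    | add x y h₁ h₂ => exact add_mem h₁ h₂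
    | mul x y h₁ h₂ => exact mul_mem h₁ h₂
    | smul c x h => exact SMulMemClass.smul_mem c h
  refine Submodule.span_mono ?_ (mem_span_listProd hx)
  rintro y ⟨l, hl, hS, rfl⟩
  have : ∃ l' : List (A ⊕ B), (∀ b, Sum.inr b ∈ l' → ∃ f, b ∈ B.face f) ∧
      l'.map (Sum.elim (MFAlg.inl : A →ₙₐ[ℂ] A.coprod B) MFAlg.inr) = l := by
    clear hl
    induction l with
    | nil => exact ⟨[], by simp, rfl⟩
    | cons z l ih =>
      obtain ⟨l', h₁, h₂⟩ := ih fun a ha => hS a (by simp [ha])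
      rcases hS z (by simp) with ⟨a, ha⟩ | ⟨b, hb, hb'⟩
      · exact ⟨Sum.inl a :: l', by simpa using h₁, by rw [List.map_cons, h₂, ← ha]; rfl⟩
      · refine ⟨Sum.inr b :: l', fun c hc => ?_, by rw [List.map_cons, h₂, ← hb']; rfl⟩
        rcases List.mem_cons.1 hc with h | h
        · rw [Sum.inr.inj h]; exact hb
        · exact h₁ c h
  obtain ⟨l', h₁, rfl⟩ := this
  exact ⟨l', by rintro rfl; exact hl rfl, h₁, rfl⟩

/-- The evaluation of a family of functionals on the free products `A₀ ⊔ A`, natural in `A`, on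
products of elements of the factors. -/
noncomputable def EvalFamily.ofNatural {F : Type} (A₀ : MFAlg.{u} F)
    (Λ : ∀ A : MFAlg.{u} F, A.Functional → (A₀.coprod A).Functional)
    (hΛ : ∀ {A B : MFAlg.{u} F} (φ : A.Functional) (h : B →ₙₐ[ℂ] A), MFAlg.IsFaced h →
      ∀ x, Λ B (φ ∘ₗ (h : B →ₗ[ℂ] A)) x =
        Λ A φ (MFAlg.coprodMap (NonUnitalAlgHom.id ℂ A₀) h x)) : EvalFamily.{u} F A₀ Unit where
  ev A φ l := Λ A φ (listProd (l.map (Sum.elim (MFAlg.inl : A₀ →ₙₐ[ℂ] A₀.coprod A)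
    fun x => MFAlg.inr x.2)))
  nat φ h hh l := by
    rw [hΛ φ h hh, map_listProd, List.map_map, List.map_map]
    congr 3
    funext x
    rcases x with x | x <;> simp
  map_add {A} φ i x y l₁ l₂ := by
    simp only [List.map_append, List.map_cons, Sum.elim_inr, _root_.map_add, listProd_middle_add]
  map_smul {A} φ i r x l₁ l₂ := by
    simp only [List.map_append, List.map_cons, Sum.elim_inr, _root_.map_smul, listProd_middle_smul,
      smul_eq_mul]

/-- Natural functionals on free products vanish if they vanish for matrix models. -/
theorem natural_eq_zero_of_model {A₀ : MFAlg.{u} TwoFaces}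
    (Λ : ∀ A : MFAlg.{u} TwoFaces, A.Functional → (A₀.coprod A).Functional)
    (hΛ : ∀ {A B : MFAlg.{u} TwoFaces} (φ : A.Functional) (h : B →ₙₐ[ℂ] A), MFAlg.IsFaced h →
      ∀ x, Λ B (φ ∘ₗ (h : B →ₗ[ℂ] A)) x =
        Λ A φ (MFAlg.coprodMap (NonUnitalAlgHom.id ℂ A₀) h x))
    (H : ∀ (ι : Type u) [Fintype ι] [DecidableEq ι] (o : ι), Λ (matrixMF ι) (matrixMF.vec o) = 0)
    (A : MFAlg.{u} TwoFaces) (φ : A.Functional) : Λ A φ = 0 := by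
  refine LinearMap.ext fun x => ?_
  induction MFAlg.coprod_span x using Submodule.span_induction with
  | zero => simp
  | add a b _ _ ha hb => rw [map_add, ha, hb]; simp
  | smul c a _ ha => rw [map_smul, ha]; simp
  | mem a ha =>
    obtain ⟨l, -, hS, rfl⟩ := ha
    -- The letters are the positions occupied by elements of `A`; the elements of `A₀` remain in the
    -- pattern as constants.
    let L : Type := {i : Fin l.length // (l.get i).isRight}
    let a : L → A := fun i => (l.get i.1).getRight i.2
    have hmem : ∀ i : L, Sum.inr (a i) ∈ l := fun i => by
      simp only [a, Sum.inr_getRight]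
      exact List.get_mem _ _
    choose f hf using fun i => hS _ (hmem i)
    let g : Fin l.length → A₀ ⊕ Unit × L := fun i =>
      if h : (l.get i).isRight then Sum.inr ((), ⟨i, h⟩)
      else Sum.inl ((l.get i).getLeft (by simpa using h))
    have hq : EvalFamily.Once ((List.finRange l.length).map g) := by
      intro ℓ
      obtain ⟨y, z, hyz⟩ := List.append_of_mem (List.mem_finRange ℓ.1)
      obtain ⟨-, hy, hz⟩ := finRange_split hyz
      have hg : ∀ i j, g i = Sum.inr (j, ℓ) → i = ℓ.1 := by
        intro i j h
        simp only [g] at h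
        split_ifs at h with h'
        exact congrArg (fun x : Unit × L => x.2.1) (Sum.inr.inj h)
      refine ⟨y.map g, z.map g, (), ?_, fun j => ⟨fun h => ?_, fun h => ?_⟩⟩
      · rw [hyz, List.map_append, List.map_cons]
        congr 2
        simp only [g]
        rw [dif_pos ℓ.2]
      · obtain ⟨i, hi, hi'⟩ := List.mem_map.1 h
        exact (hy i hi).ne (hg i j hi')
      · obtain ⟨i, hi, hi'⟩ := List.mem_map.1 h
        exact (hz i hi).ne' (hg i j hi')
    have key := (EvalFamily.ofNatural A₀ Λ hΛ).ev_eq_zero_of_model hq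
      (fun ι _ _ o X => by simp only [EvalFamily.ofNatural, H]; rfl) φ (a := a) hf
    simp only [EvalFamily.ofNatural, EvalFamily.subst, List.map_map] at key
    rw [← List.map_get_finRange l, List.map_map]
    refine Eq.trans ?_ key
    congr 2
    refine List.map_congr_left fun i _ => ?_
    simp only [Function.comp_apply, g]
    split_ifs with h
    · simp only [Sum.map_inr, Sum.elim_inr, Prod.map, a]
      obtain ⟨b, hb⟩ := Sum.isRight_iff.1 h
      simp only [hb, Sum.getRight_inr, Sum.elim_inr]
    · obtain ⟨b, hb⟩ := Sum.isLeft_iff.1 (by simpa using h : (l.get i).isLeft)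
      simp only [hb, Sum.map_inl, Sum.elim_inl, Sum.getLeft_inl, id_eq]

/-- The two-faced algebra both of whose faces are copies of the complex numbers. -/
noncomputable abbrev scalarMF : MFAlg.{u} TwoFaces := matrixMF PUnit

namespace scalarMF

/-- The unit of the face of colour `f`. -/
noncomputable def unit (f : TwoFaces) : scalarMF.{u} := matrixMF.emb f 1

/-- The character which maps the units of both faces to `1`. -/
noncomputable abbrev char : scalarMF.{u}.Functional := matrixMF.vec PUnit.unit

theorem unit_mem (f : TwoFaces) : unit.{u} f ∈ scalarMF.{u}.face f := matrixMF.emb_mem f 1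

theorem char_unit (f : TwoFaces) : char (unit.{u} f) = 1 := by
  rw [unit, matrixMF.vec_apply, matrixMF.rep_emb, Matrix.one_apply_eq]

theorem unit_mul_unit (f : TwoFaces) : unit.{u} f * unit f = unit f := by
  rw [unit, ← map_mul, one_mul]

theorem star_unit (f : TwoFaces) : star (unit.{u} f) = unit f := by
  rw [unit, matrixMF.star_emb, star_one]

theorem emb_eq (f : TwoFaces) (m : Matrix PUnit PUnit ℂ) :
    matrixMF.emb.{u} f m = m PUnit.unit PUnit.unit • unit f := by
  rw [unit, ← map_smul]
  congr 1
  ext i j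
  simp

end scalarMF

/-- Natural functionals are determined on faces by their values at the units of `scalarMF`. -/
theorem natural_eq_mul_unit (Λ : ∀ A : MFAlg.{u} TwoFaces, A.Functional → A.Functional)
    (hΛ : ∀ {A B : MFAlg.{u} TwoFaces} (φ : A.Functional) (h : B →ₙₐ[ℂ] A), MFAlg.IsFaced h →
      ∀ x, Λ B (φ ∘ₗ (h : B →ₗ[ℂ] A)) x = Λ A φ (h x))
    {A : MFAlg.{u} TwoFaces} (φ : A.Functional) {f : TwoFaces} {a : A} (ha : a ∈ A.face f) :
    Λ A φ a = φ a * Λ scalarMF scalarMF.char (scalarMF.unit f) := by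
  classical
  let E : EvalFamily.{u} TwoFaces Empty Unit :=
    { ev := fun A φ l => Λ A φ (listProd (l.map (Sum.elim Empty.elim Prod.snd)))
      nat := fun φ h hh l => by
        rw [hΛ φ h hh, map_listProd, List.map_map, List.map_map]
        congr 3
        funext x
        rcases x with x | x
        · exact x.elim
        · rfl
      map_add := fun φ i x y l₁ l₂ => by
        simp only [List.map_append, List.map_cons, Sum.elim_inr, map_add, listProd_middle_add]
      map_smul := fun φ i r x l₁ l₂ => by
        simp only [List.map_append, List.map_cons, Sum.elim_inr, map_smul, listProd_middle_smul,
          smul_eq_mul] }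
  let q : List (Empty ⊕ Unit × Unit) := [Sum.inr ((), ())]
  have hq : EvalFamily.Once q := fun ℓ => ⟨[], [], (), rfl, fun _ => by simp⟩
  let e₀ : Unit → List Unit := fun _ => [()]
  have hμ : LawMultilinear.{u} (fun _ : Unit => f) fun μ => μ [()] := by
    intro X c μ
    refine ⟨(MultilinearMap.ofSubsingleton ℂ _ ℂ ()) (freeMF.functional c μ), fun a _ => ?_⟩
    simp [jointLaw, listProd]
  -- A single letter admits only one partition into words, so the evaluation is a multiple of the
  -- first moment. The factor is then read off at the unit, whose first moment is `1`.
  have hD : ∀ μ : List Unit → ℂ, μ [] = 0 → E.ofLaw (fun _ => f) q μ =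
      E.ofLaw (fun _ => f) q (indicatorLaw e₀) * μ [()] := by
    intro μ h0
    refine sub_eq_zero.1 (((E.lawMultilinear_ofLaw (fun _ => f) hq).sub
      (hμ.const_mul (E.ofLaw (fun _ => f) q (indicatorLaw e₀)))).eq_zero h0 fun e he => Or.inl ?_)
    have : e = e₀ := by
      funext i
      have h1 := he.mem i
      have h2 := he.nodup i
      have h3 : (e i).length ≤ 1 := by simpa using h2.length_le_card
      obtain ⟨x, hx⟩ := List.length_eq_one_iff.1
        (le_antisymm h3 (List.length_pos_of_mem h1))
      simpa [e₀] using hx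
    subst this
    have : indicatorLaw e₀ [()] = 1 := if_pos ⟨(), rfl⟩
    rw [this]; ring
  have h1 := E.ev_subst q φ (a := fun _ => a) (f := fun _ => f) fun _ => ha
  have h2 := E.ev_subst q scalarMF.char.{u} (a := fun _ => scalarMF.unit f) (f := fun _ => f)
    fun _ => scalarMF.unit_mem f
  rw [hD _ (map_zero _)] at h1 h2
  simp only [jointLaw, List.map_cons, List.map_nil, listProd, scalarMF.char_unit, mul_one] at h1 h2
  rw [← h2] at h1
  rw [mul_comm]
  exact h1

/-! ## Unital extensions of homomorphisms -/

section UnitMap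

variable {A B : Type*} [NonUnitalRing A] [Module ℂ A] [IsScalarTower ℂ A A] [SMulCommClass ℂ A A]
  [NonUnitalRing B] [Module ℂ B] [IsScalarTower ℂ B B] [SMulCommClass ℂ B B]

/-- The unital extension of a homomorphism. -/
noncomputable def unitMap (H : A →ₙₐ[ℂ] B) : Unitization ℂ A →ₐ[ℂ] Unitization ℂ B :=
  Unitization.lift ((Unitization.inrNonUnitalAlgHom ℂ B).comp H)

@[simp] theorem unitMap_inr (H : A →ₙₐ[ℂ] B) (x : A) :
    unitMap H (Unitization.inr x) = Unitization.inr (H x) := by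
  simp [unitMap]

theorem unitMap_apply (H : A →ₙₐ[ℂ] B) (z : Unitization ℂ A) :
    unitMap H z = algebraMap ℂ _ z.fst + Unitization.inr (H z.snd) := by
  simp [unitMap]

theorem unitExt_algebraMap (φ : A →ₗ[ℂ] ℂ) (c : ℂ) :
    unitExt φ (algebraMap ℂ (Unitization ℂ A) c) = c := by
  rw [Algebra.algebraMap_eq_smul_one, map_smul, unitExt_one, smul_eq_mul, mul_one]

theorem unitExt_lift (φ : B →ₗ[ℂ] ℂ) (H : A →ₙₐ[ℂ] Unitization ℂ B) (z : Unitization ℂ A) :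
    unitExt φ (Unitization.lift H z) = z.fst + unitExt φ (H z.snd) := by
  change unitExt φ (algebraMap ℂ _ z.fst + H z.snd) = _
  rw [map_add, unitExt_algebraMap]

theorem unitExt_unitMap (φ : B →ₗ[ℂ] ℂ) (H : A →ₙₐ[ℂ] B) (z : Unitization ℂ A) :
    unitExt φ (unitMap H z) = unitExt (φ ∘ₗ (H : A →ₗ[ℂ] B)) z := by
  rw [unitMap, unitExt_lift]
  exact congrArg _ (unitExt_inr φ _)

theorem star_unitMap [StarRing A] [StarModule ℂ A] [StarRing B] [StarModule ℂ B] (H : A →ₙₐ[ℂ] B)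
    (hH : ∀ x, H (star x) = star (H x)) (z : Unitization ℂ A) :
    unitMap H (star z) = star (unitMap H z) := by
  rw [unitMap_apply, unitMap_apply, star_add, Unitization.fst_star, Unitization.snd_star, hH,
    ← algebraMap_star_comm, Unitization.inr_star]

end UnitMap

namespace matrixMF

variable {ι : Type u} [Fintype ι] [DecidableEq ι]

/-- The unital extension of the representation. -/
noncomputable def unitRep : Unitization ℂ (matrixMF ι) →ₐ[ℂ] Matrix ι ι ℂ := Unitization.lift rep

@[simp] theorem unitRep_inr (x : matrixMF ι) : unitRep (Unitization.inr x) = rep x := by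
  simp [unitRep]

theorem unitRep_apply (z : Unitization ℂ (matrixMF ι)) :
    unitRep z = algebraMap ℂ _ z.fst + rep z.snd := rfl

theorem unitExt_vec (o : ι) (z : Unitization ℂ (matrixMF ι)) :
    unitExt (vec o) z = unitRep z o o := by
  rw [unitExt_apply, unitRep_apply, vec_apply, Matrix.add_apply, Matrix.algebraMap_matrix_apply,
    if_pos rfl]
  rfl

theorem unitRep_star (z : Unitization ℂ (matrixMF ι)) : unitRep (star z) = star (unitRep z) := by
  rw [unitRep_apply, unitRep_apply, star_add, Unitization.fst_star, Unitization.snd_star, rep_star,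
    algebraMap_star_comm]

/-- The rank one element of the face of colour `f` which maps the basis vector `o` to `v`. -/
noncomputable def ket (f : TwoFaces) (o : ι) (v : ι → ℂ) : matrixMF ι :=
  emb f (Matrix.vecMulVec v (Pi.single o 1))

theorem rep_ket (f : TwoFaces) (o : ι) (v : ι → ℂ) (i : ι) : rep (ket f o v) i o = v i := by
  simp [ket, Matrix.vecMulVec_apply]

theorem ket_mem (f : TwoFaces) (o : ι) (v : ι → ℂ) : ket f o v ∈ (matrixMF ι).face f :=
  emb_mem _ _

/-- Elements which annihilate the state vector are null vectors. -/
theorem unitExt_mul_eq_zero {C : Type u} [NonUnitalRing C] [Module ℂ C] [IsScalarTower ℂ C C]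
    [SMulCommClass ℂ C C] [StarRing C] [StarModule ℂ C] {Φ : C →ₗ[ℂ] ℂ} (hΦ : IsRestrictedState Φ)
    {H : matrixMF ι →ₙₐ[ℂ] C} (hs : ∀ x, H (star x) = star (H x)) {o : ι}
    (hH : ∀ x, Φ (H x) = vec o x) {z : Unitization ℂ (matrixMF ι)} (hz : ∀ i, unitRep z i o = 0)
    (y : Unitization ℂ C) : unitExt Φ (y * unitMap H z) = 0 := by
  refine hΦ.null_left ?_ y
  have h : Φ ∘ₗ (H : matrixMF ι →ₗ[ℂ] C) = vec o := LinearMap.ext hH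
  rw [← star_unitMap H hs, ← map_mul, unitExt_unitMap, h, unitExt_vec, map_mul, unitRep_star,
    Matrix.mul_apply]
  exact Finset.sum_eq_zero fun i _ => by rw [hz, mul_zero]

end matrixMF

/-! ### Factorization over the two factors -/

namespace UniversalProduct

variable {P : UniversalProduct.{u} TwoFaces}

theorem isRestrictedState_prod_vec (hP : P.IsPositive) {ι ι' : Type u} [Fintype ι] [DecidableEq ι]
    [Fintype ι'] [DecidableEq ι'] (o : ι) (o' : ι') :
    IsRestrictedState (P.prod (matrixMF.vec o) (matrixMF.vec o')) :=
  hP _ _ matrixMF.facesStarClosed matrixMF.facesStarClosed _ _ (matrixMF.isRestrictedState_vec o)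
    (matrixMF.isRestrictedState_vec o')

theorem prod_comp_left (P : UniversalProduct.{u} TwoFaces) {A A' B : MFAlg.{u} TwoFaces}
    (φ : A.Functional) (ψ : B.Functional) (h : A' →ₙₐ[ℂ] A) (hh : MFAlg.IsFaced h)
    (x : A'.coprod B) :
    P.prod (φ ∘ₗ (h : A' →ₗ[ℂ] A)) ψ x =
      P.prod φ ψ (MFAlg.coprodMap h (NonUnitalAlgHom.id ℂ B) x) :=
  P.prod_comp hh (MFAlg.isFaced_id B) (fun _ => rfl) (fun _ => rfl) x

theorem prod_comp_right (P : UniversalProduct.{u} TwoFaces) {A B B' : MFAlg.{u} TwoFaces}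
    (φ : A.Functional) (ψ : B.Functional) (h : B' →ₙₐ[ℂ] B) (hh : MFAlg.IsFaced h)
    (x : A.coprod B') :
    P.prod φ (ψ ∘ₗ (h : B' →ₗ[ℂ] B)) x =
      P.prod φ ψ (MFAlg.coprodMap (NonUnitalAlgHom.id ℂ A) h x) :=
  P.prod_comp (MFAlg.isFaced_id A) hh (fun _ => rfl) (fun _ => rfl) x

/-- An element of a face between elements of the other factor can be replaced by a unit. -/
theorem prod_inr_inl_inr (P : UniversalProduct.{u} TwoFaces) {A B : MFAlg.{u} TwoFaces}
    (φ : A.Functional) (ψ : B.Functional) {f : TwoFaces} {a : A} (ha : a ∈ A.face f) (b b' : B) :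
    P.prod φ ψ (MFAlg.inr b * MFAlg.inl a * MFAlg.inr b') = φ a *
      P.prod scalarMF.char ψ (MFAlg.inr b * MFAlg.inl (scalarMF.unit f) * MFAlg.inr b') := by
  refine natural_eq_mul_unit (fun A φ => P.prod φ ψ ∘ₗ LinearMap.mulRight ℂ (MFAlg.inr b') ∘ₗ
    LinearMap.mulLeft ℂ (MFAlg.inr b) ∘ₗ
      ((MFAlg.inl : A →ₙₐ[ℂ] A.coprod B) : A →ₗ[ℂ] A.coprod B)) ?_ φ ha
  intro A A' φ h hh x
  refine (P.prod_comp_left φ ψ h hh _).trans (congrArg (P.prod φ ψ) ?_)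
  simp

theorem prod_inr_inl_of_face (P : UniversalProduct.{u} TwoFaces) {A B : MFAlg.{u} TwoFaces}
    (φ : A.Functional) (ψ : B.Functional) {f : TwoFaces} {a : A} (ha : a ∈ A.face f) (b : B) :
    P.prod φ ψ (MFAlg.inr b * MFAlg.inl a) = φ a *
      P.prod scalarMF.char ψ (MFAlg.inr b * MFAlg.inl (scalarMF.unit f)) := by
  refine natural_eq_mul_unit (fun A φ => P.prod φ ψ ∘ₗ
    LinearMap.mulLeft ℂ (MFAlg.inr b) ∘ₗ
      ((MFAlg.inl : A →ₙₐ[ℂ] A.coprod B) : A →ₗ[ℂ] A.coprod B)) ?_ φ ha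
  intro A A' φ h hh x
  refine (P.prod_comp_left φ ψ h hh _).trans (congrArg (P.prod φ ψ) ?_)
  simp

/-- The version for free products applies with an auxiliary first factor, which the projection `p`
maps to zero. -/
theorem natural_eq_zero_of_model' (Λ : ∀ A : MFAlg.{u} TwoFaces, A.Functional → A.Functional)
    (hΛ : ∀ {A B : MFAlg.{u} TwoFaces} (φ : A.Functional) (h : B →ₙₐ[ℂ] A), MFAlg.IsFaced h →
      ∀ x, Λ B (φ ∘ₗ (h : B →ₗ[ℂ] A)) x = Λ A φ (h x))
    (H : ∀ (ι : Type u) [Fintype ι] [DecidableEq ι] (o : ι), Λ (matrixMF ι) (matrixMF.vec o) = 0)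
    (A : MFAlg.{u} TwoFaces) (φ : A.Functional) : Λ A φ = 0 := by
  let p : ∀ A : MFAlg.{u} TwoFaces, scalarMF.coprod A →ₙₐ[ℂ] A := fun A =>
    MFAlg.lift 0 (NonUnitalAlgHom.id ℂ A)
  have h := natural_eq_zero_of_model (A₀ := scalarMF.{u})
    (fun A φ => Λ A φ ∘ₗ (p A : scalarMF.coprod A →ₗ[ℂ] A)) ?_ ?_ A φ
  · refine LinearMap.ext fun x => ?_
    have := LinearMap.congr_fun h (MFAlg.inr x)
    have hp : p A (MFAlg.inr x) = x := by simp [p]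
    rw [LinearMap.comp_apply] at this
    change Λ A φ (p A (MFAlg.inr x)) = 0 at this
    rwa [hp] at this
  · intro A B φ h hh x
    change Λ B _ (p B x) = Λ A φ (p A _)
    rw [hΛ φ h hh]
    congr 1
    have : h.comp (p B) = (p A).comp (MFAlg.coprodMap (NonUnitalAlgHom.id ℂ _) h) :=
      MFAlg.coprod_hom_ext (fun a => by simp [p]) fun b => by simp [p]
    exact DFunLike.congr_fun this x
  · intro ι _ _ o
    simp only [H]
    rfl

/-- The product of functionals factorizes on a product of an element of the second factor with
one of the first. -/
theorem prod_inr_mul_inl (hP : P.IsPositive) {A B : MFAlg.{u} TwoFaces} (φ : A.Functional)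
    (ψ : B.Functional) (b : B) (a : A) :
    P.prod φ ψ (MFAlg.inr b * MFAlg.inl a) = φ a * ψ b := by
  have model : ∀ {ι ι' : Type u} [Fintype ι] [DecidableEq ι] [Fintype ι'] [DecidableEq ι'] (o : ι)
      (o' : ι') (b : matrixMF ι') (a : matrixMF ι),
      P.prod (matrixMF.vec o) (matrixMF.vec o') (MFAlg.inr b * MFAlg.inl a) =
        matrixMF.vec o a * matrixMF.vec o' b := by
    intro ι ι' _ _ _ _ o o' b a
    -- `K` lies in a face and sends the state vector to its image under `a` minus the component
    -- along itself. Hence `a - vec o a - K` is null, and `a` may be replaced by `vec o a + K` to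
    -- the right of `b`. The contribution of the face element `K` is proportional to `vec o K`,
    -- which is zero.
    let K : matrixMF ι := matrixMF.ket TwoFaces.white o fun i =>
      matrixMF.rep a i o - matrixMF.vec o a * (Pi.single o 1 : ι → ℂ) i
    have h := matrixMF.unitExt_mul_eq_zero (isRestrictedState_prod_vec hP o o')
      (H := MFAlg.inl) (fun x => (FreeProd.star_inl x).symm)
      (fun x => P.restriction_left _ _ x)
      (z := Unitization.inr a - algebraMap ℂ _ (matrixMF.vec o a) - Unitization.inr K) (fun i => by
        simp only [map_sub, matrixMF.unitRep_inr, AlgHom.commutes, Matrix.sub_apply, K,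
          matrixMF.rep_ket, Matrix.algebraMap_matrix_apply]
        by_cases hi : i = o
        · subst hi; simp
        · simp [hi]) (Unitization.inr (MFAlg.inr b))
    have hK : P.prod (matrixMF.vec o) (matrixMF.vec o') (MFAlg.inr b * MFAlg.inl K) = 0 := by
      rw [P.prod_inr_inl_of_face _ _ (matrixMF.ket_mem _ _ _)]
      rw [matrixMF.vec_apply, matrixMF.rep_ket, matrixMF.vec_apply]
      simp
    rw [map_sub, map_sub, unitMap_inr, unitMap_inr, AlgHom.commutes, mul_sub, mul_sub,
      ← Unitization.inr_mul, ← Unitization.inr_mul, ← Algebra.commutes, ← Algebra.smul_def,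
      map_sub, map_sub, map_smul, unitExt_inr, unitExt_inr, unitExt_inr, hK,
      P.restriction_right, sub_zero, sub_eq_zero] at h
    exact h
  -- Both sides are natural in each factor; the matrix model is removed first from the left factor
  -- and then from the right one.
  have model' : ∀ {ι' : Type u} [Fintype ι'] [DecidableEq ι'] (o' : ι') (b : matrixMF ι')
      {A : MFAlg.{u} TwoFaces} (φ : A.Functional) (a : A),
      P.prod φ (matrixMF.vec o') (MFAlg.inr b * MFAlg.inl a) = φ a * matrixMF.vec o' b := by
    intro ι' _ _ o' b A φ a
    have := natural_eq_zero_of_model' (fun A φ => P.prod φ (matrixMF.vec o') ∘ₗ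
      LinearMap.mulLeft ℂ (MFAlg.inr b) ∘ₗ
      ((MFAlg.inl : A →ₙₐ[ℂ] A.coprod (matrixMF ι')) : A →ₗ[ℂ] A.coprod (matrixMF ι')) - matrixMF.vec o' b • φ)
      (fun {A B} φ h hh x => by
        refine congrArg₂ (· - ·) ((P.prod_comp_left φ (matrixMF.vec o') h hh _).trans
          (congrArg (P.prod φ _) ?_)) rfl
        simp)
      (fun ι _ _ o => LinearMap.ext fun a => by
        refine sub_eq_zero.2 ((model o o' b a).trans (mul_comm _ _))) A φ
    refine (sub_eq_zero.1 (LinearMap.congr_fun this a)).trans (mul_comm _ _)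
  have := natural_eq_zero_of_model' (fun B ψ => P.prod φ ψ ∘ₗ
      LinearMap.mulRight ℂ (MFAlg.inl a) ∘ₗ
      ((MFAlg.inr : B →ₙₐ[ℂ] A.coprod B) : B →ₗ[ℂ] A.coprod B) - φ a • ψ)
      (fun {B B'} ψ h hh x => by
        refine congrArg₂ (· - ·) ((P.prod_comp_right φ ψ h hh _).trans
          (congrArg (P.prod φ _) ?_)) rfl
        simp)
      (fun ι _ _ o => LinearMap.ext fun b => by
        exact sub_eq_zero.2 (model' o b φ a)) B ψ
  exact sub_eq_zero.1 (LinearMap.congr_fun this b)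

end UniversalProduct

/-! ## Adjoining units -/

namespace MFAlg

variable {F : Type} {A : MFAlg.{u} F} {S : Set A}

theorem subset_idealSpan : S ⊆ A.idealSpan S := fun _ hx =>
  Submodule.mem_sInf.2 fun _ hI => hI.1 hx

theorem mul_mem_idealSpan_left {x : A} (hx : x ∈ A.idealSpan S) (a : A) :
    a * x ∈ A.idealSpan S :=
  Submodule.mem_sInf.2 fun I hI => (hI.2 x (Submodule.mem_sInf.1 hx I hI) a).1

theorem mul_mem_idealSpan_right {x : A} (hx : x ∈ A.idealSpan S) (a : A) :
    x * a ∈ A.idealSpan S :=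
  Submodule.mem_sInf.2 fun I hI => (hI.2 x (Submodule.mem_sInf.1 hx I hI) a).2

theorem idealSpan_le {I : Submodule ℂ A} (h : S ⊆ I) (hI : ∀ x ∈ I, ∀ a : A, a * x ∈ I ∧ x * a ∈ I) :
    A.idealSpan S ≤ I := sInf_le ⟨h, hI⟩

/-- Modulo the ideal which is generated by the differences of the units of the faces, all of them
are units. -/
theorem IsFaceUnits.sub_mem {e : F → A} (he : A.IsFaceUnits e) (f : F) (a : A) :
    a - e f * a ∈ A.idealSpan {x | ∃ f g, x = e f - e g} ∧
      a - a * e f ∈ A.idealSpan {x | ∃ f g, x = e f - e g} := by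
  induction a using MFAlg.face_induction with
  | face g a ha =>
    obtain ⟨h₁, h₂⟩ := (he g).2 a ha
    have h : e g - e f ∈ A.idealSpan {x | ∃ f g, x = e f - e g} := subset_idealSpan ⟨g, f, rfl⟩
    constructor
    · have := mul_mem_idealSpan_right h a
      rwa [sub_mul, h₁] at this
    · have := mul_mem_idealSpan_left h a
      rwa [mul_sub, h₂] at this
  | zero => simp
  | add x y hx hy =>
    exact ⟨by rw [mul_add, add_sub_add_comm]; exact add_mem hx.1 hy.1,
      by rw [add_mul, add_sub_add_comm]; exact add_mem hx.2 hy.2⟩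
  | mul x y hx hy =>
    exact ⟨by rw [← mul_assoc, ← sub_mul]; exact mul_mem_idealSpan_right hx.1 y,
      by rw [mul_assoc, ← mul_sub]; exact mul_mem_idealSpan_left hy.2 x⟩
  | smul c x hx =>
    exact ⟨by rw [mul_smul_comm, ← smul_sub]; exact Submodule.smul_mem _ c hx.1,
      by rw [smul_mul_assoc, ← smul_sub]; exact Submodule.smul_mem _ c hx.2⟩

end MFAlg

namespace scalarMF

theorem induction {p : scalarMF.{u} → Prop} (unit : ∀ f, p (unit f))
    (zero : p 0) (add : ∀ x y, p x → p y → p (x + y)) (mul : ∀ x y, p x → p y → p (x * y))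
    (smul : ∀ (c : ℂ) x, p x → p (c • x)) (x : scalarMF.{u}) : p x := by
  refine matrixMF.induction (fun f m => ?_) zero add mul smul x
  rw [emb_eq]
  exact smul _ _ (unit f)

variable {C : Type*} [NonUnitalRing C] [Module ℂ C]

theorem hom_ext {h k : scalarMF.{u} →ₙₐ[ℂ] C} (H : ∀ f, h (unit f) = k (unit f)) : h = k := by
  ext x
  induction x using scalarMF.induction with
  | unit f => exact H f
  | zero => rw [map_zero, map_zero]
  | add x y h₁ h₂ => rw [map_add, map_add, h₁, h₂]
  | mul x y h₁ h₂ => rw [map_mul, map_mul, h₁, h₂]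
  | smul c x h₁ => rw [map_smul, map_smul, h₁]

variable [IsScalarTower ℂ C C] [SMulCommClass ℂ C C]

/-- The homomorphism which is given by idempotents. -/
noncomputable def lift (e : TwoFaces → C) (he : ∀ f, e f * e f = e f) : scalarMF.{u} →ₙₐ[ℂ] C :=
  let g : TwoFaces → (Matrix PUnit PUnit ℂ →ₙₐ[ℂ] C) := fun f =>
    { toFun := fun m => m PUnit.unit PUnit.unit • e f
      map_smul' := fun c m => by simp [mul_smul]
      map_zero' := by simp
      map_add' := fun m n => by simp [add_smul]
      map_mul' := fun m n => by
        simp [Matrix.mul_apply, smul_mul_smul_comm, he] }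
  (FreeProd.lift (g TwoFaces.white) (g TwoFaces.black) :
    FreeProd (Matrix PUnit PUnit ℂ) (Matrix PUnit PUnit ℂ) →ₙₐ[ℂ] C)

@[simp] theorem lift_unit (e : TwoFaces → C) (he : ∀ f, e f * e f = e f) (f : TwoFaces) :
    lift.{u} e he (unit f) = e f := by
  cases f
  · exact (FreeProd.lift_inl _ _ _).trans (by simp)
  · exact (FreeProd.lift_inr _ _ _).trans (by simp)

theorem isFaced_lift {A : MFAlg.{u} TwoFaces} {e : TwoFaces → A} (he : ∀ f, e f * e f = e f)
    (he' : ∀ f, e f ∈ A.face f) : MFAlg.IsFaced (lift.{u} e he) := by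
  intro f a ha
  obtain ⟨m, rfl⟩ := matrixMF.mem_face.1 ha
  rw [emb_eq, map_smul, lift_unit]
  exact SMulMemClass.smul_mem _ (he' f)

end scalarMF

/-- The homomorphism on the free product of `scalarMF` and `A` which maps the units of the faces of
`scalarMF` to a unit adjoined to `A`. -/
noncomputable def unitize (A : MFAlg.{u} TwoFaces) : scalarMF.coprod A →ₙₐ[ℂ] Unitization ℂ A :=
  MFAlg.lift (scalarMF.lift (fun _ => 1) fun _ => mul_one 1) (Unitization.inrNonUnitalAlgHom ℂ A)

@[simp] theorem unitize_unit (A : MFAlg.{u} TwoFaces) (f : TwoFaces) :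
    unitize A (MFAlg.inl (scalarMF.unit f)) = 1 := by
  simp [unitize]

@[simp] theorem unitize_inr (A : MFAlg.{u} TwoFaces) (a : A) :
    unitize A (MFAlg.inr a) = Unitization.inr a := by
  simp [unitize]

theorem scalarMF.coprod_hom_ext {A : MFAlg.{u} TwoFaces} {C : Type*} [NonUnitalRing C] [Module ℂ C]
    {h k : scalarMF.coprod A →ₙₐ[ℂ] C}
    (hl : ∀ f, h (MFAlg.inl (scalarMF.unit f)) = k (MFAlg.inl (scalarMF.unit f)))
    (hr : ∀ a : A, h (MFAlg.inr a) = k (MFAlg.inr a)) : h = k := by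
  refine MFAlg.coprod_hom_ext (fun x => ?_) hr
  exact DFunLike.congr_fun (scalarMF.hom_ext (h := h.comp MFAlg.inl) (k := k.comp MFAlg.inl) hl) x

theorem scalarMF.coprod_induction {A : MFAlg.{u} TwoFaces} {p : scalarMF.coprod A → Prop}
    (unit : ∀ f, p (MFAlg.inl (scalarMF.unit f))) (hr : ∀ a : A, p (MFAlg.inr a)) (zero : p 0)
    (add : ∀ x y, p x → p y → p (x + y)) (mul : ∀ x y, p x → p y → p (x * y))
    (smul : ∀ (c : ℂ) x, p x → p (c • x)) (x : scalarMF.coprod A) : p x := by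
  induction x using MFAlg.coprod_induction with
  | hl a =>
    induction a using scalarMF.induction with
    | unit f => exact unit f
    | zero => rw [map_zero]; exact zero
    | add x y h₁ h₂ => rw [map_add]; exact add _ _ h₁ h₂
    | mul x y h₁ h₂ => rw [map_mul]; exact mul _ _ h₁ h₂
    | smul c x h => rw [map_smul]; exact smul _ _ h
  | hr b => exact hr b
  | zero => exact zero
  | add x y h₁ h₂ => exact add _ _ h₁ h₂
  | mul x y h₁ h₂ => exact mul _ _ h₁ h₂
  | smul c x h => exact smul _ _ h

/-! ### Absorption of units and unit preservation -/

namespace UniversalProduct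

variable {P : UniversalProduct.{u} TwoFaces}

/-- The units of `scalarMF` act as units in products with its character. -/
def AbsorbsUnits (P : UniversalProduct.{u} TwoFaces) : Prop :=
  ∀ (A : MFAlg.{u} TwoFaces) (φ : A.Functional) (x : scalarMF.coprod A),
    P.prod scalarMF.char φ x = unitExt φ (unitize A x)

theorem absorbsUnits_of_model
    (H : ∀ (ι : Type u) [Fintype ι] [DecidableEq ι] (o : ι) (x : scalarMF.coprod (matrixMF ι)),
      P.prod scalarMF.char (matrixMF.vec o) x = matrixMF.unitRep (unitize _ x) o o) :
    P.AbsorbsUnits := by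
  intro A φ x
  have := natural_eq_zero_of_model (A₀ := scalarMF.{u}) (fun A φ => P.prod scalarMF.char φ -
    unitExt φ ∘ₗ (unitize A : scalarMF.coprod A →ₗ[ℂ] Unitization ℂ A)) ?_ ?_ A φ
  · exact sub_eq_zero.1 (LinearMap.congr_fun this x)
  · intro A B φ h hh x
    refine congrArg₂ (· - ·) (P.prod_comp_right scalarMF.char φ h hh x) ?_
    change unitExt _ (unitize B x) = unitExt φ (unitize A _)
    rw [← unitExt_unitMap]
    congr 1
    have : (unitMap h).toNonUnitalAlgHom.comp (unitize B) =
        (unitize A).comp (MFAlg.coprodMap (NonUnitalAlgHom.id ℂ _) h) :=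
      scalarMF.coprod_hom_ext (fun f => by
          change unitMap h (unitize B _) = unitize A _
          simp) fun b => by
        change unitMap h (unitize B _) = unitize A _
        simp
    exact DFunLike.congr_fun this x
  · intro ι _ _ o
    refine LinearMap.ext fun x => sub_eq_zero.2 ?_
    exact (H ι o x).trans (matrixMF.unitExt_vec o _).symm

theorem _root_.matrixMF.isFaceUnits {ι : Type u} [Fintype ι] [DecidableEq ι] :
    (matrixMF ι).IsFaceUnits fun f => matrixMF.emb f 1 := by
  refine fun f => ⟨matrixMF.emb_mem f 1, fun a ha => ?_⟩
  obtain ⟨m, rfl⟩ := matrixMF.mem_face.1 ha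
  rw [← map_mul, ← map_mul, one_mul, mul_one]
  exact ⟨rfl, rfl⟩

/-- The representation sends the units of both faces to the unit matrix, so its kernel contains the
ideal. -/
theorem _root_.matrixMF.vec_eq_zero {ι : Type u} [Fintype ι] [DecidableEq ι] (o : ι) :
    ∀ x ∈ (matrixMF ι).idealSpan {x | ∃ f g, x = matrixMF.emb f 1 - matrixMF.emb g 1},
      matrixMF.vec o x = 0 := by
  intro x hx
  have h : x ∈ LinearMap.ker
      ((matrixMF.rep : matrixMF ι →ₙₐ[ℂ] Matrix ι ι ℂ) : matrixMF ι →ₗ[ℂ] Matrix ι ι ℂ) := by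
    refine MFAlg.idealSpan_le ?_ ?_ hx
    · rintro _ ⟨f, g, rfl⟩
      change matrixMF.rep _ = 0
      simp
    · intro x hx a
      change matrixMF.rep x = 0 at hx
      constructor
      · change matrixMF.rep _ = 0
        rw [map_mul, hx, mul_zero]
      · change matrixMF.rep _ = 0
        rw [map_mul, hx, zero_mul]
  change matrixMF.rep x = 0 at h
  rw [matrixMF.vec_apply, h]
  rfl

/-- Modulo the ideal of the differences of units, the units of `scalarMF` turn into units of the
matrix faces. Every `x` is thus congruent to an element of the matrix model, where the product is
the vector state and units act as the identity. -/
theorem UnitPreserving.absorbsUnits (hU : P.UnitPreserving) : P.AbsorbsUnits := by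
  refine absorbsUnits_of_model fun ι _ _ o x => ?_
  have hv : ∀ {κ : Type u} [Fintype κ] [DecidableEq κ] (p : κ) (f : TwoFaces),
      matrixMF.vec p (matrixMF.emb f 1) = 1 := fun p f => by
    rw [matrixMF.vec_apply, matrixMF.rep_emb, Matrix.one_apply_eq]
  obtain ⟨h, -, -⟩ := hU scalarMF (matrixMF ι) (fun f => matrixMF.emb f 1)
    (fun f => matrixMF.emb f 1) matrixMF.isFaceUnits matrixMF.isFaceUnits scalarMF.char
    (matrixMF.vec o) (matrixMF.vec_eq_zero _) (matrixMF.vec_eq_zero _) (hv _) (hv _)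
  set J := (scalarMF.coprod (matrixMF ι)).idealSpan
          {x | ∃ u ∈ Set.range (MFAlg.inl ∘ fun f => matrixMF.emb f 1) ∪
            Set.range (MFAlg.inr ∘ fun f => matrixMF.emb f 1),
            ∃ w ∈ Set.range (MFAlg.inl ∘ fun f => matrixMF.emb f 1) ∪
            Set.range (MFAlg.inr ∘ fun f => matrixMF.emb f 1), x = u - w} with hJ
  let r : scalarMF.coprod (matrixMF ι) →ₙₐ[ℂ] matrixMF ι :=
    MFAlg.lift (scalarMF.lift (fun f => matrixMF.emb f 1) fun f => by rw [← map_mul, one_mul])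
      (NonUnitalAlgHom.id ℂ _)
  have hr : ∀ x, x - MFAlg.inr (r x) ∈ J := by
    intro x
    induction x using scalarMF.coprod_induction with
    | unit f =>
      refine MFAlg.subset_idealSpan ⟨_, Or.inl ⟨f, rfl⟩, _, Or.inr ⟨f, rfl⟩, ?_⟩
      simp only [Function.comp_apply, r, MFAlg.lift_inl, scalarMF.lift_unit]
      rfl
    | hr a => simp [r]
    | zero => simp
    | add x y h₁ h₂ =>
      rw [map_add, map_add, add_sub_add_comm]
      exact add_mem h₁ h₂
    | mul x y h₁ h₂ =>
      have : x * y - MFAlg.inr (r (x * y)) = (x - MFAlg.inr (r x)) * y +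
          MFAlg.inr (r x) * (y - MFAlg.inr (r y)) := by
        rw [map_mul, map_mul, sub_mul, mul_sub, sub_add_sub_cancel]
      rw [this]
      exact add_mem (MFAlg.mul_mem_idealSpan_right h₁ y) (MFAlg.mul_mem_idealSpan_left h₂ _)
    | smul c x h₁ =>
      rw [map_smul, map_smul, ← smul_sub]
      exact Submodule.smul_mem _ c h₁
  have h1 := h _ (hr x)
  rw [map_sub, P.restriction_right, sub_eq_zero] at h1
  rw [h1, matrixMF.vec_apply]
  have : matrixMF.rep.comp r = (matrixMF.unitRep (ι := ι)).toNonUnitalAlgHom.comp (unitize _) :=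
    scalarMF.coprod_hom_ext (fun f => by
        change matrixMF.rep (r _) = matrixMF.unitRep (unitize _ _)
        simp [r]) fun a => by
      change matrixMF.rep (r _) = matrixMF.unitRep (unitize _ _)
      simp [r]
  exact congrFun (congrFun (DFunLike.congr_fun this x) o) o

/-- Absorption speaks of an adjoined unit. A functional which does not distinguish the units of the
faces from each other does not distinguish them from the adjoined unit either, so the units of
`scalarMF` can be sent to those of `A`. -/
theorem AbsorbsUnits.prod_unital (hU : P.AbsorbsUnits) {A : MFAlg.{u} TwoFaces} {e : TwoFaces → A}
    (he : A.IsFaceUnits e) (φ : A.Functional)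
    (h0 : ∀ x ∈ A.idealSpan {x | ∃ f g, x = e f - e g}, φ x = 0) (h1 : ∀ f, φ (e f) = 1)
    (x : scalarMF.coprod A) :
    P.prod scalarMF.char φ x =
      φ (MFAlg.lift (scalarMF.lift e fun f => ((he f).2 _ (he f).1).1) (NonUnitalAlgHom.id ℂ A) x) := by
  set r : scalarMF.coprod A →ₙₐ[ℂ] A :=
    MFAlg.lift (scalarMF.lift e fun f => ((he f).2 _ (he f).1).1) (NonUnitalAlgHom.id ℂ A)
  set J := A.idealSpan {x | ∃ f g, x = e f - e g}
  -- After expansion, only elements of the ideal and a multiple of `1 - φ (e f) = 0` remain.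
  have key : ∀ f (X Y : Unitization ℂ A), unitExt φ (X * (1 - Unitization.inr (e f)) * Y) = 0 := by
    intro f X Y
    induction X with
    | inl_add_inr c a =>
      induction Y with
      | inl_add_inr d b =>
        have hX : (Unitization.inl c + Unitization.inr a : Unitization ℂ A) *
            (1 - Unitization.inr (e f)) * (Unitization.inl d + Unitization.inr b) =
            (c * d) • (1 - Unitization.inr (e f)) + Unitization.inr (d • (a - a * e f) +
              c • (b - e f * b) + (a - a * e f) * b) := by
          have e1 : (Unitization.inl c : Unitization ℂ A) = c • 1 :=
            (Algebra.algebraMap_eq_smul_one c)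
          have e2 : (Unitization.inl d : Unitization ℂ A) = d • 1 :=
            (Algebra.algebraMap_eq_smul_one d)
          simp only [e1, e2, Unitization.inr_add, Unitization.inr_smul, Unitization.inr_sub,
            Unitization.inr_mul, add_mul, mul_add, mul_sub, sub_mul, smul_mul_assoc, mul_smul_comm,
            one_mul, mul_one]
          module
        have hJ : d • (a - a * e f) + c • (b - e f * b) + (a - a * e f) * b ∈ J :=
          add_mem (add_mem (Submodule.smul_mem _ d (he.sub_mem f a).2)
            (Submodule.smul_mem _ c (he.sub_mem f b).1))
            (MFAlg.mul_mem_idealSpan_right (he.sub_mem f a).2 b)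
        rw [hX, map_add, unitExt_inr, h0 _ hJ, map_smul, map_sub, unitExt_one, unitExt_inr, h1]
        simp
  -- The outer elements `X` and `Y` make the statement pass to products, where the difference of the
  -- two homomorphisms telescopes.
  have main : ∀ x : scalarMF.coprod A, ∀ X Y : Unitization ℂ A,
      unitExt φ (X * (unitize A x - Unitization.inr (r x)) * Y) = 0 := by
    intro x
    induction x using scalarMF.coprod_induction with
    | unit f =>
      intro X Y
      have hr : r (MFAlg.inl (scalarMF.unit f)) = e f := by simp [r]
      rw [unitize_unit, hr]
      exact key f X Y
    | hr a => intro X Y; simp [r]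
    | zero => intro X Y; simp
    | add x y hx hy =>
      intro X Y
      have : X * (unitize A (x + y) - Unitization.inr (r (x + y))) * Y =
          X * (unitize A x - Unitization.inr (r x)) * Y +
          X * (unitize A y - Unitization.inr (r y)) * Y := by
        rw [map_add, map_add, Unitization.inr_add]; noncomm_ring
      rw [this, map_add, hx, hy, add_zero]
    | mul x y hx hy =>
      intro X Y
      have : X * (unitize A (x * y) - Unitization.inr (r (x * y))) * Y =
          X * (unitize A x - Unitization.inr (r x)) * (unitize A y * Y) +
          (X * Unitization.inr (r x)) * (unitize A y - Unitization.inr (r y)) * Y := by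
        rw [map_mul, map_mul, Unitization.inr_mul]; noncomm_ring
      rw [this, map_add, hx, hy, add_zero]
    | smul c x hx =>
      intro X Y
      have : X * (unitize A (c • x) - Unitization.inr (r (c • x))) * Y =
          c • (X * (unitize A x - Unitization.inr (r x)) * Y) := by
        rw [map_smul, map_smul, Unitization.inr_smul, ← smul_sub, mul_smul_comm, smul_mul_assoc]
      rw [this, map_smul, hx, smul_zero]
  have h2 := main x 1 1
  rw [one_mul, mul_one, map_sub, unitExt_inr, sub_eq_zero] at h2
  rw [hU, h2]

/-- The units of the faces of the first factor act as units. -/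
theorem AbsorbsUnits.prod_mul_inl_mul (hU : P.AbsorbsUnits) {A B : MFAlg.{u} TwoFaces}
    {e : TwoFaces → A} (he : A.IsFaceUnits e) (φ : A.Functional) (ψ : B.Functional)
    (h0 : ∀ x ∈ A.idealSpan {x | ∃ f g, x = e f - e g}, φ x = 0) (h1 : ∀ f, φ (e f) = 1)
    (f : TwoFaces) (X Y : Unitization ℂ (A.coprod B)) :
    unitExt (P.prod φ ψ) (X * Unitization.inr (MFAlg.inl (e f)) * Y) =
      unitExt (P.prod φ ψ) (X * Y) := by
  let r : scalarMF.coprod A →ₙₐ[ℂ] A :=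
    MFAlg.lift (scalarMF.lift e fun f => ((he f).2 _ (he f).1).1) (NonUnitalAlgHom.id ℂ A)
  have hr : MFAlg.IsFaced r :=
    MFAlg.isFaced_lift (scalarMF.isFaced_lift _ fun f => (he f).1) (MFAlg.isFaced_id A)
  -- The unit is lifted to an additional factor `scalarMF`. The map `G` merges this factor into the
  -- units of `A`; the map `H` reassociates and reads it as a unit adjoined to the free product of
  -- `A` and `B`. By associativity and absorption both give the same value, and `j` embeds the outer
  -- elements compatibly with both.
  let G : (scalarMF.coprod A).coprod B →ₙₐ[ℂ] A.coprod B :=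
    MFAlg.coprodMap r (NonUnitalAlgHom.id ℂ B)
  let H : (scalarMF.coprod A).coprod B →ₙₐ[ℂ] Unitization ℂ (A.coprod B) :=
    (unitize (A.coprod B)).comp (MFAlg.coprodAssoc scalarMF A B)
  let j : A.coprod B →ₙₐ[ℂ] (scalarMF.coprod A).coprod B :=
    MFAlg.coprodMap MFAlg.inr (NonUnitalAlgHom.id ℂ B)
  have key : ∀ z, P.prod φ ψ (G z) = unitExt (P.prod φ ψ) (H z) := by
    intro z
    rw [← P.prod_comp hr (MFAlg.isFaced_id B) (fun x => hU.prod_unital he φ h0 h1 x)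
      (fun _ => rfl), P.associativity, hU]
    rfl
  have key' : ∀ z, unitExt (P.prod φ ψ) (unitMap G z) =
      unitExt (P.prod φ ψ) (Unitization.lift H z) := by
    intro z
    rw [unitMap_apply, unitExt_lift, map_add, unitExt_algebraMap, unitExt_inr, key]
  have hG : ∀ X, unitMap G (unitMap j X) = X := by
    intro X
    have h : G.comp j = NonUnitalAlgHom.id ℂ _ :=
      MFAlg.coprod_hom_ext (fun a => by simp [G, j, r]) fun b => by simp [G, j]
    have : (unitMap G).comp (unitMap j) = AlgHom.id ℂ _ := Unitization.algHom_ext'' fun a => by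
      change unitMap G (unitMap j _) = _
      rw [unitMap_inr, unitMap_inr]
      exact congrArg _ (DFunLike.congr_fun h a)
    exact DFunLike.congr_fun this X
  have hH : ∀ X, Unitization.lift H (unitMap j X) = X := by
    intro X
    have h : H.comp j = Unitization.inrNonUnitalAlgHom ℂ _ :=
      MFAlg.coprod_hom_ext (fun a => by simp [H, j, MFAlg.coprodAssoc_inl_inr])
        fun b => by simp [H, j, MFAlg.coprodAssoc_inr]
    have : (Unitization.lift H).comp (unitMap j) = AlgHom.id ℂ _ :=
      Unitization.algHom_ext'' fun a => by
        change Unitization.lift H (unitMap j _) = _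
        rw [unitMap_inr]
        exact (by simp : Unitization.lift H (Unitization.inr (j a)) = H (j a)).trans
          (DFunLike.congr_fun h a)
    exact DFunLike.congr_fun this X
  have hGu : unitMap G (Unitization.inr (MFAlg.inl (MFAlg.inl (scalarMF.unit f)))) =
      Unitization.inr (MFAlg.inl (e f)) := by
    rw [unitMap_inr]; simp [G, r]
  have hHu : Unitization.lift H (Unitization.inr (MFAlg.inl (MFAlg.inl (scalarMF.unit f)))) = 1 := by
    simp [H, MFAlg.coprodAssoc_inl_inl]
  have h := key' (unitMap j X * Unitization.inr (MFAlg.inl (MFAlg.inl (scalarMF.unit f))) *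
    unitMap j Y)
  rwa [map_mul (unitMap G), map_mul (unitMap G), map_mul (Unitization.lift H),
    map_mul (Unitization.lift H), hG, hG, hH, hH, hGu, hHu, mul_one] at h

/-- If the units of `scalarMF` are absorbed, then the universal product is unit preserving. -/
theorem AbsorbsUnits.unitPreserving (hU : P.AbsorbsUnits) (hS : P.IsSymmetric) :
    P.UnitPreserving := by
  intro A B e₁ e₂ he₁ he₂ φ ψ h₁ h₂ h₁' h₂'
  refine ⟨?_, fun f => by rw [P.restriction_left, h₁'], fun f => by rw [P.restriction_right, h₂']⟩
  set Φ := P.prod φ ψ with hΦ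
  have hl : ∀ f (X Y : Unitization ℂ (A.coprod B)),
      unitExt Φ (X * Unitization.inr (MFAlg.inl (e₁ f)) * Y) = unitExt Φ (X * Y) :=
    fun f X Y => hU.prod_mul_inl_mul he₁ φ ψ h₁ h₁' f X Y
  have hr : ∀ f (X Y : Unitization ℂ (A.coprod B)),
      unitExt Φ (X * Unitization.inr (MFAlg.inr (e₂ f)) * Y) = unitExt Φ (X * Y) := by
    intro f X Y
    -- Symmetry moves the second factor to the first place, where absorption applies.
    have h : ∀ z, unitExt Φ z = unitExt (P.prod ψ φ) (unitMap (MFAlg.coprodSwap A B) z) := by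
      intro z
      rw [unitExt_unitMap]
      exact congrArg (fun χ => unitExt χ z) (LinearMap.ext fun x => hS φ ψ x)
    rw [h, h, map_mul (unitMap _), map_mul (unitMap _), map_mul (unitMap _), unitMap_inr, MFAlg.coprodSwap_inr]
    exact hU.prod_mul_inl_mul he₂ ψ φ h₂ h₂' f _ _
  -- Vanishing between arbitrary elements of the unitization defines a two-sided ideal; it contains
  -- the differences of units because each unit may be omitted.
  let I : Submodule ℂ (A.coprod B) :=
    { carrier := {x | ∀ X Y : Unitization ℂ (A.coprod B), unitExt Φ (X * Unitization.inr x * Y) = 0}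
      add_mem' := fun {x y} hx hy X Y => by
        rw [Unitization.inr_add, mul_add, add_mul, map_add, hx, hy, add_zero]
      zero_mem' := fun X Y => by simp
      smul_mem' := fun c x hx X Y => by
        rw [Unitization.inr_smul, mul_smul_comm, smul_mul_assoc, map_smul, hx, smul_zero] }
  intro x hx
  have hI : x ∈ I := by
    refine MFAlg.idealSpan_le ?_ ?_ hx
    · have key : ∀ u ∈ Set.range (MFAlg.inl ∘ e₁) ∪ Set.range (MFAlg.inr ∘ e₂),
          ∀ X Y : Unitization ℂ (A.coprod B), unitExt Φ (X * Unitization.inr u * Y) =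
            unitExt Φ (X * Y) := by
        rintro _ (⟨f, rfl⟩ | ⟨f, rfl⟩) X Y
        · exact hl f X Y
        · exact hr f X Y
      rintro _ ⟨u, hu, w, hw, rfl⟩ X Y
      rw [Unitization.inr_sub, mul_sub, sub_mul, map_sub, key u hu, key w hw, sub_self]
    · intro x hx a
      constructor
      · intro X Y
        rw [Unitization.inr_mul, ← mul_assoc]
        exact hx _ _
      · intro X Y
        rw [Unitization.inr_mul, ← mul_assoc, mul_assoc]
        exact hx _ _
  have := hI 1 1
  rwa [one_mul, mul_one, unitExt_inr] at this

end UniversalProduct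

/-! ## The coefficient of a leg between the legs of a block -/

namespace UniversalProduct

variable {P : UniversalProduct.{u} TwoFaces}

/-- A product with one factor is the functional itself, so this is the case `k = 0` of the
multilinearity of word values. -/
theorem lawMultilinear_apply (P : UniversalProduct.{u} TwoFaces) {L : Type} (f : L → TwoFaces)
    {w : List L} (hw : w.Nodup) (hw' : ∀ ℓ, ℓ ∈ w) (h0 : w ≠ []) :
    LawMultilinear.{u} f fun μ => μ w := by
  have h := P.lawMultilinear_wordValue (k := 0) (fun ℓ => ((0 : Fin 1), f ℓ)) hw hw'
  have : P.wordValue (k := 0) (fun ℓ => ((0 : Fin 1), f ℓ)) w = fun μ => μ w := by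
    funext μ
    rw [wordValue, EvalFamily.ofLaw, P.iterFamily_ev_subst (k := 0) (fun ℓ => ((0 : Fin 1), f ℓ))]
    exact freeMF.functional_word μ h0
  rwa [this] at h

theorem exists_unit_coefficient (P : UniversalProduct.{u} TwoFaces) (f : TwoFaces) :
    ∃ c : ℂ, ∀ (A : MFAlg.{u} TwoFaces) (φ : A.Functional) (a a' : A), a ∈ A.face f →
      a' ∈ A.face f → (φ a = 0 ∨ φ a' = 0) → φ (a' * a) = 0 →
      P.prod scalarMF.char φ (MFAlg.inr a * MFAlg.inl (scalarMF.unit f) * MFAlg.inr a') =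
        c * φ (a * a') := by
  let E := EvalFamily.ofNatural scalarMF.{u} (fun A φ => P.prod scalarMF.char φ)
    fun {A B} φ h hh x => P.prod_comp_right scalarMF.char φ h hh x
  let q : List (scalarMF.{u} ⊕ Unit × Bool) :=
    [Sum.inr ((), false), Sum.inl (scalarMF.unit f), Sum.inr ((), true)]
  have hq : EvalFamily.Once q := by
    intro ℓ
    cases ℓ
    · exact ⟨[], [Sum.inl (scalarMF.unit f), Sum.inr ((), true)], (), rfl, fun i => by simp⟩
    · exact ⟨[Sum.inr ((), false), Sum.inl (scalarMF.unit f)], [], (), rfl, fun i => by simp⟩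
  let e₀ : Bool → List Bool := fun _ => [false, true]
  let D := E.ofLaw (fun _ => f) q
  refine ⟨D (indicatorLaw e₀), fun A φ a a' ha ha' h h' => ?_⟩
  have hD := (E.lawMultilinear_ofLaw (fun _ => f) hq).sub
    ((P.lawMultilinear_apply (fun _ : Bool => f) (w := [false, true]) (by simp) (by simp)
      (by simp)).const_mul (D (indicatorLaw e₀)))
  let b : Bool → A := fun i => if i then a' else a
  have h0 := hD.eq_zero (μ := jointLaw φ b) (map_zero φ) fun e he => by
    have h1 : e false = [false] ∨ e false = [false, true] ∨ e false = [true, false] := by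
      have hm := he.mem false
      have hn := he.nodup false
      rcases hl : e false with _ | ⟨x, _ | ⟨y, _ | ⟨z, l⟩⟩⟩
      · simp [hl] at hm
      · rw [hl] at hm; simp at hm; simp [← hm]
      · rw [hl] at hm hn
        cases x <;> cases y <;> simp_all
      · rw [hl] at hn
        cases x <;> cases y <;> cases z <;> simp_all
    rcases h1 with h1 | h1 | h1
    · have h2 : e true = [true] := by
        have hm := he.mem true
        have hn := he.nodup true
        have hne : false ∉ e true := fun hf => by
          have := he.eq_of_mem true false hf
          rw [← this, h1] at hm
          simp at hm
        rcases hl : e true with _ | ⟨x, _ | ⟨y, l⟩⟩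
        · simp [hl] at hm
        · rw [hl] at hm; simp at hm; simp [← hm]
        · rw [hl] at hn hne
          cases x <;> cases y <;> simp_all
      rcases h with h | h
      · exact Or.inr ⟨false, by rw [h1]; exact h⟩
      · exact Or.inr ⟨true, by rw [h2]; exact h⟩
    · have : e = e₀ := by
        funext i
        cases i
        · exact h1
        · exact (he.eq_of_mem false true (by simp [h1])).trans h1
      subst this
      have h3 : indicatorLaw e₀ [false, true] = 1 := if_pos ⟨true, rfl⟩
      left
      rw [h3, mul_one]
      exact sub_self _
    · exact Or.inr ⟨false, by rw [h1]; exact h'⟩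
  have h1 := E.ev_subst (f := fun _ => f) q φ (a := b) (by intro i; cases i <;> assumption)
  rw [sub_eq_zero] at h0
  rw [h0] at h1
  have h2 : MFAlg.inr a * MFAlg.inl (scalarMF.unit f) * MFAlg.inr a' =
      listProd [MFAlg.inr a, (MFAlg.inl (scalarMF.unit f) : scalarMF.coprod A), MFAlg.inr a'] := by
    simp [listProd, mul_assoc]
  rw [h2]
  exact h1

theorem unassoc_inl {A B C : MFAlg.{u} TwoFaces} (x : A) :
    unassoc A B C (MFAlg.inl x) = MFAlg.inl (MFAlg.inl x) := by simp [unassoc]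

theorem unassoc_inr_inl {A B C : MFAlg.{u} TwoFaces} (x : B) :
    unassoc A B C (MFAlg.inr (MFAlg.inl x)) = MFAlg.inl (MFAlg.inr x) := by simp [unassoc]

theorem unassoc_inr_inr {A B C : MFAlg.{u} TwoFaces} (x : C) :
    unassoc A B C (MFAlg.inr (MFAlg.inr x)) = MFAlg.inr x := by simp [unassoc]

/-- The coefficient of a leg between the two legs of a block is an idempotent. -/
theorem unit_coefficient_mul_self (hP : P.IsPositive) {f : TwoFaces} {c : ℂ}
    (hc : ∀ (A : MFAlg.{u} TwoFaces) (φ : A.Functional) (a a' : A), a ∈ A.face f →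
      a' ∈ A.face f → (φ a = 0 ∨ φ a' = 0) → φ (a' * a) = 0 →
      P.prod scalarMF.char φ (MFAlg.inr a * MFAlg.inl (scalarMF.unit f) * MFAlg.inr a') =
        c * φ (a * a')) : c * c = c := by
  -- Two matrix units `a` and `a'` are chosen such that `a * a'` is the projection onto the state
  -- vector and `a' * a` the complementary one. The rule for `c` then applies with moment `1`.
  let o : ULift.{u} Bool := ⟨true⟩
  let x : ULift.{u} Bool := ⟨false⟩
  have hox : o ≠ x := by simp [o, x]
  let a : matrixMF (ULift.{u} Bool) := matrixMF.emb f (Matrix.single o x 1)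
  let a' : matrixMF (ULift.{u} Bool) := matrixMF.emb f (Matrix.single x o 1)
  let φ := matrixMF.vec o
  have ha : a ∈ (matrixMF _).face f := matrixMF.emb_mem _ _
  have ha' : a' ∈ (matrixMF _).face f := matrixMF.emb_mem _ _
  have h1 : φ (a * a') = 1 := by simp [φ, a, a', matrixMF.vec_apply]
  have h2 : φ (a' * a) = 0 := by simp [φ, a, a', matrixMF.vec_apply, hox]
  have h3 : φ a' = 0 := by simp [φ, a', matrixMF.vec_apply, hox.symm]
  have h4 := hc _ φ a a' ha ha' (Or.inr h3) h2
  have hu := scalarMF.unit_mem.{u} f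
  -- Two neighbouring units from different copies of `scalarMF` are inserted. Absorbing one into
  -- `a`, which keeps it in the face, and applying the rule twice gives `c * c`. By associativity
  -- the two units also form one face element of a free product, of value `1`, whose insertion gives
  -- `c`.
  have h5 := hc _ (P.prod scalarMF.char φ) (MFAlg.inr a * MFAlg.inl (scalarMF.unit f))
    (MFAlg.inr a') (mul_mem (MFAlg.isFaced_inr f _ ha) (MFAlg.isFaced_inl f _ hu))
    (MFAlg.isFaced_inr f _ ha') (Or.inr (by rw [P.restriction_right, h3])) (by
      rw [← mul_assoc, ← map_mul, prod_inr_mul_inl hP, h2, mul_zero])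
  rw [h4, h1, mul_one, prod_assoc'] at h5
  have h6 : unassoc scalarMF scalarMF (matrixMF (ULift.{u} Bool))
      (MFAlg.inr (MFAlg.inr a * MFAlg.inl (scalarMF.unit f)) * MFAlg.inl (scalarMF.unit f) *
        MFAlg.inr (MFAlg.inr a')) =
      MFAlg.inr a * MFAlg.inl (MFAlg.inr (scalarMF.unit f) * MFAlg.inl (scalarMF.unit f)) *
        MFAlg.inr a' := by
    simp only [map_mul, unassoc_inl, unassoc_inr_inl, unassoc_inr_inr, mul_assoc]
  rw [h6, P.prod_inr_inl_inr _ _ (mul_mem (MFAlg.isFaced_inr f _ hu) (MFAlg.isFaced_inl f _ hu)),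
    prod_inr_mul_inl hP, scalarMF.char_unit, one_mul, one_mul, h4, h1, mul_one] at h5
  exact h5.symm

/-- The left ideal of the null vectors of a functional. -/
noncomputable def nullSpace {C : Type u} [NonUnitalRing C] [Module ℂ C] [IsScalarTower ℂ C C]
    [SMulCommClass ℂ C C] (Φ : C →ₗ[ℂ] ℂ) : Submodule ℂ (Unitization ℂ C) where
  carrier := {z | ∀ y, unitExt Φ (y * z) = 0}
  add_mem' := fun {x z} hx hz y => by rw [mul_add, map_add, hx, hz, add_zero]
  zero_mem' := fun y => by simp
  smul_mem' := fun c x hx y => by rw [mul_smul_comm, map_smul, hx, smul_zero]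

theorem mul_mem_nullSpace {C : Type u} [NonUnitalRing C] [Module ℂ C] [IsScalarTower ℂ C C]
    [SMulCommClass ℂ C C] {Φ : C →ₗ[ℂ] ℂ} {z : Unitization ℂ C} (hz : z ∈ nullSpace Φ)
    (y : Unitization ℂ C) : y * z ∈ nullSpace Φ := fun x => by
  rw [← mul_assoc]; exact hz _

/-- If a unit of `scalarMF` between two elements of the same colour can be omitted, then the units
of `scalarMF` are absorbed. -/
theorem absorbsUnits_of_unit_coefficient (hP : P.IsPositive)
    (hc : ∀ (f : TwoFaces) (A : MFAlg.{u} TwoFaces) (φ : A.Functional) (a a' : A), a ∈ A.face f →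
      a' ∈ A.face f → (φ a = 0 ∨ φ a' = 0) → φ (a' * a) = 0 →
      P.prod scalarMF.char φ (MFAlg.inr a * MFAlg.inl (scalarMF.unit f) * MFAlg.inr a') =
        φ (a * a')) : P.AbsorbsUnits := by
  refine absorbsUnits_of_model fun ι _ _ o x => ?_
  set Φ := P.prod scalarMF.char (matrixMF.vec o) with hΦ
  have hst : IsRestrictedState Φ := isRestrictedState_prod_vec hP _ o
  set N := nullSpace Φ with hN
  let I : matrixMF ι →ₙₐ[ℂ] scalarMF.coprod (matrixMF ι) := MFAlg.inr
  let p : TwoFaces → scalarMF.coprod (matrixMF ι) := fun f => MFAlg.inl (scalarMF.unit f)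
  have hnull : ∀ z : Unitization ℂ (matrixMF ι), (∀ i, matrixMF.unitRep z i o = 0) →
      unitMap I z ∈ N := fun z hz => matrixMF.unitExt_mul_eq_zero hst
    (fun x => (FreeProd.star_inr x).symm) (fun x => P.restriction_right _ _ x) hz
  -- The character is the vector state on `1 × 1` matrices, whose vector is fixed by the units.
  have hunit : ∀ f, (Unitization.inr (p f) - 1 : Unitization ℂ _) ∈ N := by
    intro f
    have := matrixMF.unitExt_mul_eq_zero hst (H := MFAlg.inl) (o := PUnit.unit)
      (fun x => (FreeProd.star_inl x).symm) (fun x => P.restriction_left _ _ x)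
      (z := Unitization.inr (scalarMF.unit f) - 1) fun i => by
        simp [scalarMF.unit]
    rwa [map_sub, unitMap_inr, map_one] at this
  -- The norm of `K - p f * K` is the value of `star K * K` minus that of `star K * p f * K`, and
  -- the hypothesis identifies the two. The condition `v o = 0` supplies its moment assumptions.
  have hket : ∀ (f : TwoFaces) (v : ι → ℂ), v o = 0 →
      (Unitization.inr (I (matrixMF.ket f o v) - p f * I (matrixMF.ket f o v)) :
        Unitization ℂ _) ∈ N := by
    intro f v hv
    set K := matrixMF.ket f o v with hK
    have hKf : K ∈ (matrixMF ι).face f := matrixMF.ket_mem _ _ _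
    have hK0 : matrixMF.vec o K = 0 := by rw [matrixMF.vec_apply, matrixMF.rep_ket, hv]
    have hKK : matrixMF.vec o (K * star K) = 0 := by
      rw [matrixMF.vec_apply, map_mul, matrixMF.rep_star, Matrix.mul_apply]
      refine Finset.sum_eq_zero fun i _ => ?_
      rw [hK, matrixMF.ket, matrixMF.rep_emb, Matrix.vecMulVec_apply, hv, zero_mul, zero_mul]
    have h1 := hc f _ (matrixMF.vec o) (star K) K (matrixMF.facesStarClosed f _ hKf) hKf
      (Or.inr hK0) hKK
    have hsI : star (I K) = I (star K) := FreeProd.star_inr K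
    have hsp : star (p f) = p f := (FreeProd.star_inl _).trans (congrArg _ (scalarMF.star_unit f))
    have hpp : p f * p f = p f := by
      simp only [p]; rw [← map_mul, scalarMF.unit_mul_unit]
    refine hst.null_left ?_
    have h2 : star (I K - p f * I K) * (I K - p f * I K) =
        I (star K * K) - I (star K) * p f * I K := by
      rw [star_sub, star_mul, hsI, hsp, map_mul]
      have : I (star K) * p f * (p f * I K) = I (star K) * p f * I K := by
        rw [mul_assoc, ← mul_assoc (p f), hpp, mul_assoc]
      rw [sub_mul, mul_sub, mul_sub, this]
      simp [mul_assoc]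
    rw [← Unitization.inr_star, ← Unitization.inr_mul, unitExt_inr, h2, map_sub, h1]
    exact sub_eq_zero.2 (P.restriction_right _ _ _)
  let k : (ι → ℂ) → Unitization ℂ (scalarMF.coprod (matrixMF ι)) := fun v =>
    Unitization.inr (I (matrixMF.ket TwoFaces.white o v))
  have hk : ∀ v w, k (v + w) = k v + k w := by
    intro v w
    simp only [k, matrixMF.ket, Matrix.add_vecMulVec, map_add, Unitization.inr_add]
  have hk' : ∀ (c : ℂ) v, k (c • v) = c • k v := by
    intro c v
    simp only [k, matrixMF.ket, Matrix.smul_vecMulVec, map_smul, Unitization.inr_smul]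
  -- Modulo null vectors, elements act on the vectors `k v` by their matrices, with the units of
  -- `scalarMF` acting as the identity. The null vectors form a left ideal, so generators suffice.
  have hmain : ∀ (y : scalarMF.coprod (matrixMF ι)) (v : ι → ℂ),
      Unitization.inr y * k v - k ((matrixMF.unitRep (unitize _ y)).mulVec v) ∈ N := by
    intro y
    induction y using scalarMF.coprod_induction with
    | unit f =>
      intro v
      rw [unitize_unit, map_one, Matrix.one_mulVec]
      -- The vector is split into a multiple of the state vector, fixed by `hunit`, and a remainder
      -- with `w o = 0`. The remainder is produced by the face of colour `f` instead of the white
      -- one, as `hket` compares equal colours only.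
      let w : ι → ℂ := v - v o • Pi.single o 1
      have hw : w o = 0 := by simp [w]
      have h1 : k v - Unitization.inr (I (matrixMF.ket f o w)) - algebraMap ℂ _ (v o) ∈ N := by
        have := hnull (Unitization.inr (matrixMF.ket TwoFaces.white o v) -
          Unitization.inr (matrixMF.ket f o w) - algebraMap ℂ _ (v o)) fun i => by
            simp only [map_sub, matrixMF.unitRep_inr, AlgHom.commutes, Matrix.sub_apply,
              matrixMF.rep_ket, Matrix.algebraMap_matrix_apply, w, Pi.sub_apply, Pi.smul_apply]
            by_cases hi : i = o
            · subst hi; simp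
            · simp [hi]
        rwa [map_sub, map_sub, unitMap_inr, unitMap_inr, AlgHom.commutes] at this
      have h2 := hket f w hw
      have h3 := N.smul_mem (v o) (hunit f)
      have h4 := sub_mem (add_mem (sub_mem (mul_mem_nullSpace h1 (Unitization.inr (p f))) h2) h3) h1
      convert h4 using 1
      rw [Algebra.algebraMap_eq_smul_one, Unitization.inr_sub, Unitization.inr_mul, mul_sub, mul_sub,
        mul_smul_comm, mul_one]
      module
    | hr d =>
      intro v
      rw [unitize_inr, matrixMF.unitRep_inr]
      have := hnull (Unitization.inr (d * matrixMF.ket TwoFaces.white o v -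
        matrixMF.ket TwoFaces.white o ((matrixMF.rep d).mulVec v))) fun i => by
          rw [matrixMF.unitRep_inr, map_sub, map_mul, Matrix.sub_apply, matrixMF.rep_ket,
            Matrix.mul_apply, sub_eq_zero]
          simp only [matrixMF.rep_ket]
          rfl
      rwa [unitMap_inr, map_sub, map_mul, Unitization.inr_sub, Unitization.inr_mul] at this
    | zero =>
      intro v
      have : k 0 = 0 := by simpa using hk' 0 0
      simp [this]
    | add x y hx hy =>
      intro v
      have := add_mem (hx v) (hy v)
      rw [map_add, map_add, Matrix.add_mulVec, hk, Unitization.inr_add, add_mul, add_sub_add_comm]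
      exact this
    | mul x y hx hy =>
      intro v
      have := add_mem (mul_mem_nullSpace (hy v) (Unitization.inr x))
        (hx ((matrixMF.unitRep (unitize _ y)).mulVec v))
      rw [mul_sub, sub_add_sub_cancel, ← mul_assoc, ← Unitization.inr_mul,
        Matrix.mulVec_mulVec, ← map_mul, ← map_mul] at this
      exact this
    | smul c x hx =>
      intro v
      have := N.smul_mem c (hx v)
      rw [map_smul, map_smul, Matrix.smul_mulVec, hk', Unitization.inr_smul, smul_mul_assoc,
        ← smul_sub]
      exact this
  have hone : k (Pi.single o 1) - 1 ∈ N := by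
    have := hnull (Unitization.inr (matrixMF.ket TwoFaces.white o (Pi.single o 1)) - 1) fun i => by
      rw [map_sub, matrixMF.unitRep_inr, map_one, Matrix.sub_apply, matrixMF.rep_ket,
        Matrix.one_apply, Pi.single_apply, sub_self]
    rwa [map_sub, unitMap_inr, map_one] at this
  have h1 := hone (Unitization.inr x)
  have h2 := hmain x (Pi.single o 1) 1
  rw [mul_sub, map_sub, mul_one, unitExt_inr, sub_eq_zero] at h1
  rw [one_mul, map_sub, sub_eq_zero, h1] at h2
  rw [h2]
  simp only [k, unitExt_inr]
  refine (P.restriction_right _ _ _).trans ?_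
  rw [matrixMF.vec_apply, matrixMF.rep_ket, Matrix.mulVec_single_one]
  rfl

end UniversalProduct

/-! ## Pure noncrossing words -/

theorem List.sublist_of_mem₂ {α : Type*} {l₁ l₂ : List α} {x y : α} (hx : x ∈ l₁) (hy : y ∈ l₂) :
    [x, y].Sublist (l₁ ++ l₂) :=
  (List.singleton_sublist.2 hx).append (List.singleton_sublist.2 hy)

/-- The class of the first letter of a word consists of neighbouring letters, or it has a gap. -/
theorem List.class_head_interval_or_gap {L K : Type*} (b : L → K) (y : L) (m : List L) :
    (∃ t r, m = t ++ r ∧ (∀ z ∈ y :: t, b z = b y) ∧ ∀ z ∈ r, b z ≠ b y) ∨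
      ∃ s y₁ r y₂ r', y :: m = s ++ y₁ :: r ++ y₂ :: r' ∧ r ≠ [] ∧ b y₁ = b y ∧ b y₂ = b y ∧
        ∀ z ∈ r, b z ≠ b y := by
  classical
  induction m generalizing y with
  | nil => exact Or.inl ⟨[], [], by simp⟩
  | cons a m ih =>
    by_cases ha : b a = b y
    · rcases ih a with ⟨t, r, rfl, h₁, h₂⟩ | ⟨s, y₁, r, y₂, r', h, hr, h₁, h₂, h₃⟩
      · rw [ha] at h₁ h₂
        exact Or.inl ⟨a :: t, r, rfl, by simpa using h₁, h₂⟩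
      · rw [ha] at h₁ h₂ h₃
        exact Or.inr ⟨y :: s, y₁, r, y₂, r', by rw [h]; simp, hr, h₁, h₂, h₃⟩
    · by_cases h : ∃ z ∈ m, b z = b y
      · have key : ∀ l : List L, (∃ z ∈ l, b z = b y) →
            ∃ r y₂ r', l = r ++ y₂ :: r' ∧ b y₂ = b y ∧ ∀ z ∈ r, b z ≠ b y := by
          intro l hl
          induction l with
          | nil => simp at hl
          | cons c l ihl =>
            by_cases hc : b c = b y
            · exact ⟨[], c, l, rfl, hc, by simp⟩
            · obtain ⟨r, y₂, r', rfl, h₁, h₂⟩ := ihl (by simpa [hc] using hl)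
              exact ⟨c :: r, y₂, r', rfl, h₁, by simpa [hc] using h₂⟩
        obtain ⟨r, y₂, r', rfl, h₁, h₂⟩ := key m h
        exact Or.inr ⟨[], y, a :: r, y₂, r', by simp, by simp, rfl, h₁, by simpa [ha] using h₂⟩
      · push Not at h
        exact Or.inl ⟨[], a :: m, by simp, by simp, by simpa [ha] using h⟩

/-- Inside the gap between two letters of the same class of a noncrossing word, there is a class
which consists of neighbouring letters. -/
theorem List.exists_interval_class {L K : Type*} (b : L → K) {x x' : L} {w₁ w₂ m : List L}
    (hm : m ≠ []) (hx : b x = b x') (hmx : ∀ y ∈ m, b y ≠ b x)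
    (hw : ∀ y₁ y₂ y₃ y₄, [y₁, y₂, y₃, y₄].Sublist (w₁ ++ x :: m ++ x' :: w₂) → b y₁ = b y₃ →
      b y₂ = b y₄ → b y₁ = b y₂) :
    ∃ (u v u' : List L) (κ : K), w₁ ++ x :: m ++ x' :: w₂ = u ++ v ++ u' ∧ u ≠ [] ∧ v ≠ [] ∧
      u' ≠ [] ∧ (∀ y ∈ v, b y = κ) ∧ (∀ y ∈ u ++ u', b y ≠ κ) ∧
      ∃ z y z', [z, y, z'].Sublist (w₁ ++ x :: m ++ x' :: w₂) ∧ b z = b z' ∧ b y ≠ b z ∧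
        b y = κ := by
  induction hn : m.length using Nat.strong_induction_on generalizing x x' w₁ w₂ m with
  | _ n ih =>
  obtain ⟨y, m, rfl⟩ := List.exists_cons_of_ne_nil hm
  have hy : b y ≠ b x := hmx y (by simp)
  have hxy : [x, y].Sublist (w₁ ++ [x] ++ [y]) := sublist_of_mem₂ (by simp) (by simp)
  -- A class meeting both the gap and its outside would cross the class of `x`, so the class of `y`
  -- stays inside the gap.
  have hy₁ : ∀ z ∈ w₁, b z ≠ b y := fun z hz hzy => hy <| hzy.symm.trans <| hw z x y x' (by
    have h1 : [z, x].Sublist (w₁ ++ [x]) := sublist_of_mem₂ hz (List.mem_singleton_self x)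
    have h2 : [y, x'].Sublist (y :: m ++ x' :: w₂) :=
      sublist_of_mem₂ List.mem_cons_self List.mem_cons_self
    simpa using h1.append h2) hzy hx
  have hy₂ : ∀ z ∈ w₂, b z ≠ b y := fun z hz hzy => hy <| Eq.symm <| hw x y x' z (by
    have h2 : [x', z].Sublist ((m ++ [x']) ++ w₂) := sublist_of_mem₂ (by simp) hz
    simpa using hxy.append h2) hx hzy.symm
  -- Either the class of `y` is an interval as required, or it has a strictly shorter gap of its
  -- own, to which the induction hypothesis applies.
  rcases List.class_head_interval_or_gap b y m with
    ⟨t, r, rfl, ht, hr⟩ | ⟨s, y₁, r, y₂, r', h, hr, h₁, h₂, h₃⟩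
  · refine ⟨w₁ ++ [x], y :: t, r ++ x' :: w₂, b y, by simp, by simp, by simp, by simp, ht, ?_,
      x, y, x', ?_, hx, hy, rfl⟩
    · intro z hz
      simp only [List.mem_append, List.mem_cons, List.not_mem_nil, or_false] at hz
      rcases hz with (hz | rfl) | hz | rfl | hz
      · exact hy₁ z hz
      · exact hy.symm
      · exact hr z hz
      · rw [← hx]; exact hy.symm
      · exact hy₂ z hz
    · simp
  · have e : w₁ ++ x :: (y :: m) ++ x' :: w₂ =
        (w₁ ++ x :: s) ++ y₁ :: r ++ y₂ :: (r' ++ x' :: w₂) := by rw [h]; simp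
    have hlen : r.length < n := by
      rw [← hn, h]
      simp only [List.length_append, List.length_cons]
      omega
    rw [e] at hw
    simp only [e]
    exact ih _ hlen hr (h₁.trans h₂.symm) (fun z hz => by rw [h₁]; exact h₃ z hz) hw rfl

/-! ### Evaluation of pure noncrossing words -/

namespace UniversalProduct

variable {P : UniversalProduct.{u} TwoFaces}

theorem IsSymmetric.prod_inl_mul_inr (hS : P.IsSymmetric) (hP : P.IsPositive)
    {A B : MFAlg.{u} TwoFaces} (φ : A.Functional) (ψ : B.Functional) (a : A) (b : B) :
    P.prod φ ψ (MFAlg.inl a * MFAlg.inr b) = φ a * ψ b := by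
  rw [hS, map_mul, MFAlg.coprodSwap_inl, MFAlg.coprodSwap_inr, prod_inr_mul_inl hP, mul_comm]

/-- An iterated product of copies of a functional is a product of two functionals, the first of
which is any of the factors. -/
theorem IsSymmetric.exists_factor (hS : P.IsSymmetric) (A : MFAlg.{u} TwoFaces) (φ : A.Functional)
    {k : ℕ} (κ₀ : Fin (k + 1)) :
    ∃ (R : MFAlg.{u} TwoFaces) (ρ : R.Functional)
      (Θ : MFAlg.iterCoprod k (fun _ => A) →ₙₐ[ℂ] A.coprod R) (j : Fin (k + 1) → A →ₙₐ[ℂ] R),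
      MFAlg.IsFaced Θ ∧ (∀ x, Θ (MFAlg.iterIncl k (fun _ => A) κ₀ x) = MFAlg.inl x) ∧
      (∀ κ ≠ κ₀, ∀ x, Θ (MFAlg.iterIncl k (fun _ => A) κ x) = MFAlg.inr (j κ x)) ∧
      ∀ x, P.iterProd k (fun _ => A) (fun _ => φ) x = P.prod φ ρ (Θ x) := by
  induction k with
  | zero =>
    obtain rfl : κ₀ = 0 := Fin.fin_one_eq_zero κ₀
    exact ⟨A, φ, MFAlg.inl, fun _ => NonUnitalAlgHom.id ℂ A, MFAlg.isFaced_inl, fun _ => rfl,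
      fun κ hκ => absurd (Fin.fin_one_eq_zero κ) hκ, fun x => (P.restriction_left φ φ x).symm⟩
  | succ k ih =>
    induction κ₀ using Fin.cases with
    | zero =>
      refine ⟨MFAlg.iterCoprod k fun _ => A, P.iterProd k (fun _ => A) fun _ => φ,
        NonUnitalAlgHom.id ℂ _, Fin.cases 0 (MFAlg.iterIncl k fun _ => A), MFAlg.isFaced_id _,
        fun _ => rfl, fun κ hκ x => ?_, fun _ => rfl⟩
      obtain ⟨κ, rfl⟩ := Fin.exists_succ_eq.2 hκ
      rfl
    | succ κ₀ =>
      obtain ⟨R, ρ, Θ, j, hΘ, h₀, h₁, h₂⟩ := ih κ₀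
      refine ⟨A.coprod R, P.prod φ ρ,
        (exchange A A R).comp (MFAlg.coprodMap (NonUnitalAlgHom.id ℂ A) Θ),
        Fin.cases MFAlg.inl fun κ => MFAlg.inr.comp (j κ),
        (isFaced_exchange _ _ _).comp (MFAlg.isFaced_coprodMap (MFAlg.isFaced_id A) hΘ),
        fun x => ?_, fun κ hκ x => ?_, fun x => ?_⟩
      · refine Eq.trans (congrArg (exchange A A R) ((MFAlg.coprodMap_inr _ _ _).trans
          (congrArg _ (h₀ x)))) (exchange_inr_inl _ _ _ x)
      · induction κ using Fin.cases with
        | zero =>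
          exact Eq.trans (congrArg (exchange A A R) (MFAlg.coprodMap_inl _ _ _))
            (exchange_inl _ _ _ x)
        | succ κ =>
          exact Eq.trans (congrArg (exchange A A R) ((MFAlg.coprodMap_inr _ _ _).trans
            (congrArg _ (h₁ κ (fun h => hκ (congrArg _ h)) x)))) (exchange_inr_inr _ _ _ _)
      · refine (P.prod_comp (MFAlg.isFaced_id A) hΘ (fun _ => rfl) h₂ x).trans ?_
        exact hS.prod_exchange φ φ ρ _

/-- Absorption of units allows to remove an element of a face. -/
theorem AbsorbsUnits.prod_inr_inl_inr (hU : P.AbsorbsUnits) {A B : MFAlg.{u} TwoFaces}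
    (φ : A.Functional) (ψ : B.Functional) {f : TwoFaces} {a : A} (ha : a ∈ A.face f) (b b' : B) :
    P.prod φ ψ (MFAlg.inr b * MFAlg.inl a * MFAlg.inr b') = φ a * ψ (b * b') := by
  rw [UniversalProduct.prod_inr_inl_inr P φ ψ ha, hU, map_mul (unitize B), map_mul (unitize B), unitize_unit, unitize_inr,
    unitize_inr, mul_one, ← Unitization.inr_mul, unitExt_inr]

section Word

variable {L : Type} {k : ℕ} (b : L → Fin (k + 1)) (f : L → TwoFaces)

/-- A product of copies of a functional takes the value `1` at a pure noncrossing word if the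
functional takes the value `1` at all its blocks. -/
theorem AbsorbsUnits.iterProd_eq_one (hU : P.AbsorbsUnits) (hP : P.IsPositive) (hS : P.IsSymmetric)
    {A : MFAlg.{u} TwoFaces} (φ : A.Functional) {a : L → A} (ha : ∀ ℓ, a ℓ ∈ A.face (f ℓ))
    {w : List L} (h0 : w ≠ [])
    (hφ : ∀ κ, w.filter (fun ℓ => b ℓ = κ) ≠ [] →
      φ (listProd ((w.filter fun ℓ => b ℓ = κ).map a)) = 1)
    (hw : ∀ x y x' y', [x, y, x', y'].Sublist w → b x = b x' → b y = b y' → b x = b y)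
    (hf : ∀ x y x', [x, y, x'].Sublist w → b x = b x' → b y ≠ b x →
      ∀ z ∈ w, b z = b y → f z = f y) :
    P.iterProd k (fun _ => A) (fun _ => φ)
      (listProd (w.map fun ℓ => MFAlg.iterIncl k (fun _ => A) (b ℓ) (a ℓ))) = 1 := by
  induction hn : w.length using Nat.strong_induction_on generalizing w with
  | _ n ih =>
  let g : L → MFAlg.iterCoprod k (fun _ => A) := fun ℓ => MFAlg.iterIncl k (fun _ => A) (b ℓ) (a ℓ)
  change P.iterProd k (fun _ => A) (fun _ => φ) (listProd (w.map g)) = 1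
  -- Any class can be made the first factor of a product of two functionals; words avoiding the
  -- class then lie in the second factor.
  have hfac : ∀ κ : Fin (k + 1), ∃ (R : MFAlg.{u} TwoFaces) (ρ : R.Functional)
      (Θ : MFAlg.iterCoprod k (fun _ => A) →ₙₐ[ℂ] A.coprod R),
      (∀ x, P.iterProd k (fun _ => A) (fun _ => φ) x = P.prod φ ρ (Θ x)) ∧
      (∀ v : List L, (∀ ℓ ∈ v, b ℓ = κ) → Θ (listProd (v.map g)) =
        MFAlg.inl (listProd (v.map a))) ∧
      ∀ v : List L, (∀ ℓ ∈ v, b ℓ ≠ κ) → ∃ y, Θ (listProd (v.map g)) = MFAlg.inr y := by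
    intro κ
    obtain ⟨R, ρ, Θ, j, -, h₁, h₂, h₃⟩ := hS.exists_factor A φ κ
    refine ⟨R, ρ, Θ, h₃, fun v hv => ?_, fun v hv => ⟨listProd (v.map fun ℓ => j (b ℓ) (a ℓ)), ?_⟩⟩
    · rw [map_listProd, map_listProd, List.map_map, List.map_map]
      refine congrArg _ (List.map_congr_left fun ℓ hℓ => ?_)
      simp only [Function.comp_apply, g, hv ℓ hℓ, h₁]
    · rw [map_listProd, map_listProd, List.map_map, List.map_map]
      refine congrArg _ (List.map_congr_left fun ℓ hℓ => ?_)
      simp only [Function.comp_apply, g, h₂ _ (hv ℓ hℓ)]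
  have hblock : ∀ {u v u' : List L} {κ : Fin (k + 1)}, w = u ++ v ++ u' → v ≠ [] →
      (∀ y ∈ v, b y = κ) → (∀ y ∈ u ++ u', b y ≠ κ) → φ (listProd (v.map a)) = 1 := by
    intro u v u' κ h hv hvκ huκ
    have : w.filter (fun ℓ => b ℓ = κ) = v := by
      rw [h, List.filter_append, List.filter_append, (List.filter_eq_nil_iff (l := u)).2,
        List.filter_eq_self.2, List.filter_eq_nil_iff.2]
      · simp
      · intro y hy; simpa using huκ y (by simp [hy])
      · intro y hy; simpa using hvκ y hy
      · intro y hy; simpa using huκ y (by simp [hy])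
    rw [← this]
    exact hφ κ (by rwa [this])
  -- Removing a complete class which is an interval leaves a shorter word with the same hypotheses,
  -- to which the induction hypothesis applies.
  have hrest : ∀ {u v u' : List L} {κ : Fin (k + 1)}, w = u ++ v ++ u' → v ≠ [] → u ++ u' ≠ [] →
      (∀ y ∈ v, b y = κ) → (∀ y ∈ u ++ u', b y ≠ κ) →
      P.iterProd k (fun _ => A) (fun _ => φ) (listProd ((u ++ u').map g)) = 1 := by
    intro u v u' κ h hv hu hvκ huκ
    have hsub : (u ++ u').Sublist w := by
      rw [h]; exact (List.sublist_append_left u v).append (List.Sublist.refl u')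
    refine ih _ ?_ hu (fun κ' hκ' => ?_) (fun x y x' y' h' => hw x y x' y' (h'.trans hsub))
      (fun x y x' h' e e' z hz => hf x y x' (h'.trans hsub) e e' z (hsub.subset hz)) rfl
    · rw [← hn, h]
      have := List.length_pos_iff.2 hv
      simp only [List.length_append]; omega
    · have hne : κ' ≠ κ := by
        rintro rfl
        refine hκ' (List.filter_eq_nil_iff.2 fun y hy => ?_)
        simpa using huκ y hy
      have : w.filter (fun ℓ => b ℓ = κ') = (u ++ u').filter fun ℓ => b ℓ = κ' := by
        rw [h]
        simp only [List.filter_append]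
        rw [(List.filter_eq_nil_iff (l := v)).2, List.append_nil]
        intro y hy
        simpa [hvκ y hy] using hne.symm
      rw [← this] at hκ' ⊢
      exact hφ κ' hκ'
  obtain ⟨x, m, rfl⟩ := List.exists_cons_of_ne_nil h0
  -- If the class of the first letter is an initial interval, it splits off by factorization.
  -- Otherwise it has a gap, and inside the gap there is an interval class with an inner leg; `hf`
  -- makes it monochrome, so its product is a face element which absorption removes.
  rcases List.class_head_interval_or_gap b x m with
    ⟨t, r, rfl, ht, hr⟩ | ⟨s, y₁, r, y₂, r', h, hr, h₁, h₂, h₃⟩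
  · have hsplit : x :: (t ++ r) = [] ++ (x :: t) ++ r := by simp
    have hone := hblock hsplit (by simp) ht (by simpa using hr)
    obtain ⟨R, ρ, Θ, h₁, h₂, h₃⟩ := hfac (b x)
    by_cases hr0 : r = []
    · rw [hsplit, hr0, List.nil_append, List.append_nil, h₁, h₂ _ ht, P.restriction_left, hone]
    · obtain ⟨y, hy⟩ := h₃ r hr
      have := hrest hsplit (by simp) (by simpa using hr0) ht (by simpa using hr)
      rw [List.nil_append, h₁, hy, P.restriction_right] at this
      rw [hsplit, List.nil_append, List.map_append, listProd_append (by simp) (by simpa using hr0),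
        h₁, map_mul, h₂ _ ht, hy, hS.prod_inl_mul_inr hP, hone, this, one_mul]
  · rw [h] at hw
    obtain ⟨u, v, u', κ, e, hu, hv, hu', hvκ, huκ, z, y, z', hin, hz, hy, rfl⟩ :=
      List.exists_interval_class b hr (h₁.trans h₂.symm) (fun z hz => by rw [h₁]; exact h₃ z hz) hw
    rw [← h] at e hin
    have hone := hblock e hv hvκ huκ
    have hr := hrest e hv (by simp [hu]) hvκ huκ
    obtain ⟨R, ρ, Θ, h₁, h₂, h₃⟩ := hfac (b y)
    obtain ⟨X, hX⟩ := h₃ u fun ℓ hℓ => huκ ℓ (by simp [hℓ])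
    obtain ⟨Y, hY⟩ := h₃ u' fun ℓ hℓ => huκ ℓ (by simp [hℓ])
    have hvf : listProd (v.map a) ∈ A.face (f y) := by
      refine listProd_mem _ fun c hc => ?_
      obtain ⟨ℓ, hℓ, rfl⟩ := List.mem_map.1 hc
      rw [← hf z y z' hin hz hy ℓ (by rw [e]; simp [hℓ]) (hvκ ℓ hℓ)]
      exact ha ℓ
    rw [List.map_append, listProd_append (by simpa using hu) (by simpa using hu'), h₁,
      map_mul Θ, hX, hY, ← map_mul, P.restriction_right] at hr
    rw [e, List.map_append, List.map_append, listProd_append (by simp [hu]) (by simpa using hu'),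
      listProd_append (by simpa using hu) (by simpa using hv), h₁, map_mul Θ, map_mul Θ, hX,
      hY, h₂ v hvκ, hU.prod_inr_inl_inr φ ρ hvf, hone, hr, one_mul]

end Word

end UniversalProduct

/-! ## Pure noncrossing partitions and unit preservation -/

namespace UniversalProduct

variable {P : UniversalProduct.{u} TwoFaces}

theorem _root_.LegPartition.filter_finRange {n k : ℕ} {π : LegPartition n}
    {b : Fin (n + 1) → Fin (k + 1)} (hb : ∀ i j, b i = b j ↔ π.SameBlock i j) (ℓ : Fin (n + 1)) :
    (List.finRange (n + 1)).filter (fun m => b m = b ℓ) = π.word ℓ := by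
  have hs : ((List.finRange (n + 1)).filter (fun m => b m = b ℓ)).Pairwise (· < ·) :=
    (List.pairwise_lt_finRange _).sublist List.filter_sublist
  rw [LegPartition.word, ← (List.toFinset_sort (· ≤ ·) (hs.imp fun h => h.ne)).2
    (hs.imp fun h => h.le)]
  congr 1
  ext m
  have h1 : m ∈ π.part ℓ ↔ m ∈ π.word ℓ := by rw [LegPartition.word, Finset.mem_sort]
  rw [h1, π.mem_word, ← hb]
  simp

/-- The coefficient is the value of the word in the indicator law of the partition, which gives each
block the value `1`; removing the blocks one by one does not change it. -/
theorem AbsorbsUnits.highestCoefficient_eq_one (hU : P.AbsorbsUnits) (hP : P.IsPositive)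
    (hS : P.IsSymmetric) {α : MFPartition TwoFaces → ℂ} (hα : P.IsHighestCoefficients α)
    {p : MFPartition TwoFaces} (hp : p.IsPureNoncrossing) : α p = 1 := by
  obtain ⟨k, b, hb, hb'⟩ := p.π.exists_enumeration
  rw [hα.eq_wordValue p hb hb', wordValue, EvalFamily.ofLaw,
    P.iterFamily_ev_subst fun ℓ => (b ℓ, p.f ℓ)]
  refine hU.iterProd_eq_one b p.f hP hS _ (fun ℓ => freeMF.gen_mem ℓ) (by simp)
    (fun κ hκ => ?_) (fun x y x' y' h hx hy => ?_) fun x y x' h hx hy z _ hz => ?_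
  · obtain ⟨ℓ, rfl⟩ := hb κ
    rw [LegPartition.filter_finRange hb'] at hκ ⊢
    rw [freeMF.functional_word _ hκ, indicatorLaw, if_pos ⟨ℓ, rfl⟩]
  · have hlt := (List.pairwise_lt_finRange _).sublist h
    simp only [List.pairwise_cons, List.mem_cons, List.not_mem_nil, or_false, forall_eq_or_imp,
      forall_eq] at hlt
    obtain ⟨β, hβ, hxβ, hx'β⟩ := (hb' _ _).1 hx
    obtain ⟨γ, hγ, hyγ, hy'γ⟩ := (hb' _ _).1 hy
    have := hp.1 x y x' y' hlt.1.1 hlt.2.1.1 hlt.2.2.1 β hβ γ hγ hxβ hx'β hyγ hy'γ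
    exact (hb' _ _).2 ⟨β, hβ, hxβ, this ▸ hyγ⟩
  · have hlt := (List.pairwise_lt_finRange _).sublist h
    simp only [List.pairwise_cons, List.mem_cons, List.not_mem_nil, or_false, forall_eq_or_imp,
      forall_eq] at hlt
    obtain ⟨β, hβ, hxβ, hx'β⟩ := (hb' _ _).1 hx
    obtain ⟨γ, hγ, hzγ, hyγ⟩ := (hb' _ _).1 hz
    exact hp.2 γ hγ ⟨y, hyγ, x, x', hlt.1.1, hlt.2.1, β, hβ, hxβ, hx'β,
      fun h => hy ((hb' _ _).2 ⟨β, hβ, h, hxβ⟩)⟩ z hzγ y hyγ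

/-- If the partitions of three legs of a colour into the outer legs and the inner one have nonzero
highest coefficients, then units are absorbed. -/
theorem absorbsUnits_of_pNC_subset (hP : P.IsPositive) (h : pNC ⊆ P.partitionSet) :
    P.AbsorbsUnits := by
  refine absorbsUnits_of_unit_coefficient hP fun f => ?_
  obtain ⟨c, hc⟩ := P.exists_unit_coefficient f
  suffices hne : c ≠ 0 by
    have hc1 : c = 1 := mul_left_cancel₀ hne ((unit_coefficient_mul_self hP hc).trans (mul_one c).symm)
    simpa only [hc1, one_mul] using hc
  -- The partition of three legs into the outer pair and the middle leg, the latter taken from the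
  -- first factor so that it sits in the place of the unit. It is noncrossing because a crossing
  -- needs four legs.
  let b : Fin 3 → Fin 2 := ![1, 0, 1]
  let e : Fin 3 → List (Fin 3) := ![[0, 2], [1], [0, 2]]
  have he : IsWordPartition e := ⟨by decide, by decide, by decide⟩
  have hbe : ∀ i j, b i = b j ↔ e i = e j := by decide
  obtain ⟨π, hπ⟩ := LegPartition.exists_word_eq he (by decide)
  let p : MFPartition TwoFaces := ⟨2, fun _ => f, π⟩
  have hb : Function.Surjective b := by decide
  have hb' : ∀ i j, b i = b j ↔ p.π.SameBlock i j := by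
    intro i j
    rw [← LegPartition.word_eq_iff, hπ]
    exact hbe i j
  obtain ⟨α, hα, hαp⟩ := h (show p ∈ pNC from ⟨fun i j k l hij hjk hkl => by
    have := l.2
    simp only [Fin.lt_def] at hij hjk hkl
    simp only [p] at this
    omega, fun _ _ _ _ _ _ _ => rfl⟩)
  rw [hα.eq_wordValue p hb hb', wordValue, EvalFamily.ofLaw,
    P.iterFamily_ev_subst fun ℓ => (b ℓ, p.f ℓ)] at hαp
  rintro rfl
  refine hαp ?_
  set φ := freeMF.functional.{u} (fun ℓ => (b ℓ, p.f ℓ).2) (indicatorLaw p.π.word)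
  have hφ : ∀ v, v ≠ [] → φ (listProd (v.map freeMF.gen)) = indicatorLaw e v := fun v hv => by
    rw [← hπ]; exact freeMF.functional_word _ hv
  have hmem : ∀ ℓ, freeMF.gen.{u} (c := fun ℓ => (b ℓ, p.f ℓ).2) ℓ ∈
    (freeMF.{u} (Fin 3) fun ℓ => (b ℓ, p.f ℓ).2).face f := fun ℓ => freeMF.gen_mem ℓ
  have h0 : φ (freeMF.gen 0) = 0 := by
    refine (hφ [0] (by simp)).trans (if_neg (by decide))
  have h20 : φ (freeMF.gen 2 * freeMF.gen 0) = 0 := by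
    refine (hφ [2, 0] (by simp)).trans (if_neg (by decide))
  -- The middle letter is replaced by a unit, after which the value is a multiple of the coefficient
  -- `c`, here assumed to be zero.
  have key := P.prod_inr_inl_inr φ φ (hmem 1) (freeMF.gen 0) (freeMF.gen 2)
  rw [hc _ φ _ _ (hmem 0) (hmem 2) (Or.inl h0) h20, zero_mul, mul_zero] at key
  refine Eq.trans (congrArg (P.prod φ φ) ?_) key
  exact (mul_assoc _ _ _).symm

end UniversalProduct

theorem corollary9p7 (P : UniversalProduct.{u} TwoFaces)
    (hpos : P.IsPositive) (hsymm : P.IsSymmetric) :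
    (∃! α : MFPartition TwoFaces → ℂ, P.IsHighestCoefficients α) ∧
      (P.UnitPreserving ↔ pNC ⊆ P.partitionSet) := by
  have hex := UniversalProduct.existsUnique_isHighestCoefficients hpos hsymm
  refine ⟨hex, fun hU p hp => ?_,
    fun h => (UniversalProduct.absorbsUnits_of_pNC_subset hpos h).unitPreserving hsymm⟩
  obtain ⟨α, hα, -⟩ := hex
  refine ⟨α, hα, ?_⟩
  rw [hU.absorbsUnits.highestCoefficient_eq_one hpos hsymm hα hp]
  exact one_ne_zero
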